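/- **Notation.** For $\xi\in\mathbb R^d$ write $|\xi|=|\xi_1|+\dots+|\xi_d|$, and let $\mathbb R^d_I=\{\xi\in\mathbb R^d:\xi_i\ge 0 \text{ for all } i\}$ be the first octant. Fix a smooth $\psi:\mathbb R^d\to\mathbb R$ with $\psi=1$ on the closed unit ball and $\operatorname{supp}\psi$ equal to the closed ball of radius $5/4$, both centred at $0$ (both balls taken in the Euclidean length, or both in the length $|\cdot|$). Put $\varphi(\xi)=\psi(\xi)-\psi(2\xi)$, $\Delta_0=\mathcal F^{-1}\psi\mathcal F$, $\Delta_j=\mathcal F^{-1}\varphi(2^{-j}\cdot)\mathcal F$ for $j\ge1$, and $2^{s|\nabla|}=\mathcal F^{-1}2^{s|\xi|}\mathcal F$, where $\mathcal F$ (also written $\widehat{\ }$) is the Fourier transform in $x$. For $\mathbb A\subset\mathbb Z_+=\{0,1,2,\dots\}$ and $q<\infty$ let $$\|u\|_{\tilde L^\gamma(\mathbb R,B^{\sigma,s}_{r,q}(\mathbb A))}=\Big(\sum_{j\in\mathbb A}2^{\sigma jq}\,\|2^{s|\nabla|}\Delta_ju\|^q_{L^\gamma_tL^r_x(\mathbb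 R\times\mathbb R^d)}\Big)^{1/q}\in[0,\infty],\qquad B^{\sigma,s}_{r,q}=B^{\sigma,s}_{r,q}(\mathbb Z_+).$$ For $\lambda>1$ let $\mathbb Z_\lambda=\{j\in\mathbb Z_+:j\le\log_2\lambda\}$ and $\mathbb Z_\lambda^c=\mathbb Z_+\setminus\mathbb Z_\lambda$. The norm of $X\cap Y$ is $\max(\|\cdot\|_X,\|\cdot\|_Y)$. **Lemma 4.2.** Let $d\ge2$, $p=2(d+1)/(d-1)$, $1/p+1/p'=1$, $\delta(p)=1/2-1/p$, and $\sigma>1/2$. There is a constant $C\ge1$, depending only on $d$, $\sigma$ and $\psi$, such that the following holds for all $\alpha\in\mathbb N$ with $\alpha\ge4/(d-1)$ and $\sigma\ge\sigma_c:=d/2-2/\alpha$, all $s<0$ and all $\lambda>1$. Let $v$ be such that $\widehat v(t)=\widehat v(t,\cdot)$ is measurable in $(t,\xi)$ and, for almost every $t\in\mathbb R$, is a locally integrable function on $\mathbb R^d$ with $\operatorname{supp}\widehat v(t)\subset\mathbb R^d_I$. (If $v\in\tilde L^\infty(\mathbb R,B^{\sigma_c,s}_{2,2})$, then $\widehat v(t)$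 is automatically a locally integrable function for almost every $t$.) The power $v^{1+\alpha}$ is understood through its Fourier transform in $x$, the $(1+\alpha)$-fold convolution $\widehat v(t)*\dots*\widehat v(t)$, which is well defined because of the support condition. Then $$\begin{aligned} \|v^{1+\alpha}\|_{\tilde L^{p'}(\mathbb R,B^{\sigma-1/2,s}_{p',2}(\mathbb Z_\lambda^c))} \le (C\sqrt\alpha)^{\alpha+C}\Big(&\|v\|_{\tilde L^p(\mathbb R,B^{\sigma-1/2,s}_{p,2}(\mathbb Z_\lambda^c))}\, \|v\|^{4/(d-1)}_{\tilde L^p(\mathbb R,B^{\sigma_c-1/2,s}_{p,2}(\mathbb Z_\lambda^c))\cap\tilde L^p(\mathbb R,B^{\sigma_c-\delta(p),s}_{p,2}(\mathbb Z_\lambda))}\\ &+\lambda^{-1/p}\,\|v\|_{\tilde L^p(\mathbb R,B^{\sigma-\delta(p),s}_{p,2}(\mathbb Z_\lambda))}\, \|v\|^{4/(d-1)}_{\tilde L^p(\mathbb R,B^{\sigma_c-\delta(p),s}_{p,2}(\mathbb Z_\lambda))}\Big)\, \|v\|^{\alpha-4/(d-1)}_{\tilde L^\infty(\mathbb R,B^{\sigma_c,s}_{2,2})}.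 \end{aligned}$$ The inequality is in $[0,\infty]$, with $0\cdot\infty=0$ and $\infty^0=0^0=1$. -/

import Mathlib

open MeasureTheory
open scoped FourierTransform ENNReal ContDiff

namespace NLKG

/-- The space `ℝ^d`. -/
abbrev E (d : ℕ) := EuclideanSpace ℝ (Fin d)

/-- The length `|ξ| = |ξ₁| + ⋯ + |ξ_d|`, which enters the exponential weight `2^{s|ξ|}`. -/
def l1Norm {d : ℕ} (ξ : E d) : ℝ := ∑ i, |ξ i|

/-- The closed first octant `{ξ : ξ_i ≥ 0 for all i}`. -/
def octant (d : ℕ) : Set (E d) := {ξ | ∀ i, 0 ≤ ξ i}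

/-- Smooth cutoffs `ψ`, equal to `1` on the unit ball, with support the ball of radius `5/4`.
The balls are taken in the Euclidean length or in the length `|ξ₁| + ⋯ + |ξ_d|`. -/
def IsCutoff {d : ℕ} (ψ : E d → ℝ) : Prop :=
  ContDiff ℝ ∞ ψ ∧ ∃ N : E d → ℝ, (N = (fun ξ => ‖ξ‖) ∨ N = l1Norm) ∧
    (∀ ξ, N ξ ≤ 1 → ψ ξ = 1) ∧ tsupport ψ = {ξ | N ξ ≤ 5 / 4}

/-- Symbols of the dyadic operators `Δ_j`: `ψ` for `j = 0`, and `φ(2^{-j} ξ)` for `j ≥ 1`,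
where `φ(ξ) = ψ(ξ) - ψ(2ξ)`. -/
noncomputable def dyadicSymbol {d : ℕ} (ψ : E d → ℝ) (j : ℕ) (ξ : E d) : ℝ :=
  if j = 0 then ψ ξ else ψ (((2 : ℝ) ^ j)⁻¹ • ξ) - ψ ((2 : ℝ) • ((2 : ℝ) ^ j)⁻¹ • ξ)

/-- The function `2^{s|∇|} Δ_j f` on `ℝ^d`, for the `f` with Fourier transform `g`. -/
noncomputable def expDelta {d : ℕ} (ψ : E d → ℝ) (s : ℝ) (j : ℕ) (g : E d → ℂ) : E d → ℂ :=
  𝓕⁻ (fun ξ => (((2 : ℝ) ^ (s * l1Norm ξ) * dyadicSymbol ψ j ξ : ℝ) : ℂ) * g ξ)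

/-- The mixed norm `‖ ‖F(t, x)‖_{L^r_x} ‖_{L^γ_t}`, with values in `[0, ∞]`. -/
noncomputable def mixedNorm {d : ℕ} (γ r : ℝ≥0∞) (F : ℝ → E d → ℂ) : ℝ≥0∞ :=
  eLpNorm (fun t => eLpNorm (F t) r volume) γ volume

/-- The norm of `u` in `L̃^γ(ℝ; B^{σ,s}_{r,q}(A))`, `A ⊆ {0, 1, 2, …}`, `q < ∞`, with values in
`[0, ∞]`: the `ℓ^q` norm over `j ∈ A` of `2^{σ j} ‖2^{s|∇|} Δ_j u‖_{L^γ_t L^r_x}`.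
The function `u` is given by its Fourier transform in `x`, `uhat t ξ`. -/
noncomputable def tildeNorm {d : ℕ} (ψ : E d → ℝ) (γ r : ℝ≥0∞) (q σ s : ℝ) (A : Set ℕ)
    (uhat : ℝ → E d → ℂ) : ℝ≥0∞ :=
  (∑' j : A, (ENNReal.ofReal ((2 : ℝ) ^ (σ * ((j : ℕ) : ℝ))) *
    mixedNorm γ r (fun t => expDelta ψ s j (uhat t))) ^ q) ^ (1 / q)

/-- The low frequencies `{j ≥ 0 : j ≤ log₂ lam}`; the high ones are the complement. -/
def lowFreq (lam : ℝ) : Set ℕ := {j | (j : ℝ) ≤ Real.logb 2 lam}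

/-- The `(n+1)`-fold convolution `g * ⋯ * g`: the Fourier transform of the power `f^{1+n}`,
where `f` has Fourier transform `g`. For `g` locally integrable and supported in the octant
the integrals run over bounded sets. -/
noncomputable def convPow {d : ℕ} (g : E d → ℂ) : ℕ → E d → ℂ
  | 0 => g
  | n + 1 => convolution g (convPow g n) (ContinuousLinearMap.mul ℝ ℂ) volume

/-- `p = 2(d+1)/(d-1)`. -/
noncomputable def pExp (d : ℕ) : ℝ := 2 * ((d : ℝ) + 1) / ((d : ℝ) - 1)

/-- `δ(p) = 1/2 - 1/p`. -/
noncomputable def deltaExp (p : ℝ) : ℝ := 1 / 2 - 1 / p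

/-- The critical index `σ_c = d/2 - 2/α`. -/
noncomputable def sigmaC (d α : ℕ) : ℝ := (d : ℝ) / 2 - 2 / (α : ℝ)

end NLKG

namespace NLKG

/-! On the octant the length `|ξ|` is additive, so the weight `2^{s|ξ|}` is multiplicative and
`2^{s|∇|}` passes through products. The claim thus concerns powers of sums of the pieces `w_i =
2^{s|∇|} Δ_i v`. A sum of octant frequencies is at least as large as each summand, so `Δ_k` of the
power sees only `S_{k+2}`, where `S_j = ∑_{i<j} w_i` (`convPow_weight_trunc`,
`IsGauge.pieceHat_convPow`). Telescope `S_{k+2}^{1+α}` into increments `S_{j+1}^{1+α} - S_j^{1+α}`.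
Their frequencies are at most of order `α 2^j`, so only the band `k - α - 2 ≤ j ≤ k + 1` survives
(`IsGauge.expDelta_convPow`). No multilinear expansion is needed, which keeps the dependence on `α`
under control.

Put `n = 4/(d-1)`, so that `p = n + 2` and `p' = p/(n+1)`. An increment is at most `(α+1) |w_j|
U^α`, where `U` bounds `|S_j|` and `|S_{j+1}|`. Hölder's inequality has room for `w_j` and `n`
further factors in `L^p`; the other `α - n` must be paid for in `L^∞`.

If `α > n`, this is pointwise interpolation. Bernstein's inequality gives `|w_i| ≤ 2^{2i/α} β_i`,
with `β` in `ℓ²` controlled by the norm `Z` of `v` at regularity `σ_c`. Also `|w_i| = 2^{-κi} γ_i`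
with `κ = σ_c - 1/2`. Cutting the sum at the best index yields `U ≲ (√α Z)^{1-n/α} G^{n/α}`, where
`G` is the `ℓ²` norm of `γ` (`sum_interp_le`). The factor `√α` is the root of a geometric sum with
ratio `2^{4/α}`. Since `α` is an integer, `κ` is bounded below over all `α > n`.

If `α = n`, then `κ = 0` and interpolation breaks down. Now `p` is an integer, and the embedding of
`B^0_{p,2}` into `L^p` takes over (`IsGauge.exists_eLpNorm'_partSum_le`). By convexity, adding `w_j`
to `S_j` to form `T = S_{j+1}` raises the `p`-th power of the norm by at most `p Re ∫ |T|^{p-2}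
conj(T) w_j`. As `w_j` has frequency about `2^j`, the pairing gains `2^{-j}` at the price of a
derivative of `T`, of size at most `∑_{i≤j} 2^i ‖w_i‖_p`. Schur's test sums the result.

The band is then summed in `k` (`tsum_band_split_le`). Increments with low `j` that reach a high `k`
have `2^j` comparable to at least `λ`, up to a factor exponential in `α`; this produces `λ^{-1/p}`.
-/

open scoped ComplexConjugate

/-! ### Interpolation of dyadic sums between growth and decay -/

/-- If `w` is bounded by `2^{aJ} b + 2^{-κJ} g` for all `J`, and by `g`, it is bounded by the
geometric mean of `b` and `g` with the weights that balance the two terms. -/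
lemma real_interp_le {w b g a κ : ℝ} (hb : 0 < b) (hg : 0 ≤ g) (ha : 0 < a) (hκ : 0 < κ)
    (h0 : w ≤ g) (h : ∀ J : ℕ, w ≤ (2 : ℝ) ^ (a * J) * b + (2 : ℝ) ^ (-κ * J) * g) :
    w ≤ (1 + (2 : ℝ) ^ κ) * b ^ (κ / (a + κ)) * g ^ (a / (a + κ)) := by
  have hs : 0 < a + κ := by positivity
  have e1 : κ / (a + κ) + a / (a + κ) = 1 := by field_simp; ring
  have hk1 : (1 : ℝ) ≤ (2 : ℝ) ^ κ := Real.one_le_rpow (by norm_num) hκ.le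
  -- For `g ≤ b` the balancing index would not be positive, and the bound by `g` is already enough.
  rcases le_or_gt g b with hgb | hgb
  · have : g ≤ b ^ (κ / (a + κ)) * g ^ (a / (a + κ)) := by
      calc g = g ^ (κ / (a + κ)) * g ^ (a / (a + κ)) := by
            rw [← Real.rpow_add_of_nonneg hg (by positivity) (by positivity), e1, Real.rpow_one]
        _ ≤ _ := by gcongr
    rw [mul_assoc]
    nlinarith [Real.rpow_nonneg hb.le (κ / (a + κ)), Real.rpow_nonneg hg (a / (a + κ))]
  · have hg' : 0 < g := hb.trans hgb
    -- The real index at which `2^{ax} b = 2^{-κx} g`. Rounding it down decreases the growing term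
    -- and loses at most `2^κ` in the decaying one.
    set x : ℝ := Real.logb 2 (g / b) / (a + κ) with hx
    have hgb1 : 1 < g / b := by rwa [one_lt_div hb]
    have hx0 : 0 < x := div_pos (Real.logb_pos (by norm_num) hgb1) hs
    have h2x : (2 : ℝ) ^ ((a + κ) * x) = g / b := by
      rw [hx, mul_div_cancel₀ _ hs.ne', Real.rpow_logb (by norm_num) (by norm_num) (by positivity)]
    have hJ1 := Nat.floor_le hx0.le
    have hJ2 := Nat.lt_floor_add_one x
    set J := ⌊x⌋₊
    have key : ∀ t : ℝ, (2 : ℝ) ^ (t * x) = (g / b) ^ (t / (a + κ)) := by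
      intro t
      rw [← h2x, ← Real.rpow_mul (by norm_num)]
      congr 1; field_simp
    have A : (2 : ℝ) ^ (a * J) * b ≤ b ^ (κ / (a + κ)) * g ^ (a / (a + κ)) := by
      calc (2 : ℝ) ^ (a * J) * b ≤ (2 : ℝ) ^ (a * x) * b := by gcongr; norm_num
        _ = (g / b) ^ (a / (a + κ)) * b := by rw [key]
        _ = _ := by
          rw [Real.div_rpow hg hb.le, div_mul_eq_mul_div, mul_comm, mul_div_right_comm]
          congr 1
          nth_rw 1 [← Real.rpow_one b, ← e1]
          rw [Real.rpow_add hb, mul_div_cancel_right₀ _ (by positivity)]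
    have B : (2 : ℝ) ^ (-κ * J) * g ≤ (2 : ℝ) ^ κ * (b ^ (κ / (a + κ)) * g ^ (a / (a + κ))) := by
      calc (2 : ℝ) ^ (-κ * J) * g ≤ (2 : ℝ) ^ (κ + (-κ) * x) * g := by
            gcongr
            · norm_num
            · nlinarith
        _ = (2 : ℝ) ^ κ * ((g / b) ^ (-κ / (a + κ)) * g) := by
            rw [Real.rpow_add (by norm_num), key]; ring
        _ = _ := by
          congr 1
          rw [neg_div, Real.rpow_neg (by positivity), Real.div_rpow hg hb.le, inv_div,
            div_mul_eq_mul_div, mul_div_assoc]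
          congr 1
          nth_rw 1 [← Real.rpow_one g, ← e1]
          rw [Real.rpow_add hg', mul_div_cancel_left₀ _ (by positivity)]
    calc w ≤ _ := h J
      _ ≤ _ := add_le_add A B
      _ = _ := by ring

/-- The hypothesis `hb` is there for `b = 0`, `g = ∞`: the bound then reads `0 · ∞ = 0`, while `h0`
and `h` say nothing about `w`. -/
lemma ennreal_interp_le {w b g : ℝ≥0∞} {a κ : ℝ} (ha : 0 < a) (hκ : 0 < κ) (hb : b = 0 → w = 0)
    (h0 : w ≤ g)
    (h : ∀ J : ℕ, w ≤ ENNReal.ofReal ((2 : ℝ) ^ (a * J)) * b + ENNReal.ofReal ((2 : ℝ) ^ (-κ * J)) * g) :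
    w ≤ ENNReal.ofReal (1 + (2 : ℝ) ^ κ) * b ^ (κ / (a + κ)) * g ^ (a / (a + κ)) := by
  have hs : 0 < a + κ := by positivity
  have h1 : 0 < κ / (a + κ) := by positivity
  have h2 : 0 < a / (a + κ) := by positivity
  have hc : ENNReal.ofReal (1 + (2 : ℝ) ^ κ) ≠ 0 := by
    rw [Ne, ENNReal.ofReal_eq_zero, not_le]; positivity
  by_cases hb0 : b = 0
  · simp [hb hb0]
  by_cases hg0 : g = 0
  · have : w = 0 := le_antisymm (hg0 ▸ h0) bot_le
    simp [this]
  by_cases hgt : g = ⊤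
  · rw [hgt, ENNReal.top_rpow_of_pos h2, ENNReal.mul_top]
    · exact le_top
    · refine mul_ne_zero hc ?_
      simp [ENNReal.rpow_eq_zero_iff, hb0, h1.le]
  by_cases hbt : b = ⊤
  · rw [hbt, ENNReal.top_rpow_of_pos h1, ENNReal.mul_top hc, ENNReal.top_mul]
    · exact le_top
    · simp [ENNReal.rpow_eq_zero_iff, hg0, h2.le]
  have hwt : w ≠ ⊤ := ne_top_of_le_ne_top hgt h0
  lift w to NNReal using hwt
  lift b to NNReal using hbt
  lift g to NNReal using hgt
  have hbpos : 0 < (b : ℝ) := by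
    have : b ≠ 0 := by simpa using hb0
    positivity
  have := real_interp_le (w := w) (b := b) (g := g) hbpos g.2 ha hκ (by exact_mod_cast h0) (by
    intro J
    have hJ := h J
    rw [← ENNReal.ofReal_coe_nnreal, ← ENNReal.ofReal_coe_nnreal (p := b),
      ← ENNReal.ofReal_coe_nnreal (p := g), ← ENNReal.ofReal_mul (by positivity),
      ← ENNReal.ofReal_mul (by positivity), ← ENNReal.ofReal_add (by positivity) (by positivity),
      ENNReal.ofReal_le_ofReal_iff (by positivity)] at hJ
    exact hJ)
  rw [← ENNReal.ofReal_coe_nnreal, ← ENNReal.ofReal_coe_nnreal (p := b),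
      ← ENNReal.ofReal_coe_nnreal (p := g), ENNReal.ofReal_rpow_of_nonneg (by positivity) h1.le,
      ENNReal.ofReal_rpow_of_nonneg (by positivity) h2.le,
      ← ENNReal.ofReal_mul (by positivity), ← ENNReal.ofReal_mul (by positivity)]
  exact ENNReal.ofReal_le_ofReal this

lemma ennreal_cauchy_schwarz {ι : Type*} (F : Finset ι) (f g : ι → ℝ≥0∞) :
    ∑ i ∈ F, f i * g i ≤ (∑ i ∈ F, f i ^ (2 : ℝ)) ^ (1 / 2 : ℝ) * (∑ i ∈ F, g i ^ (2 : ℝ)) ^ (1 / 2 : ℝ) :=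
  ENNReal.inner_le_Lp_mul_Lq F f g Real.HolderConjugate.two_two

/-- Real powers of `2` in `[0, ∞]`. -/
noncomputable def pow2 (x : ℝ) : ℝ≥0∞ := ENNReal.ofReal ((2 : ℝ) ^ x)

lemma pow2_add (x y : ℝ) : pow2 (x + y) = pow2 x * pow2 y := by
  rw [pow2, pow2, pow2, Real.rpow_add (by norm_num), ENNReal.ofReal_mul (by positivity)]

lemma pow2_zero : pow2 0 = 1 := by simp [pow2]

lemma pow2_rpow (x y : ℝ) : pow2 x ^ y = pow2 (x * y) := by
  rw [pow2, pow2, ENNReal.ofReal_rpow_of_pos (by positivity), Real.rpow_mul (by norm_num)]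

lemma pow2_mono {x y : ℝ} (h : x ≤ y) : pow2 x ≤ pow2 y :=
  ENNReal.ofReal_le_ofReal (Real.rpow_le_rpow_of_exponent_le (by norm_num) h)

/-- The ratio `2^{2a}` exceeds `1` by at least `a`, so the geometric sum costs `1/a`. With `a =
2/α`, the square root of this factor is where `√α` comes from. -/
lemma sum_pow2_lt {a : ℝ} (ha : 0 < a) (J : ℕ) :
    ∑ i ∈ Finset.range J, pow2 (a * i) ^ (2 : ℝ) ≤ ENNReal.ofReal (1 / a) * pow2 (2 * a * J) := by
  have h1 : 1 + a ≤ (2 : ℝ) ^ (2 * a) := by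
    have := one_add_mul_self_le_rpow_one_add (s := 1) (by norm_num) (p := 2) (by norm_num)
    rw [Real.rpow_def_of_pos (by norm_num)]
    have h2 := Real.add_one_le_exp (Real.log 2 * (2 * a))
    have h3 := Real.log_two_gt_d9
    nlinarith
  have : ∑ i ∈ Finset.range J, pow2 (a * i) ^ (2 : ℝ) =
      ENNReal.ofReal (∑ i ∈ Finset.range J, ((2 : ℝ) ^ (2 * a)) ^ i) := by
    rw [ENNReal.ofReal_sum_of_nonneg (fun _ _ => by positivity)]
    refine Finset.sum_congr rfl fun i _ => ?_
    rw [pow2_rpow, pow2, ← Real.rpow_mul_natCast (by norm_num)]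
    congr 2; ring
  rw [this, pow2, ← ENNReal.ofReal_mul (by positivity)]
  refine ENNReal.ofReal_le_ofReal ?_
  rw [geom_sum_eq (by linarith), Real.rpow_mul_natCast (by norm_num), one_div, inv_mul_eq_div]
  have : (0 : ℝ) < ((2 : ℝ) ^ (2 * a)) ^ J := by positivity
  gcongr <;> linarith

/-- The constant involves only the lower bound `κ₀` of `κ`, which later makes the estimate uniform
in `α`. -/
lemma sum_pow2_ge {κ₀ κ : ℝ} (h0 : 0 < κ₀) (hκ : κ₀ ≤ κ) (J j : ℕ) :
    ∑ i ∈ (Finset.range j).filter (J ≤ ·), pow2 (-κ * i) ^ (2 : ℝ) ≤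
      ENNReal.ofReal (1 / (1 - (2 : ℝ) ^ (-2 * κ₀))) * pow2 (-(2 * κ) * J) := by
  have hr1 : (2 : ℝ) ^ (-2 * κ₀) < 1 := Real.rpow_lt_one_of_one_lt_of_neg (by norm_num) (by linarith)
  set r : ℝ := (2 : ℝ) ^ (-2 * κ) with hr
  have hr2 : r ≤ (2 : ℝ) ^ (-2 * κ₀) := Real.rpow_le_rpow_of_exponent_le (by norm_num) (by linarith)
  have hr0 : 0 < r := by positivity
  have e : ∀ i : ℕ, pow2 (-κ * i) ^ (2 : ℝ) = ENNReal.ofReal (r ^ i) := by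
    intro i
    rw [pow2_rpow, pow2, hr, ← Real.rpow_mul_natCast (by norm_num)]
    congr 2; ring
  calc ∑ i ∈ (Finset.range j).filter (J ≤ ·), pow2 (-κ * i) ^ (2 : ℝ)
      ≤ ∑ i ∈ Finset.Ico J (J + j), pow2 (-κ * i) ^ (2 : ℝ) := by
        refine Finset.sum_le_sum_of_subset fun i => ?_
        simp only [Finset.mem_filter, Finset.mem_range, Finset.mem_Ico]; omega
    _ = ENNReal.ofReal (∑ i ∈ Finset.range j, r ^ (J + i)) := by
        rw [ENNReal.ofReal_sum_of_nonneg (fun _ _ => by positivity), Finset.sum_Ico_eq_sum_range, Nat.add_sub_cancel_left]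
        exact Finset.sum_congr rfl fun i _ => e _
    _ ≤ _ := by
      rw [pow2, ← ENNReal.ofReal_mul (by apply div_nonneg <;> linarith)]
      refine ENNReal.ofReal_le_ofReal ?_
      have e2 : (2 : ℝ) ^ (-(2 * κ) * J) = r ^ J := by
        rw [hr, ← Real.rpow_mul_natCast (by norm_num)]; congr 1; ring
      simp_rw [e2, pow_add]
      rw [← Finset.mul_sum, mul_comm]
      gcongr
      rw [geom_sum_eq (by linarith), ← neg_div_neg_eq]
      have : 0 < r ^ j := by positivity
      gcongr <;> linarith

/-- A sum of pieces that grow like `2^{ai} β_i` and decay like `2^{-κi} γ_i`, both in `ℓ²`. -/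
lemma sum_interp_le {a κ₀ κ : ℝ} (ha : 0 < a) (h0 : 0 < κ₀) (hκ : κ₀ ≤ κ) (j : ℕ) (z β : ℕ → ℝ≥0∞)
    (hz : ∀ i ∈ Finset.range j, z i ≤ pow2 (a * i) * β i) :
    ∑ i ∈ Finset.range j, z i ≤
      ENNReal.ofReal ((1 + (2 : ℝ) ^ κ) * (1 + (1 / (1 - (2 : ℝ) ^ (-2 * κ₀))) ^ (1 / 2 : ℝ))) *
      (ENNReal.ofReal ((1 / a) ^ (1 / 2 : ℝ)) *
        (∑ i ∈ Finset.range j, β i ^ (2 : ℝ)) ^ (1 / 2 : ℝ)) ^ (κ / (a + κ)) *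
      ((∑ i ∈ Finset.range j, (pow2 (κ * i) * z i) ^ (2 : ℝ)) ^ (1 / 2 : ℝ)) ^ (a / (a + κ)) := by
  have hκ' : 0 < κ := h0.trans_le hκ
  have hr1 : (2 : ℝ) ^ (-2 * κ₀) < 1 := Real.rpow_lt_one_of_one_lt_of_neg (by norm_num) (by linarith)
  set c : ℝ := (1 / (1 - (2 : ℝ) ^ (-2 * κ₀))) with hc
  have hc0 : 0 < c := by rw [hc]; apply div_pos <;> linarith
  set Z := (∑ i ∈ Finset.range j, β i ^ (2 : ℝ)) ^ (1 / 2 : ℝ) with hZ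
  set G := (∑ i ∈ Finset.range j, (pow2 (κ * i) * z i) ^ (2 : ℝ)) ^ (1 / 2 : ℝ) with hG
  -- Cut at `J` and apply Cauchy–Schwarz to each side against its geometric weight: `2^{-κi}` for `i
  -- ≥ J`, and `2^{ai}` for `i < J`.
  have hhigh : ∀ J : ℕ, ∑ i ∈ (Finset.range j).filter (J ≤ ·), z i ≤
      pow2 (-κ * J) * (ENNReal.ofReal (c ^ (1 / 2 : ℝ)) * G) := by
    intro J
    calc ∑ i ∈ (Finset.range j).filter (J ≤ ·), z i
        = ∑ i ∈ (Finset.range j).filter (J ≤ ·), pow2 (-κ * i) * (pow2 (κ * i) * z i) := by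
          refine Finset.sum_congr rfl fun i _ => ?_
          rw [← mul_assoc, ← pow2_add]; simp [pow2_zero]
      _ ≤ _ := ennreal_cauchy_schwarz _ _ _
      _ ≤ (ENNReal.ofReal c * pow2 (-(2 * κ) * J)) ^ (1 / 2 : ℝ) * G := by
          refine mul_le_mul' (ENNReal.rpow_le_rpow (sum_pow2_ge h0 hκ J j) (by norm_num))
            (ENNReal.rpow_le_rpow (Finset.sum_le_sum_of_subset (Finset.filter_subset _ _))
              (by norm_num))
      _ = _ := by
          rw [ENNReal.mul_rpow_of_nonneg _ _ (by norm_num), pow2_rpow,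
            ENNReal.ofReal_rpow_of_pos hc0]
          rw [show -(2 * κ) * J * (1 / 2 : ℝ) = -κ * J by ring]
          ring
  have hlow : ∀ J : ℕ, ∑ i ∈ (Finset.range j).filter (¬ J ≤ ·), z i ≤
      pow2 (a * J) * (ENNReal.ofReal ((1 / a) ^ (1 / 2 : ℝ)) * Z) := by
    intro J
    calc ∑ i ∈ (Finset.range j).filter (¬ J ≤ ·), z i
        ≤ ∑ i ∈ (Finset.range j).filter (¬ J ≤ ·), pow2 (a * i) * β i :=
          Finset.sum_le_sum fun i hi => hz i (Finset.mem_filter.1 hi).1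
      _ ≤ _ := ennreal_cauchy_schwarz _ _ _
      _ ≤ (ENNReal.ofReal (1 / a) * pow2 (2 * a * J)) ^ (1 / 2 : ℝ) * Z := by
          refine mul_le_mul' (ENNReal.rpow_le_rpow
              ((Finset.sum_le_sum_of_subset fun i => ?_).trans (sum_pow2_lt ha J)) (by norm_num))
            (ENNReal.rpow_le_rpow (Finset.sum_le_sum_of_subset (Finset.filter_subset _ _))
              (by norm_num))
          simp only [Finset.mem_filter, Finset.mem_range]; omega
      _ = _ := by
          rw [ENNReal.mul_rpow_of_nonneg _ _ (by norm_num), pow2_rpow,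
            ENNReal.ofReal_rpow_of_pos (by positivity)]
          rw [show (2 * a) * J * (1 / 2 : ℝ) = a * J by ring]
          ring
  have main := ennreal_interp_le (w := ∑ i ∈ Finset.range j, z i)
    (b := ENNReal.ofReal ((1 / a) ^ (1 / 2 : ℝ)) * Z)
    (g := ENNReal.ofReal (c ^ (1 / 2 : ℝ)) * G) ha hκ' (by
      intro hb
      rw [mul_eq_zero, ENNReal.ofReal_eq_zero, or_iff_right (not_le.2 (by positivity)), hZ,
        ENNReal.rpow_eq_zero_iff_of_pos (by norm_num), Finset.sum_eq_zero_iff] at hb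
      refine Finset.sum_eq_zero fun i hi => ?_
      have := hb i hi
      rw [ENNReal.rpow_eq_zero_iff_of_pos (by norm_num)] at this
      simpa [this] using hz i hi) (by
      have := hhigh 0
      simpa [pow2_zero] using this) (by
      intro J
      rw [← Finset.sum_filter_add_sum_filter_not (Finset.range j) (J ≤ ·), add_comm]
      exact add_le_add (hlow J) (hhigh J))
  refine main.trans ?_
  rw [ENNReal.ofReal_mul (by positivity), ENNReal.mul_rpow_of_nonneg (ENNReal.ofReal (c ^ _)) _ (by positivity)]
  -- A base at least `1` raised to an exponent at most `1` does not increase, so this factor does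
  -- not depend on `a`.
  have : ENNReal.ofReal (c ^ (1 / 2 : ℝ)) ^ (a / (a + κ)) ≤ ENNReal.ofReal (1 + c ^ (1 / 2 : ℝ)) := by
    calc _ ≤ ENNReal.ofReal (1 + c ^ (1 / 2 : ℝ)) ^ (a / (a + κ)) := by
          gcongr; linarith
      _ ≤ ENNReal.ofReal (1 + c ^ (1 / 2 : ℝ)) ^ (1 : ℝ) := by
          apply ENNReal.rpow_le_rpow_of_exponent_le
          · rw [ENNReal.one_le_ofReal]; linarith [Real.rpow_nonneg hc0.le (1 / 2)]
          · rw [div_le_one (by positivity)]; linarith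
      _ = _ := ENNReal.rpow_one _
  calc _ ≤ ENNReal.ofReal (1 + 2 ^ κ) * (ENNReal.ofReal ((1 / a) ^ (1 / 2 : ℝ)) * Z) ^ (κ / (a + κ)) *
        (ENNReal.ofReal (1 + c ^ (1 / 2 : ℝ)) * G ^ (a / (a + κ))) := by gcongr
    _ = _ := by ring

/-! ### Integral inequalities and Schur's test on a band -/

/-- Minkowski's inequality for square functions, in `L^p` with `p ≥ 2`. -/
lemma eLpNorm'_square_function_le {X ι : Type*} [MeasurableSpace X] {μ : Measure X} (F : Finset ι)
    {f : ι → X → ℝ≥0∞} (hf : ∀ i ∈ F, Measurable (f i)) {p : ℝ} (hp : 2 ≤ p) :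
    eLpNorm' (fun x => (∑ i ∈ F, f i x ^ (2 : ℝ)) ^ (1 / 2 : ℝ)) p μ ≤
      (∑ i ∈ F, eLpNorm' (f i) p μ ^ (2 : ℝ)) ^ (1 / 2 : ℝ) := by
  have hp0 : 0 < p := by linarith
  have e : ∀ i, eLpNorm' (fun x => f i x ^ (2 : ℝ)) (p / 2) μ = eLpNorm' (f i) p μ ^ (2 : ℝ) := by
    intro i
    simp only [eLpNorm', enorm_eq_self]
    rw [← ENNReal.rpow_mul]
    congr 1
    · refine lintegral_congr fun x => ?_
      rw [← ENNReal.rpow_mul]; congr 1; ring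
    · field_simp
  have e2 : eLpNorm' (fun x => (∑ i ∈ F, f i x ^ (2 : ℝ)) ^ (1 / 2 : ℝ)) p μ =
      eLpNorm' (∑ i ∈ F, fun x => f i x ^ (2 : ℝ)) (p / 2) μ ^ (1 / 2 : ℝ) := by
    simp only [eLpNorm', enorm_eq_self]
    rw [← ENNReal.rpow_mul]
    congr 1
    · refine lintegral_congr fun x => ?_
      rw [← ENNReal.rpow_mul, Finset.sum_apply]; congr 1; ring
    · field_simp
  rw [e2]
  gcongr
  -- The triangle inequality is used in `L^{p/2}`, which is where `p ≥ 2` enters.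
  refine (eLpNorm'_sum_le (fun i hi => ((hf i hi).pow_const 2).aestronglyMeasurable)
    (by linarith)).trans_eq ?_
  exact Finset.sum_congr rfl fun i _ => e i

/-- Hölder's inequality against a density. -/
lemma lintegral_mul_rpow_le {X : Type*} [MeasurableSpace X] {μ : Measure X} {K f : X → ℝ≥0∞}
    (hK : Measurable K) (hf : Measurable f) {p : ℝ} (hp : 1 < p) :
    (∫⁻ y, K y * f y ∂μ) ^ p ≤ (∫⁻ y, K y ∂μ) ^ (p - 1) * ∫⁻ y, K y * f y ^ p ∂μ := by
  have hpq := Real.HolderConjugate.conjExponent hp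
  have h := ENNReal.lintegral_mul_le_Lp_mul_Lq (μ.withDensity K) hpq hf.aemeasurable
    (aemeasurable_const (b := (1 : ℝ≥0∞)))
  simp only [Pi.mul_apply, mul_one, ENNReal.one_rpow, lintegral_const, one_mul] at h
  rw [lintegral_withDensity_eq_lintegral_mul _ hK hf,
    lintegral_withDensity_eq_lintegral_mul _ hK (hf.pow_const p),
    withDensity_apply _ MeasurableSet.univ, Measure.restrict_univ] at h
  have hp0 : 0 < p := by linarith
  calc (∫⁻ y, K y * f y ∂μ) ^ p ≤ _ := ENNReal.rpow_le_rpow h hp0.le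
    _ = _ := by
      rw [ENNReal.mul_rpow_of_nonneg _ _ hp0.le, ← ENNReal.rpow_mul, ← ENNReal.rpow_mul,
        one_div_mul_cancel hp0.ne', ENNReal.rpow_one, mul_comm]
      congr 2
      rw [Real.conjExponent]
      field_simp

/-- Young's inequality `‖K * f‖_p ≤ ‖K‖_1 ‖f‖_p`. -/
lemma eLpNorm'_lconvolution_le {V : Type*} [MeasurableSpace V] [AddCommGroup V] [MeasurableAdd₂ V]
    [MeasurableNeg V] {μ : Measure V} [SFinite μ] [μ.IsAddLeftInvariant]
    {K f : V → ℝ≥0∞} (hK : Measurable K) (hf : Measurable f) {p : ℝ} (hp : 1 < p) :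
    eLpNorm' (fun x => ∫⁻ y, K y * f (x - y) ∂μ) p μ ≤ (∫⁻ y, K y ∂μ) * eLpNorm' f p μ := by
  have hp0 : 0 < p := by linarith
  simp only [eLpNorm', enorm_eq_self]
  have hm : Measurable fun z : V × V => K z.2 * f (z.1 - z.2) ^ p :=
    (hK.comp measurable_snd).mul ((hf.comp measurable_sub).pow_const p)
  calc (∫⁻ x, (∫⁻ y, K y * f (x - y) ∂μ) ^ p ∂μ) ^ (1 / p)
      ≤ (∫⁻ x, (∫⁻ y, K y ∂μ) ^ (p - 1) * ∫⁻ y, K y * f (x - y) ^ p ∂μ ∂μ) ^ (1 / p) := by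
        gcongr with x
        exact lintegral_mul_rpow_le hK (hf.comp (measurable_const.sub measurable_id)) hp
    _ = ((∫⁻ y, K y ∂μ) ^ p * ∫⁻ x, f x ^ p ∂μ) ^ (1 / p) := by
        rw [lintegral_const_mul _ hm.lintegral_prod_right', lintegral_lintegral_swap hm.aemeasurable]
        have : ∀ y, ∫⁻ x, K y * f (x - y) ^ p ∂μ = K y * ∫⁻ x, f x ^ p ∂μ := by
          intro y
          have hy : Measurable fun x => f (x - y) ^ p :=
            (hf.comp (measurable_id.sub measurable_const)).pow_const p
          rw [lintegral_const_mul _ hy]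
          congr 1
          simp_rw [sub_eq_add_neg]
          exact lintegral_add_right_eq_self (fun x => f x ^ p) (-y)
        simp_rw [this]
        rw [lintegral_mul_const _ hK, ← mul_assoc]
        congr 2
        nth_rw 2 [← ENNReal.rpow_one (∫⁻ y, K y ∂μ)]
        rw [← ENNReal.rpow_add_of_nonneg _ _ (by linarith) (by norm_num)]
        congr 1; ring
    _ = _ := by
        rw [ENNReal.mul_rpow_of_nonneg _ _ (by positivity), ← ENNReal.rpow_mul,
          mul_one_div_cancel hp0.ne', ENNReal.rpow_one]

/-- Schur's test for a band matrix on `ℓ²(ℕ)`. -/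
lemma tsum_band_le (A : Set ℕ) (M : ℕ) (a e : ℕ → ℝ≥0∞)
    (h : ∀ k ∈ A, a k ≤ ∑ j ∈ (Finset.range (k + 2)).filter (fun j => k ≤ j + M), e j) :
    ∑' k : A, a k ^ (2 : ℝ) ≤ ((M : ℝ≥0∞) + 2) ^ (2 : ℝ) * ∑' j, e j ^ (2 : ℝ) := by
  -- Indexing by diagonals: `i = k + 1 - j` takes the `M + 2` values `0, …, M + 1`, and on each
  -- diagonal the matrix is a shift, of norm at most `1` on `ℓ²`.
  set b : ℕ → ℕ → ℝ≥0∞ := fun k i => if i ≤ k + 1 then e (k + 1 - i) else 0 with hb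
  have h1 : ∀ k ∈ A, a k ≤ ∑ i ∈ Finset.range (M + 2), b k i := by
    intro k hk
    refine (h k hk).trans ?_
    rw [← Finset.sum_filter_add_sum_filter_not (Finset.range (M + 2)) (· ≤ k + 1)]
    refine le_trans (le_of_eq ?_) le_self_add
    refine Finset.sum_nbij' (fun j => k + 1 - j) (fun i => k + 1 - i) ?_ ?_ ?_ ?_ ?_
    · intro j; simp only [Finset.mem_filter, Finset.mem_range]; omega
    · intro j; simp only [Finset.mem_filter, Finset.mem_range]; omega
    · intro j; simp only [Finset.mem_filter, Finset.mem_range]; omega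
    · intro j; simp only [Finset.mem_filter, Finset.mem_range]; omega
    · intro j; simp only [Finset.mem_filter, Finset.mem_range, hb]
      intro hj
      rw [if_pos (by omega)]; congr 1; omega
  have h2 : ∀ i, ∑' k, b k i ^ (2 : ℝ) ≤ ∑' j, e j ^ (2 : ℝ) := by
    intro i
    have : ∀ k, b k i ^ (2 : ℝ) = ∑' j, if j + i = k + 1 then e j ^ (2 : ℝ) else 0 := by
      intro k
      simp only [hb]
      split_ifs with hi
      · rw [tsum_eq_single (k + 1 - i)]
        · rw [if_pos (by omega)]
        · intro j hj; rw [if_neg (by omega)]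
      · rw [ENNReal.zero_rpow_of_pos (by norm_num), ENNReal.tsum_eq_zero.2]
        intro j; rw [if_neg (by omega)]
    simp_rw [this]
    rw [ENNReal.tsum_comm]
    refine ENNReal.tsum_le_tsum fun j => ?_
    by_cases hj : 1 ≤ j + i
    · rw [tsum_eq_single (j + i - 1)]
      · split_ifs <;> simp
      · intro k hk; rw [if_neg (by omega)]
    · rw [ENNReal.tsum_eq_zero.2]
      · exact bot_le
      · intro k; rw [if_neg (by omega)]
  calc ∑' k : A, a k ^ (2 : ℝ)
      ≤ ∑' k : A, ((M : ℝ≥0∞) + 2) * ∑ i ∈ Finset.range (M + 2), b k i ^ (2 : ℝ) := by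
        refine ENNReal.tsum_le_tsum fun k => ?_
        refine (ENNReal.rpow_le_rpow (h1 k k.2) (by norm_num)).trans ?_
        refine (ENNReal.rpow_sum_le_const_mul_sum_rpow _ _ (by norm_num)).trans_eq ?_
        norm_num
    _ ≤ ∑' k : ℕ, ((M : ℝ≥0∞) + 2) * ∑ i ∈ Finset.range (M + 2), b k i ^ (2 : ℝ) :=
        ENNReal.tsum_comp_le_tsum_of_injective Subtype.val_injective
          (fun k : ℕ => ((M : ℝ≥0∞) + 2) * ∑ i ∈ Finset.range (M + 2), b k i ^ (2 : ℝ))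
    _ ≤ ((M : ℝ≥0∞) + 2) * ∑ i ∈ Finset.range (M + 2), ∑' j, e j ^ (2 : ℝ) := by
        rw [ENNReal.tsum_mul_left, Summable.tsum_finsetSum (fun _ _ => ENNReal.summable)]
        exact mul_le_mul_right (Finset.sum_le_sum fun i _ => h2 i) _
    _ = _ := by
        rw [Finset.sum_const, Finset.card_range, nsmul_eq_mul, ← mul_assoc, ENNReal.rpow_two, sq]
        push_cast; rfl

/-! ### Dilated Schwartz kernels and Fourier multipliers -/

variable {d : ℕ}

lemma lintegral_comp_dilation {R : ℝ} (hR : 0 < R) {f : E d → ℝ≥0∞} (hf : Measurable f) :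
    ENNReal.ofReal (R ^ d) * ∫⁻ y, f (R • y) = ∫⁻ y, f y := by
  have h1 : ∫⁻ y, f (R • y) = ∫⁻ y, f y ∂(Measure.map (R • ·) (volume : Measure (E d))) :=
    (lintegral_map hf (measurable_const_smul R)).symm
  rw [h1, Measure.map_addHaar_smul _ hR.ne', lintegral_smul_measure, smul_eq_mul, ← mul_assoc,
    ← ENNReal.ofReal_mul (by positivity)]
  have : R ^ d * |(R ^ Module.finrank ℝ (E d))⁻¹| = 1 := by
    rw [finrank_euclideanSpace_fin, abs_of_pos (by positivity)]
    exact mul_inv_cancel₀ (by positivity)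
  rw [this]; simp

/-- The `L¹`-normalized dilation `R^d K(R ·)` of a Schwartz function. -/
noncomputable def dil (K : SchwartzMap (E d) ℂ) (R : ℝ) (y : E d) : ℂ := ((R ^ d : ℝ) : ℂ) * K (R • y)

lemma continuous_dil (K : SchwartzMap (E d) ℂ) (R : ℝ) : Continuous (dil K R) :=
  continuous_const.mul (K.continuous.comp (continuous_const_smul R))

lemma enorm_ofReal_pow {R : ℝ} (hR : 0 < R) : ‖((R ^ d : ℝ) : ℂ)‖ₑ = ENNReal.ofReal (R ^ d) := by
  rw [← ofReal_norm, Complex.norm_real, Real.norm_of_nonneg (by positivity)]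

lemma enorm_dil (K : SchwartzMap (E d) ℂ) {R : ℝ} (hR : 0 < R) (y : E d) :
    ‖dil K R y‖ₑ = ENNReal.ofReal (R ^ d) * ‖K (R • y)‖ₑ := by
  rw [dil, enorm_mul, enorm_ofReal_pow hR]

lemma lintegral_dil (K : SchwartzMap (E d) ℂ) {R : ℝ} (hR : 0 < R) :
    ∫⁻ y, ‖dil K R y‖ₑ = ∫⁻ y, ‖K y‖ₑ := by
  simp_rw [enorm_dil K hR]
  have hm : Measurable fun y => ‖K y‖ₑ := K.continuous.measurable.enorm
  rw [lintegral_const_mul' _ _ ENNReal.ofReal_ne_top, lintegral_comp_dilation hR hm]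

lemma integrable_dil (K : SchwartzMap (E d) ℂ) {R : ℝ} (hR : 0 < R) : Integrable (dil K R) := by
  refine ⟨(continuous_dil K R).aestronglyMeasurable, ?_⟩
  rw [HasFiniteIntegral, lintegral_dil K hR]
  exact (K.integrable (μ := volume)).2

lemma lintegral_norm_mul_dil (K : SchwartzMap (E d) ℂ) {R : ℝ} (hR : 0 < R) :
    ENNReal.ofReal R * ∫⁻ y, ‖dil K R y‖ₑ * ‖y‖ₑ = ∫⁻ y, ‖K y‖ₑ * ‖y‖ₑ := by
  have hm : Measurable fun y => ‖K y‖ₑ * ‖y‖ₑ := K.continuous.measurable.enorm.mul measurable_enorm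
  rw [← lintegral_comp_dilation hR hm, ← lintegral_const_mul' _ _ ENNReal.ofReal_ne_top,
    ← lintegral_const_mul' _ _ ENNReal.ofReal_ne_top]
  refine lintegral_congr fun y => ?_
  rw [enorm_dil K hR, enorm_smul, Real.enorm_eq_ofReal hR.le]
  ring

/-- The factor `R^d`, with `R` about `2^i`, becomes the growth `2^{di/2}` in Bernstein's inequality.
-/
lemma lintegral_sq_dil (K : SchwartzMap (E d) ℂ) {R : ℝ} (hR : 0 < R) :
    ∫⁻ y, ‖dil K R y‖ₑ ^ (2 : ℝ) = ENNReal.ofReal (R ^ d) * ∫⁻ y, ‖K y‖ₑ ^ (2 : ℝ) := by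
  have hm : Measurable fun y => ‖K y‖ₑ ^ (2 : ℝ) := K.continuous.measurable.enorm.pow_const _
  rw [← lintegral_comp_dilation hR hm, ← mul_assoc, ← lintegral_const_mul' _ _
    (ENNReal.mul_ne_top ENNReal.ofReal_ne_top ENNReal.ofReal_ne_top)]
  refine lintegral_congr fun y => ?_
  rw [enorm_dil K hR, ENNReal.mul_rpow_of_nonneg _ _ (by norm_num)]
  congr 1
  rw [ENNReal.rpow_two, sq]

lemma enorm_sub_le_lintegral_fderiv (K : SchwartzMap (E d) ℂ) (y z : E d) :
    ‖K (y + z) - K y‖ₑ ≤ ∫⁻ t in Set.Ioc (0 : ℝ) 1, ‖fderiv ℝ K (y + t • z)‖ₑ * ‖z‖ₑ := by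
  have hd : ∀ t : ℝ, HasDerivAt (fun t : ℝ => K (y + t • z)) (fderiv ℝ K (y + t • z) z) t := by
    intro t
    have h1 : HasDerivAt (fun t : ℝ => y + t • z) z t := by
      simpa using ((hasDerivAt_id t).smul_const z).const_add y
    exact (K.differentiable _).hasFDerivAt.comp_hasDerivAt t h1
  have hc : Continuous fun t : ℝ => fderiv ℝ K (y + t • z) z := by
    have := (K.smooth 1).continuous_fderiv (by norm_num)
    fun_prop
  have h := intervalIntegral.integral_eq_sub_of_hasDerivAt (fun t _ => hd t)
    (hc.intervalIntegrable 0 1)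
  simp only [one_smul, zero_smul, add_zero] at h
  rw [← h, intervalIntegral.integral_of_le zero_le_one]
  refine (enorm_integral_le_lintegral_enorm _).trans (lintegral_mono fun t => ?_)
  exact ContinuousLinearMap.le_opENorm _ _

lemma lintegral_translate_sub_le (K : SchwartzMap (E d) ℂ) (z : E d) :
    ∫⁻ y, ‖K (y + z) - K y‖ₑ ≤ (∫⁻ y, ‖fderiv ℝ K y‖ₑ) * ‖z‖ₑ := by
  have hc : Continuous fun y => fderiv ℝ K y := (K.smooth 1).continuous_fderiv (by norm_num)
  have hm : Measurable fun q : E d × ℝ => ‖fderiv ℝ K (q.1 + q.2 • z)‖ₑ * ‖z‖ₑ := by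
    have : Continuous fun q : E d × ℝ => fderiv ℝ K (q.1 + q.2 • z) := by fun_prop
    exact this.measurable.enorm.mul_const _
  calc ∫⁻ y, ‖K (y + z) - K y‖ₑ
      ≤ ∫⁻ y, ∫⁻ t in Set.Ioc (0 : ℝ) 1, ‖fderiv ℝ K (y + t • z)‖ₑ * ‖z‖ₑ :=
        lintegral_mono fun y => enorm_sub_le_lintegral_fderiv K y z
    _ = ∫⁻ t in Set.Ioc (0 : ℝ) 1, ∫⁻ y, ‖fderiv ℝ K (y + t • z)‖ₑ * ‖z‖ₑ :=
        lintegral_lintegral_swap hm.aemeasurable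
    _ = ∫⁻ t in Set.Ioc (0 : ℝ) 1, (∫⁻ y, ‖fderiv ℝ K y‖ₑ) * ‖z‖ₑ := by
        refine lintegral_congr fun t => ?_
        rw [lintegral_mul_const' _ _ enorm_ne_top,
          lintegral_add_right_eq_self (fun y => ‖fderiv ℝ K y‖ₑ) (t • z)]
    _ = _ := by simp

/-- Rescaling turns the shift `z` into `R z`, so one derivative costs a factor `R`. -/
lemma lintegral_translate_dil_sub_le (K : SchwartzMap (E d) ℂ) {R : ℝ} (hR : 0 < R) (z : E d) :
    ∫⁻ y, ‖dil K R (y + z) - dil K R y‖ₑ ≤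
      (∫⁻ y, ‖fderiv ℝ K y‖ₑ) * ENNReal.ofReal R * ‖z‖ₑ := by
  have hm : Measurable fun y => ‖K (y + R • z) - K y‖ₑ := by
    have := K.continuous
    have : Continuous fun y => K (y + R • z) - K y := by fun_prop
    exact this.measurable.enorm
  have e : ∀ y, ‖dil K R (y + z) - dil K R y‖ₑ =
      ENNReal.ofReal (R ^ d) * ‖K (R • y + R • z) - K (R • y)‖ₑ := by
    intro y
    rw [dil, dil, ← mul_sub, enorm_mul, enorm_ofReal_pow hR,
      smul_add]
  simp_rw [e]
  rw [lintegral_const_mul' _ _ ENNReal.ofReal_ne_top, lintegral_comp_dilation hR hm]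
  refine (lintegral_translate_sub_le K _).trans_eq ?_
  rw [enorm_smul, Real.enorm_eq_ofReal hR.le, mul_assoc]

lemma fourier_dil (K : SchwartzMap (E d) ℂ) {R : ℝ} (hR : 0 < R) (ξ : E d) :
    𝓕 (dil K R) ξ = 𝓕 (K : E d → ℂ) (R⁻¹ • ξ) := by
  rw [Real.fourier_eq, Real.fourier_eq]
  have h := Measure.integral_comp_smul (volume : Measure (E d))
    (fun v => Real.fourierChar (-inner ℝ v (R⁻¹ • ξ)) • K v) R
  rw [finrank_euclideanSpace_fin, abs_of_pos (by positivity), eq_inv_smul_iff₀ (by positivity)] at h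
  rw [← h, ← integral_smul]
  refine integral_congr_ae (Filter.Eventually.of_forall fun v => ?_)
  simp only [dil, inner_smul_left, inner_smul_right]
  rw [show R⁻¹ * ((starRingEnd ℝ) R * inner ℝ v ξ) = inner ℝ v ξ by
    simp only [conj_trivial]; field_simp]
  simp only [Circle.smul_def, smul_eq_mul, Complex.real_smul]
  ring

/-- A Fourier multiplier is a convolution. -/
lemma fourierInv_mul_eq {K h : E d → ℂ} (hK : Integrable K) (hh : Integrable h) (x : E d) :
    𝓕⁻ (fun ξ => 𝓕 K ξ * h ξ) x = ∫ y, K y * 𝓕⁻ h (x - y) := by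
  have hg : Integrable fun ξ => Real.fourierChar (inner ℝ ξ x) • h ξ :=
    ((Real.fourierIntegral_convergent_iff (-x)).2 hh).congr
      (Filter.Eventually.of_forall fun ξ => by simp)
  have hflip := VectorFourier.integral_fourierIntegral_smul_eq_flip (L := innerₗ (E d))
    (μ := volume) (ν := volume) Real.continuous_fourierChar continuous_inner hK hg
  simp only [smul_eq_mul] at hflip
  rw [Real.fourierInv_eq]
  calc ∫ v, Real.fourierChar (inner ℝ v x) • (𝓕 K v * h v)
      = ∫ v, 𝓕 K v * (Real.fourierChar (inner ℝ v x) • h v) := by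
        congr 1; ext v; simp only [Circle.smul_def, smul_eq_mul]; ring
    _ = _ := hflip
    _ = _ := by
      congr 1; ext y; congr 1
      rw [Real.fourierInv_eq]
      simp only [VectorFourier.fourierIntegral]
      congr 1; ext ξ
      rw [smul_smul, ← AddChar.map_add_eq_mul]
      congr 2
      simp only [LinearMap.flip_apply, innerₗ_apply_apply]
      rw [inner_sub_right, real_inner_comm y ξ]; ring

lemma enorm_fourierInv_mul_le {K h : E d → ℂ} (hK : Integrable K) (hh : Integrable h) (x : E d) :
    ‖𝓕⁻ (fun ξ => 𝓕 K ξ * h ξ) x‖ₑ ≤ ∫⁻ y, ‖K y‖ₑ * ‖𝓕⁻ h (x - y)‖ₑ := by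
  rw [fourierInv_mul_eq hK hh]
  refine (enorm_integral_le_lintegral_enorm _).trans_eq ?_
  simp_rw [enorm_mul]

lemma continuous_fourierInv {h : E d → ℂ} (hh : Integrable h) : Continuous (𝓕⁻ h) := by
  have : 𝓕⁻ h = fun x => 𝓕 h (-x) := by ext x; exact Real.fourierInv_eq_fourier_neg h x
  rw [this]
  exact (VectorFourier.fourierIntegral_continuous Real.continuous_fourierChar
    (L := innerₗ (E d)) continuous_inner hh).comp continuous_neg

/-- `L^p` bound for the multiplier with kernel `K`. -/
lemma eLpNorm_fourierInv_mul_le {K h : E d → ℂ} (hKc : Continuous K) (hK : Integrable K)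
    (hh : Integrable h) {p : ℝ} (hp : 1 < p) :
    eLpNorm (𝓕⁻ (fun ξ => 𝓕 K ξ * h ξ)) (ENNReal.ofReal p) volume ≤
      (∫⁻ y, ‖K y‖ₑ) * eLpNorm (𝓕⁻ h) (ENNReal.ofReal p) volume := by
  have hp0 : ENNReal.ofReal p ≠ 0 := by rw [Ne, ENNReal.ofReal_eq_zero]; linarith
  rw [eLpNorm_eq_eLpNorm' hp0 ENNReal.ofReal_ne_top, eLpNorm_eq_eLpNorm' hp0 ENNReal.ofReal_ne_top,
    ENNReal.toReal_ofReal (by linarith)]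
  have hY := eLpNorm'_lconvolution_le (μ := (volume : Measure (E d))) (p := p) hKc.measurable.enorm
    (continuous_fourierInv hh).measurable.enorm hp
  have e : eLpNorm' (fun x => ‖𝓕⁻ h x‖ₑ) p volume = eLpNorm' (𝓕⁻ h) p volume := by
    simp [eLpNorm']
  rw [← e]
  refine le_trans ?_ hY
  simp only [eLpNorm', enorm_eq_self]
  gcongr with x
  exact enorm_fourierInv_mul_le hK hh x

/-! ### Cutoffs and the two admissible lengths -/

/-- The properties of a cutoff `ψ` relative to the length `N` that defines it. -/
structure IsGauge (ψ N : E d → ℝ) : Prop where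
  norm_le : ∀ ξ, ‖ξ‖ ≤ N ξ
  smul : ∀ (a : ℝ) ξ, N (a • ξ) = |a| * N ξ
  add_le : ∀ ξ η, N (ξ + η) ≤ N ξ + N η
  mono : ∀ η ξ, η ∈ octant d → ξ - η ∈ octant d → N η ≤ N ξ
  eq_one : ∀ ξ, N ξ ≤ 1 → ψ ξ = 1
  eq_zero : ∀ ξ, 5 / 4 < N ξ → ψ ξ = 0

lemma norm_le_l1Norm (ξ : E d) : ‖ξ‖ ≤ l1Norm ξ := by
  rw [EuclideanSpace.norm_eq]
  refine Real.sqrt_le_iff.2 ⟨Finset.sum_nonneg fun i _ => abs_nonneg _, ?_⟩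
  simp only [Real.norm_eq_abs, l1Norm]
  exact Finset.sum_sq_le_sq_sum_of_nonneg fun i _ => abs_nonneg _

/-- Both lengths are norms, dominate the Euclidean one and are monotone in nonnegative coordinates.
Nothing else about them matters, so the two choices of balls are treated together from here on. -/
lemma IsCutoff.exists_gauge {ψ : E d → ℝ} (hψ : IsCutoff ψ) : ∃ N, IsGauge ψ N := by
  obtain ⟨-, N, hN, h1, h0⟩ := hψ
  have hz : ∀ ξ, 5 / 4 < N ξ → ψ ξ = 0 := by
    intro ξ hξ
    apply image_eq_zero_of_notMem_tsupport
    rw [h0]; simpa using hξ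
  refine ⟨N, ?_⟩
  rcases hN with rfl | rfl
  · refine ⟨fun _ => le_rfl, fun a ξ => by simp [norm_smul], norm_add_le, ?_, h1, hz⟩
    intro η ξ hη hξ
    simp only [EuclideanSpace.norm_eq]
    refine Real.sqrt_le_sqrt (Finset.sum_le_sum fun i _ => ?_)
    have a1 : 0 ≤ η i := hη i
    have a2 : 0 ≤ (ξ - η) i := hξ i
    simp only [PiLp.sub_apply] at a2
    rw [Real.norm_of_nonneg a1, Real.norm_of_nonneg (by linarith)]
    gcongr; linarith
  · refine ⟨norm_le_l1Norm, fun a ξ => by simp [l1Norm, abs_mul, Finset.mul_sum], ?_, ?_, h1, hz⟩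
    · intro ξ η
      simp only [l1Norm, ← Finset.sum_add_distrib]
      exact Finset.sum_le_sum fun i _ => abs_add_le _ _
    · intro η ξ hη hξ
      refine Finset.sum_le_sum fun i _ => ?_
      have a1 : 0 ≤ η i := hη i
      have a2 : 0 ≤ (ξ - η) i := hξ i
      simp only [PiLp.sub_apply] at a2
      rw [abs_of_nonneg a1, abs_of_nonneg (by linarith)]
      linarith

lemma IsGauge.hasCompactSupport {ψ N : E d → ℝ} (h : IsGauge ψ N) : HasCompactSupport ψ :=
  HasCompactSupport.intro (isCompact_closedBall (0 : E d) (5 / 4)) fun ξ hξ =>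
    h.eq_zero ξ (lt_of_lt_of_le (by simpa using hξ) (h.norm_le ξ))

/-- Apart from continuity, the smoothness of `ψ` is used only here. The constants later depend on
`ψ` through norms of `K`: its `L¹` and `L²` norms, its first moment and the `L¹` norm of its
derivative. -/
lemma IsCutoff.exists_kernel {ψ : E d → ℝ} (hψ : IsCutoff ψ) :
    ∃ K : SchwartzMap (E d) ℂ, ∀ ξ, 𝓕 (K : E d → ℂ) ξ = (ψ ξ : ℂ) := by
  obtain ⟨N, hN⟩ := hψ.exists_gauge
  have hc : HasCompactSupport fun ξ => (ψ ξ : ℂ) :=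
    hN.hasCompactSupport.comp_left (g := fun x : ℝ => (x : ℂ)) (by simp)
  have hs : ContDiff ℝ ∞ fun ξ => (ψ ξ : ℂ) := Complex.ofRealCLM.contDiff.comp hψ.1
  refine ⟨𝓕⁻ (hc.toSchwartzMap hs), fun ξ => ?_⟩
  rw [← SchwartzMap.fourier_coe, FourierTransform.fourier_fourierInv_eq]
  rfl

/-! ### Convolution powers on the octant -/

lemma integrable_convPow {h : E d → ℂ} (hh : Integrable h) (n : ℕ) : Integrable (convPow h n) := by
  induction n with
  | zero => exact hh
  | succ n ih => exact hh.integrable_convolution _ ih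

lemma fourierInv_convolution {f g : E d → ℂ} (hf : Integrable f) (hg : Integrable g) (x : E d) :
    𝓕⁻ (convolution f g (ContinuousLinearMap.mul ℝ ℂ) volume) x = 𝓕⁻ f x * 𝓕⁻ g x := by
  have h : convolution f g (ContinuousLinearMap.mul ℝ ℂ) volume =
      convolution f g (ContinuousLinearMap.mul ℂ ℂ) volume := by
    ext ξ; simp [convolution_def]
  rw [h]
  simp only [Real.fourierInv_eq_fourier_neg]
  exact Real.fourier_mul_convolution_eq hf hg _

lemma fourierInv_convPow {h : E d → ℂ} (hh : Integrable h) (n : ℕ) (x : E d) :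
    𝓕⁻ (convPow h n) x = 𝓕⁻ h x ^ (n + 1) := by
  induction n with
  | zero => simp [convPow]
  | succ n ih => rw [convPow, fourierInv_convolution hh (integrable_convPow hh n), ih]; ring

lemma convPow_zero (n : ℕ) : convPow (0 : E d → ℂ) n = 0 := by
  cases n with
  | zero => rfl
  | succ n => simp [convPow, zero_convolution]

lemma ae_sub_left {P : E d → Prop} (h : ∀ᵐ η, P η) (ξ : E d) : ∀ᵐ η, P (ξ - η) :=
  (quasiMeasurePreserving_sub_left volume ξ).ae h

/-- Supports add under convolution because `N` is subadditive. Only the case `n = 0` forces an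
exceptional null set. -/
lemma convPow_eq_zero_of_lt {ψ N : E d → ℝ} (hN : IsGauge ψ N) {h : E d → ℂ} {R : ℝ}
    (hh : ∀ᵐ ξ, R < N ξ → h ξ = 0) (n : ℕ) :
    ∀ᵐ ξ, (n + 1) * R < N ξ → convPow h n ξ = 0 := by
  induction n with
  | zero => simpa [convPow] using hh
  | succ n ih =>
    refine Filter.Eventually.of_forall fun ξ hξ => ?_
    rw [convPow, convolution_def]
    refine integral_eq_zero_of_ae ?_
    filter_upwards [hh, ae_sub_left ih ξ] with η h1 h2
    simp only [ContinuousLinearMap.mul_apply', Pi.zero_apply, mul_eq_zero]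
    by_contra! hc
    have h3 : N η ≤ R := not_lt.1 fun hlt => hc.1 (h1 hlt)
    have h4 : N (ξ - η) ≤ (n + 1) * R := not_lt.1 fun hlt => hc.2 (h2 hlt)
    have h5 := hN.add_le η (ξ - η)
    rw [add_sub_cancel] at h5
    push_cast at hξ
    linarith

lemma octant_add {ξ η : E d} (h1 : η ∈ octant d) (h2 : ξ - η ∈ octant d) : ξ ∈ octant d := by
  intro i
  have a1 : 0 ≤ η i := h1 i
  have a2 : 0 ≤ (ξ - η) i := h2 i
  simp only [PiLp.sub_apply] at a2
  linarith

lemma convPow_octant {g : E d → ℂ} (hg : ∀ᵐ ξ, ξ ∉ octant d → g ξ = 0) (n : ℕ) :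
    ∀ᵐ ξ, ξ ∉ octant d → convPow g n ξ = 0 := by
  induction n with
  | zero => exact hg
  | succ n ih =>
    refine Filter.Eventually.of_forall fun ξ hξ => ?_
    rw [convPow, convolution_def]
    refine integral_eq_zero_of_ae ?_
    filter_upwards [hg, ae_sub_left ih ξ] with η h1 h2
    simp only [ContinuousLinearMap.mul_apply', Pi.zero_apply, mul_eq_zero]
    by_contra! hc
    exact hξ (octant_add (by_contra fun h => hc.1 (h1 h)) (by_contra fun h => hc.2 (h2 h)))

lemma l1Norm_add_of_octant {ξ η : E d} (h1 : η ∈ octant d) (h2 : ξ - η ∈ octant d) :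
    l1Norm ξ = l1Norm η + l1Norm (ξ - η) := by
  simp only [l1Norm, ← Finset.sum_add_distrib]
  refine Finset.sum_congr rfl fun i _ => ?_
  rw [abs_of_nonneg (octant_add h1 h2 i), abs_of_nonneg (h1 i), abs_of_nonneg (h2 i)]
  simp

/-- On the octant the weights `2^{s|ξ|}` are multiplicative and high frequencies do not
contribute to low ones. -/
lemma convPow_weight_trunc {ψ N : E d → ℝ} (hN : IsGauge ψ N) {s R : ℝ} {g h : E d → ℂ}
    (hg : ∀ᵐ ξ, ξ ∉ octant d → g ξ = 0) (hh : ∀ᵐ ξ, ξ ∉ octant d → h ξ = 0)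
    (hgh : ∀ ξ, N ξ ≤ R → h ξ = (((2 : ℝ) ^ (s * l1Norm ξ) : ℝ) : ℂ) * g ξ) (n : ℕ) :
    ∀ᵐ ξ, N ξ ≤ R → (((2 : ℝ) ^ (s * l1Norm ξ) : ℝ) : ℂ) * convPow g n ξ = convPow h n ξ := by
  induction n with
  | zero => exact Filter.Eventually.of_forall fun ξ hξ => (hgh ξ hξ).symm
  | succ n ih =>
    refine Filter.Eventually.of_forall fun ξ hξ => ?_
    rw [convPow, convPow, convolution_def, convolution_def, ← integral_const_mul]
    refine integral_congr_ae ?_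
    filter_upwards [hg, hh, ae_sub_left ih ξ, ae_sub_left (convPow_octant hg n) ξ,
      ae_sub_left (convPow_octant hh n) ξ] with η h1 h2 h3 h4 h5
    simp only [ContinuousLinearMap.mul_apply']
    by_cases hη : η ∈ octant d
    · by_cases hζ : ξ - η ∈ octant d
      · have m1 := hN.mono η ξ hη hζ
        have m2 := hN.mono (ξ - η) ξ hζ (by simpa using hη)
        rw [← h3 (m2.trans hξ), hgh η (m1.trans hξ), l1Norm_add_of_octant hη hζ, mul_add,
          Real.rpow_add (by norm_num)]
        push_cast; ring
      · rw [h4 hζ, h5 hζ]; simp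
    · rw [h1 hη, h2 hη]; simp

/-! ### Dyadic pieces and the telescoped power -/

variable {ψ N : E d → ℝ}

/-- The Fourier transform of `2^{s|∇|} Δ_i f`, for the `f` with Fourier transform `g`. -/
noncomputable def pieceHat (ψ : E d → ℝ) (s : ℝ) (i : ℕ) (g : E d → ℂ) (ξ : E d) : ℂ :=
  (((2 : ℝ) ^ (s * l1Norm ξ) * dyadicSymbol ψ i ξ : ℝ) : ℂ) * g ξ

/-- The Fourier transform of `∑_{i<j} 2^{s|∇|} Δ_i f`. -/
noncomputable def partHat (ψ : E d → ℝ) (s : ℝ) (j : ℕ) (g : E d → ℂ) (ξ : E d) : ℂ :=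
  ∑ i ∈ Finset.range j, pieceHat ψ s i g ξ

/-- The partial sum `∑_{i<j} 2^{s|∇|} Δ_i f`. -/
noncomputable def partSum (ψ : E d → ℝ) (s : ℝ) (j : ℕ) (g : E d → ℂ) (x : E d) : ℂ :=
  ∑ i ∈ Finset.range j, expDelta ψ s i g x

lemma expDelta_eq (s : ℝ) (i : ℕ) (g : E d → ℂ) : expDelta ψ s i g = 𝓕⁻ (pieceHat ψ s i g) := rfl

lemma IsGauge.dyadicSymbol_eq_zero_of_lt (hN : IsGauge ψ N) {i : ℕ} {ξ : E d}
    (h : 5 / 4 * 2 ^ i < N ξ) : dyadicSymbol ψ i ξ = 0 := by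
  have h2 : (0 : ℝ) < 2 ^ i := by positivity
  have h1 : 5 / 4 < N (((2 : ℝ) ^ i)⁻¹ • ξ) := by
    rw [hN.smul, abs_of_pos (by positivity), inv_mul_eq_div, lt_div_iff₀ h2]; exact h
  unfold dyadicSymbol
  split_ifs with hi
  · subst hi; exact hN.eq_zero _ (by simpa using h)
  · rw [hN.eq_zero _ h1, hN.eq_zero, sub_zero]
    rw [hN.smul, abs_of_pos (by norm_num)]; linarith

lemma IsGauge.dyadicSymbol_succ_eq_zero_of_le (hN : IsGauge ψ N) {i : ℕ} {ξ : E d}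
    (h : N ξ ≤ 2 ^ i) : dyadicSymbol ψ (i + 1) ξ = 0 := by
  have h2 : (0 : ℝ) < 2 ^ i := by positivity
  have e : (2 : ℝ) • ((2 : ℝ) ^ (i + 1))⁻¹ • ξ = ((2 : ℝ) ^ i)⁻¹ • ξ := by
    rw [smul_smul, pow_succ]; congr 1; field_simp
  have h1 : N (((2 : ℝ) ^ i)⁻¹ • ξ) ≤ 1 := by
    rw [hN.smul, abs_of_pos (by positivity), inv_mul_eq_div, div_le_one h2]; exact h
  rw [dyadicSymbol, if_neg (by omega), e, hN.eq_one _ h1, hN.eq_one, sub_self]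
  have e2 : ((2 : ℝ) ^ (i + 1))⁻¹ • ξ = (1 / 2 : ℝ) • ((2 : ℝ) ^ i)⁻¹ • ξ := by
    rw [← e, smul_smul]; norm_num
  have h0 : 0 ≤ N (((2 : ℝ) ^ i)⁻¹ • ξ) := (norm_nonneg _).trans (hN.norm_le _)
  rw [e2, hN.smul, abs_of_pos (by norm_num)]
  linarith

lemma dyadicSymbol_succ (i : ℕ) (ξ : E d) :
    dyadicSymbol ψ (i + 1) ξ = ψ (((2 : ℝ) ^ (i + 1))⁻¹ • ξ) - ψ (((2 : ℝ) ^ i)⁻¹ • ξ) := by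
  rw [dyadicSymbol, if_neg (by omega)]
  congr 2
  rw [smul_smul, pow_succ]; congr 1; field_simp

lemma sum_dyadicSymbol (j : ℕ) (ξ : E d) :
    ∑ i ∈ Finset.range (j + 1), dyadicSymbol ψ i ξ = ψ (((2 : ℝ) ^ j)⁻¹ • ξ) := by
  induction j with
  | zero => simp [dyadicSymbol]
  | succ j ih => rw [Finset.sum_range_succ, ih, dyadicSymbol_succ]; ring

lemma continuous_l1Norm : Continuous (l1Norm : E d → ℝ) := by
  unfold l1Norm; fun_prop

lemma continuous_dyadicSymbol (hψ : Continuous ψ) (i : ℕ) : Continuous (dyadicSymbol ψ i) := by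
  unfold dyadicSymbol
  split_ifs <;> fun_prop

lemma IsGauge.integrable_pieceHat (hN : IsGauge ψ N) (hψ : Continuous ψ) (s : ℝ) (i : ℕ)
    {g : E d → ℂ} (hg : LocallyIntegrable g) : Integrable (pieceHat ψ s i g) := by
  have hc : Continuous fun ξ : E d => (((2 : ℝ) ^ (s * l1Norm ξ) * dyadicSymbol ψ i ξ : ℝ) : ℂ) := by
    have h1 : Continuous fun ξ : E d => (2 : ℝ) ^ (s * l1Norm ξ) :=
      Continuous.rpow continuous_const (continuous_const.mul continuous_l1Norm)
        fun _ => Or.inl (by norm_num)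
    exact Complex.continuous_ofReal.comp (h1.mul (continuous_dyadicSymbol hψ i))
  refine hg.integrable_smul_left_of_hasCompactSupport hc ?_
  refine HasCompactSupport.intro (isCompact_closedBall (0 : E d) (5 / 4 * 2 ^ i)) fun ξ hξ => ?_
  rw [hN.dyadicSymbol_eq_zero_of_lt (lt_of_lt_of_le (by simpa using hξ) (hN.norm_le ξ))]
  simp

lemma IsGauge.integrable_dyadicSymbol_mul (hN : IsGauge ψ N) (hψ : Continuous ψ) (k : ℕ)
    {h : E d → ℂ} (hh : Integrable h) : Integrable fun ξ => (dyadicSymbol ψ k ξ : ℂ) * h ξ := by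
  refine hh.locallyIntegrable.integrable_smul_left_of_hasCompactSupport
    (Complex.continuous_ofReal.comp (continuous_dyadicSymbol hψ k)) ?_
  refine HasCompactSupport.intro (isCompact_closedBall (0 : E d) (5 / 4 * 2 ^ k)) fun ξ hξ => ?_
  rw [Function.comp_apply,
    hN.dyadicSymbol_eq_zero_of_lt (lt_of_lt_of_le (by simpa using hξ) (hN.norm_le ξ))]
  simp

lemma IsGauge.integrable_partHat (hN : IsGauge ψ N) (hψ : Continuous ψ) (s : ℝ) (j : ℕ)
    {g : E d → ℂ} (hg : LocallyIntegrable g) : Integrable (partHat ψ s j g) :=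
  integrable_finsetSum _ fun i _ => hN.integrable_pieceHat hψ s i hg

lemma fourierInv_finsetSum {ι : Type*} (F : Finset ι) {h : ι → E d → ℂ}
    (hh : ∀ i ∈ F, Integrable (h i)) (x : E d) :
    𝓕⁻ (fun ξ => ∑ i ∈ F, h i ξ) x = ∑ i ∈ F, 𝓕⁻ (h i) x := by
  simp only [Real.fourierInv_eq, Finset.smul_sum]
  refine integral_finsetSum _ fun i hi => ?_
  have := (Real.fourierIntegral_convergent_iff (-x)).2 (hh i hi)
  exact this.congr (Filter.Eventually.of_forall fun ξ => by simp)

lemma IsGauge.fourierInv_partHat (hN : IsGauge ψ N) (hψ : Continuous ψ) (s : ℝ) (j : ℕ)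
    {g : E d → ℂ} (hg : LocallyIntegrable g) : 𝓕⁻ (partHat ψ s j g) = partSum ψ s j g := by
  ext x
  exact fourierInv_finsetSum _ (fun i _ => hN.integrable_pieceHat hψ s i hg) x

lemma partHat_succ_eq (s : ℝ) (j : ℕ) (g : E d → ℂ) (ξ : E d) : partHat ψ s (j + 1) g ξ =
    (((2 : ℝ) ^ (s * l1Norm ξ) * ψ (((2 : ℝ) ^ j)⁻¹ • ξ) : ℝ) : ℂ) * g ξ := by
  rw [← sum_dyadicSymbol (ψ := ψ), partHat, Finset.mul_sum, Complex.ofReal_sum, Finset.sum_mul]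
  rfl

lemma IsGauge.partHat_eq_zero_of_lt (hN : IsGauge ψ N) (s : ℝ) (j : ℕ) (g : E d → ℂ) {ξ : E d}
    (h : 5 / 4 * 2 ^ j < N ξ) : partHat ψ s (j + 1) g ξ = 0 := by
  refine Finset.sum_eq_zero fun i hi => ?_
  have : (2 : ℝ) ^ i ≤ 2 ^ j :=
    pow_le_pow_right₀ (by norm_num) (by simp only [Finset.mem_range] at hi; omega)
  rw [pieceHat, hN.dyadicSymbol_eq_zero_of_lt (lt_of_le_of_lt (by gcongr) h)]
  simp

/-- Low frequency parts of a power, as the Fourier transform sees them. -/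
lemma IsGauge.pieceHat_convPow (hN : IsGauge ψ N) (s : ℝ) (k n : ℕ) {g : E d → ℂ}
    (hg : ∀ᵐ ξ, ξ ∉ octant d → g ξ = 0) :
    pieceHat ψ s k (convPow g n) =ᵐ[volume]
      fun ξ => (dyadicSymbol ψ k ξ : ℂ) * convPow (partHat ψ s (k + 2) g) n ξ := by
  have ho : ∀ᵐ ξ, ξ ∉ octant d → partHat ψ s (k + 2) g ξ = 0 := by
    filter_upwards [hg] with ξ h1 h2
    rw [partHat_succ_eq, h1 h2, mul_zero]
  -- On `N ξ ≤ 2^{k+1}` the symbol `ψ(2^{-(k+1)} ξ)` of the first `k + 2` pieces is `1`, and this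
  -- ball contains the support `N ξ ≤ (5/4) 2^k` of the symbol of `Δ_k`.
  have h := convPow_weight_trunc hN (s := s) (R := 2 ^ (k + 1)) hg ho (fun ξ hξ => by
    rw [partHat_succ_eq, hN.eq_one, mul_one]
    rw [hN.smul, abs_of_pos (by positivity), inv_mul_eq_div, div_le_one (by positivity)]
    exact hξ) n
  filter_upwards [h] with ξ hξ
  by_cases hk : N ξ ≤ 2 ^ (k + 1)
  · rw [← hξ hk, pieceHat]; push_cast; ring
  · rw [pieceHat, hN.dyadicSymbol_eq_zero_of_lt]
    · simp
    · have : (0 : ℝ) < 2 ^ k := by positivity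
      rw [pow_succ] at hk; linarith

/-- The increments of `(∑_{i<j} w_i)^{n+1}` in `j`, `w_i = 2^{s|∇|} Δ_i f`. -/
noncomputable def powDiff (ψ : E d → ℝ) (s : ℝ) (n j : ℕ) (g : E d → ℂ) (x : E d) : ℂ :=
  partSum ψ s (j + 1) g x ^ (n + 1) - partSum ψ s j g x ^ (n + 1)

noncomputable def powDiffHat (ψ : E d → ℝ) (s : ℝ) (n j : ℕ) (g : E d → ℂ) (ξ : E d) : ℂ :=
  convPow (partHat ψ s (j + 1) g) n ξ - convPow (partHat ψ s j g) n ξ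

lemma fourierInv_sub {f g : E d → ℂ} (hf : Integrable f) (hg : Integrable g) (x : E d) :
    𝓕⁻ (fun ξ => f ξ - g ξ) x = 𝓕⁻ f x - 𝓕⁻ g x := by
  simp only [Real.fourierInv_eq, smul_sub]
  refine integral_sub ?_ ?_
  · exact ((Real.fourierIntegral_convergent_iff (-x)).2 hf).congr
      (Filter.Eventually.of_forall fun ξ => by simp)
  · exact ((Real.fourierIntegral_convergent_iff (-x)).2 hg).congr
      (Filter.Eventually.of_forall fun ξ => by simp)

lemma IsGauge.integrable_powDiffHat (hN : IsGauge ψ N) (hψ : Continuous ψ) (s : ℝ) (n j : ℕ)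
    {g : E d → ℂ} (hg : LocallyIntegrable g) : Integrable (powDiffHat ψ s n j g) :=
  (integrable_convPow (hN.integrable_partHat hψ s _ hg) n).sub
    (integrable_convPow (hN.integrable_partHat hψ s _ hg) n)

lemma IsGauge.fourierInv_powDiffHat (hN : IsGauge ψ N) (hψ : Continuous ψ) (s : ℝ) (n j : ℕ)
    {g : E d → ℂ} (hg : LocallyIntegrable g) : 𝓕⁻ (powDiffHat ψ s n j g) = powDiff ψ s n j g := by
  ext x
  have h := fun j => hN.integrable_partHat hψ s j hg
  unfold powDiffHat
  rw [fourierInv_sub (integrable_convPow (h _) n) (integrable_convPow (h _) n),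
    fourierInv_convPow (h _), fourierInv_convPow (h _), hN.fourierInv_partHat hψ s _ hg,
    hN.fourierInv_partHat hψ s _ hg, powDiff]

lemma IsGauge.powDiffHat_eq_zero (hN : IsGauge ψ N) (s : ℝ) (n j : ℕ) (g : E d → ℂ) :
    ∀ᵐ ξ, (n + 1) * (5 / 4 * 2 ^ j) < N ξ → powDiffHat ψ s n j g ξ = 0 := by
  have h1 := convPow_eq_zero_of_lt hN (h := partHat ψ s (j + 1) g) (R := 5 / 4 * 2 ^ j)
    (Filter.Eventually.of_forall fun ξ hξ => hN.partHat_eq_zero_of_lt s j g hξ) n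
  have h2 : ∀ᵐ ξ, (n + 1) * (5 / 4 * 2 ^ j) < N ξ → convPow (partHat ψ s j g) n ξ = 0 := by
    cases j with
    | zero =>
      have : partHat ψ s 0 g = 0 := by ext; simp [partHat]
      rw [this, convPow_zero]; simp
    | succ j =>
      refine convPow_eq_zero_of_lt hN (Filter.Eventually.of_forall fun ξ hξ => ?_) n
      refine hN.partHat_eq_zero_of_lt s j g (lt_of_le_of_lt ?_ hξ)
      gcongr <;> simp
  filter_upwards [h1, h2] with ξ a b hξ
  rw [powDiffHat, a hξ, b hξ, sub_zero]

/-- The increment lives in `N ξ ≤ (n+1)(5/4) 2^j ≤ 2^{j+n+2}`, while for `k ≥ 1` the symbol of `Δ_k`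
vanishes on `N ξ ≤ 2^{k-1}`. The shift `n + 2` absorbs the factor `n + 1 ≤ 2^n` and the `5/4`. -/
lemma IsGauge.dyadicSymbol_mul_powDiffHat (hN : IsGauge ψ N) (s : ℝ) {n j k : ℕ}
    (hk : j + (n + 2) < k) (g : E d → ℂ) :
    (fun ξ => (dyadicSymbol ψ k ξ : ℂ) * powDiffHat ψ s n j g ξ) =ᵐ[volume] 0 := by
  filter_upwards [hN.powDiffHat_eq_zero s n j g] with ξ hξ
  obtain ⟨k, rfl⟩ : ∃ l, k = l + 1 := ⟨k - 1, by omega⟩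
  by_cases h : N ξ ≤ 2 ^ k
  · simp [hN.dyadicSymbol_succ_eq_zero_of_le h]
  · rw [hξ, mul_zero]; · rfl
    refine lt_of_le_of_lt ?_ (not_le.1 h)
    have h1 : (2 : ℝ) ^ (j + (n + 2)) ≤ 2 ^ k := pow_le_pow_right₀ (by norm_num) (by omega)
    have h2 : (n : ℝ) + 1 ≤ 2 ^ n := by exact_mod_cast Nat.lt_two_pow_self
    have h3 : (0 : ℝ) < 2 ^ j := by positivity
    have h4 : ((n : ℝ) + 1) * 2 ^ j ≤ 2 ^ n * 2 ^ j := by gcongr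
    rw [pow_add, pow_add] at h1
    nlinarith

/-- The power of `S_{k+2}` telescopes over `j < k + 2`, and `Δ_k` annihilates the increments of too
low frequency. The number of survivors is linear in `n`. -/
lemma IsGauge.expDelta_convPow (hN : IsGauge ψ N) (hψ : Continuous ψ) (s : ℝ) (k n : ℕ)
    {g : E d → ℂ} (hl : LocallyIntegrable g) (hg : ∀ᵐ ξ, ξ ∉ octant d → g ξ = 0) (x : E d) :
    expDelta ψ s k (convPow g n) x =
      ∑ j ∈ (Finset.range (k + 2)).filter (fun j => k ≤ j + (n + 2)),
        𝓕⁻ (fun ξ => (dyadicSymbol ψ k ξ : ℂ) * powDiffHat ψ s n j g ξ) x := by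
  have hint : ∀ j, Integrable fun ξ => (dyadicSymbol ψ k ξ : ℂ) * powDiffHat ψ s n j g ξ := fun j =>
    hN.integrable_dyadicSymbol_mul hψ k (hN.integrable_powDiffHat hψ s n j hl)
  have h0 : partHat ψ s 0 g = 0 := by ext; simp [partHat]
  rw [expDelta_eq, Real.fourierInv_congr_ae (hN.pieceHat_convPow s k n hg)]
  have e : (fun ξ => (dyadicSymbol ψ k ξ : ℂ) * convPow (partHat ψ s (k + 2) g) n ξ) =
      fun ξ => ∑ j ∈ Finset.range (k + 2), (dyadicSymbol ψ k ξ : ℂ) * powDiffHat ψ s n j g ξ := by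
    ext ξ
    rw [← Finset.mul_sum]
    unfold powDiffHat
    rw [Finset.sum_range_sub (fun j => convPow (partHat ψ s j g) n ξ), h0, convPow_zero]
    simp
  rw [e, fourierInv_finsetSum _ (fun j _ => hint j)]
  rw [Finset.sum_filter_of_ne]
  intro j _ hj
  by_contra hk
  refine hj ?_
  rw [Real.fourierInv_congr_ae (hN.dyadicSymbol_mul_powDiffHat s (not_le.1 hk) g), Real.fourierInv_eq]
  simp

/-- The multipliers `Δ_k` are uniformly bounded on `L^p`. -/
lemma eLpNorm_dyadic_le {K : SchwartzMap (E d) ℂ} (hK : ∀ ξ, 𝓕 (K : E d → ℂ) ξ = (ψ ξ : ℂ))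
    (k : ℕ) {h : E d → ℂ} (hh : Integrable h) {p : ℝ} (hp : 1 < p) :
    eLpNorm (𝓕⁻ (fun ξ => (dyadicSymbol ψ k ξ : ℂ) * h ξ)) (ENNReal.ofReal p) volume ≤
      2 * (∫⁻ y, ‖K y‖ₑ) * eLpNorm (𝓕⁻ h) (ENNReal.ofReal p) volume := by
  cases k with
  | zero =>
    have e : (fun ξ => (dyadicSymbol ψ 0 ξ : ℂ) * h ξ) = fun ξ => 𝓕 (K : E d → ℂ) ξ * h ξ := by
      ext ξ; rw [hK]; simp [dyadicSymbol]
    rw [e, two_mul, add_mul]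
    exact (eLpNorm_fourierInv_mul_le K.continuous K.integrable hh hp).trans le_self_add
  | succ k =>
    set L : E d → ℂ := dil K (2 ^ (k + 1)) - dil K (2 ^ k) with hL
    have h1 : Integrable (dil K (2 ^ (k + 1))) := integrable_dil K (by positivity)
    have h2 : Integrable (dil K (2 ^ k)) := integrable_dil K (by positivity)
    have e : (fun ξ => (dyadicSymbol ψ (k + 1) ξ : ℂ) * h ξ) = fun ξ => 𝓕 L ξ * h ξ := by
      ext ξ
      have : 𝓕 L ξ = 𝓕 (dil K (2 ^ (k + 1))) ξ - 𝓕 (dil K (2 ^ k)) ξ := by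
        have := fourierInv_sub h1 h2 (-ξ)
        simp only [Real.fourierInv_eq_fourier_neg, neg_neg] at this
        exact this
      rw [this, fourier_dil K (by positivity), fourier_dil K (by positivity), hK, hK,
        dyadicSymbol_succ]
      push_cast; rfl
    rw [e]
    refine (eLpNorm_fourierInv_mul_le ((continuous_dil K _).sub (continuous_dil K _))
      (h1.sub h2) hh hp).trans ?_
    gcongr
    calc ∫⁻ y, ‖L y‖ₑ ≤ ∫⁻ y, (‖dil K (2 ^ (k + 1)) y‖ₑ + ‖dil K (2 ^ k) y‖ₑ) :=
          lintegral_mono fun y => enorm_sub_le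
      _ = _ := by
        rw [lintegral_add_left (continuous_dil K _).measurable.enorm,
          lintegral_dil K (by positivity), lintegral_dil K (by positivity), two_mul]

lemma IsGauge.eLpNorm_expDelta_convPow_le (hN : IsGauge ψ N) (hψ : Continuous ψ)
    {K : SchwartzMap (E d) ℂ} (hK : ∀ ξ, 𝓕 (K : E d → ℂ) ξ = (ψ ξ : ℂ)) (s : ℝ) (k n : ℕ)
    {g : E d → ℂ} (hl : LocallyIntegrable g) (hg : ∀ᵐ ξ, ξ ∉ octant d → g ξ = 0)
    {p : ℝ} (hp : 1 < p) :
    eLpNorm (expDelta ψ s k (convPow g n)) (ENNReal.ofReal p) volume ≤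
      ∑ j ∈ (Finset.range (k + 2)).filter (fun j => k ≤ j + (n + 2)),
        2 * (∫⁻ y, ‖K y‖ₑ) * eLpNorm (powDiff ψ s n j g) (ENNReal.ofReal p) volume := by
  have hint : ∀ j, Integrable fun ξ => (dyadicSymbol ψ k ξ : ℂ) * powDiffHat ψ s n j g ξ := fun j =>
    hN.integrable_dyadicSymbol_mul hψ k (hN.integrable_powDiffHat hψ s n j hl)
  have e : expDelta ψ s k (convPow g n) =
      ∑ j ∈ (Finset.range (k + 2)).filter (fun j => k ≤ j + (n + 2)),
        𝓕⁻ (fun ξ => (dyadicSymbol ψ k ξ : ℂ) * powDiffHat ψ s n j g ξ) := by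
    ext x; rw [hN.expDelta_convPow hψ s k n hl hg, Finset.sum_apply]
  rw [e]
  refine (eLpNorm_sum_le (fun j _ => (continuous_fourierInv (hint j)).aestronglyMeasurable)
    (by rw [ENNReal.one_le_ofReal]; exact hp.le)).trans (Finset.sum_le_sum fun j _ => ?_)
  rw [← hN.fourierInv_powDiffHat hψ s n j hl]
  exact eLpNorm_dyadic_le hK k (hN.integrable_powDiffHat hψ s n j hl) hp

/-! ### Reproducing kernels, translations and Bernstein's inequality -/

/-- The symbol of `Δ_i` lives in `2^{i-1} < N ξ ≤ (5/4) 2^i`, without the lower bound for `i = 0`,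
so a multiplier equal to `1` there acts trivially. -/
lemma IsGauge.pieceHat_eq_mul (hN : IsGauge ψ N) (s : ℝ) (i : ℕ) (g : E d → ℂ) {m : E d → ℂ}
    (hm : ∀ ξ, N ξ ≤ 5 / 4 * 2 ^ i → (0 < i → 2 ^ i < 2 * N ξ) → m ξ = 1) :
    pieceHat ψ s i g = fun ξ => m ξ * pieceHat ψ s i g ξ := by
  ext ξ
  by_cases h1 : N ξ ≤ 5 / 4 * 2 ^ i
  · by_cases h2 : 0 < i → 2 ^ i < 2 * N ξ
    · rw [hm ξ h1 h2, one_mul]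
    · push Not at h2
      obtain ⟨hi, h2⟩ := h2
      obtain ⟨l, rfl⟩ : ∃ l, i = l + 1 := ⟨i - 1, by omega⟩
      rw [pieceHat, hN.dyadicSymbol_succ_eq_zero_of_le]
      · simp
      · rw [pow_succ] at h2; linarith
  · rw [pieceHat, hN.dyadicSymbol_eq_zero_of_lt (not_le.1 h1)]; simp

lemma IsGauge.pieceHat_eq_dil (hN : IsGauge ψ N) {K : SchwartzMap (E d) ℂ}
    (hK : ∀ ξ, 𝓕 (K : E d → ℂ) ξ = (ψ ξ : ℂ)) (s : ℝ) (i : ℕ) (g : E d → ℂ) :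
    pieceHat ψ s i g = fun ξ => 𝓕 (dil K (2 ^ (i + 1))) ξ * pieceHat ψ s i g ξ := by
  refine hN.pieceHat_eq_mul s i g fun ξ h _ => ?_
  rw [fourier_dil K (by positivity), hK, hN.eq_one, Complex.ofReal_one]
  rw [hN.smul, abs_of_pos (by positivity), inv_mul_eq_div, div_le_one (by positivity), pow_succ]
  have : (0 : ℝ) < 2 ^ i := by positivity
  linarith

/-- A kernel of mean zero that reproduces the frequencies of size about `2^i`. -/
noncomputable def dilDiff (K : SchwartzMap (E d) ℂ) (i : ℕ) (y : E d) : ℂ :=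
  dil K (2 ^ (i + 1)) y - dil K (2 ^ i / 4) y

lemma integrable_dilDiff (K : SchwartzMap (E d) ℂ) (i : ℕ) : Integrable (dilDiff K i) :=
  (integrable_dil K (by positivity)).sub (integrable_dil K (by positivity))

lemma continuous_dilDiff (K : SchwartzMap (E d) ℂ) (i : ℕ) : Continuous (dilDiff K i) :=
  (continuous_dil K _).sub (continuous_dil K _)

lemma fourier_dilDiff {K : SchwartzMap (E d) ℂ} (hK : ∀ ξ, 𝓕 (K : E d → ℂ) ξ = (ψ ξ : ℂ)) (i : ℕ)
    (ξ : E d) : 𝓕 (dilDiff K i) ξ =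
      (ψ (((2 : ℝ) ^ (i + 1))⁻¹ • ξ) : ℂ) - (ψ (((2 : ℝ) ^ i / 4)⁻¹ • ξ) : ℂ) := by
  have := fourierInv_sub (integrable_dil K (R := 2 ^ (i + 1)) (by positivity))
    (integrable_dil K (R := 2 ^ i / 4) (by positivity)) (-ξ)
  simp only [Real.fourierInv_eq_fourier_neg, neg_neg] at this
  rw [fourier_dil K (by positivity), fourier_dil K (by positivity), hK, hK] at this
  exact this

lemma integral_dilDiff {K : SchwartzMap (E d) ℂ} (hK : ∀ ξ, 𝓕 (K : E d → ℂ) ξ = (ψ ξ : ℂ)) (i : ℕ) :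
    ∫ y, dilDiff K i y = 0 := by
  have := fourier_dilDiff hK i 0
  simpa [Real.fourier_eq] using this

/-- On the shell of `Δ_i` the wide cutoff is `1`, and the narrow one, dilated by `2^i/4`, is `0`
because `4 · 2^{-i} N ξ > 2 > 5/4`. The piece `i = 0` reaches the frequency `0`, where a kernel of
mean zero cannot reproduce it. -/
lemma IsGauge.pieceHat_eq_dilDiff (hN : IsGauge ψ N) {K : SchwartzMap (E d) ℂ}
    (hK : ∀ ξ, 𝓕 (K : E d → ℂ) ξ = (ψ ξ : ℂ)) (s : ℝ) {i : ℕ} (hi : 0 < i) (g : E d → ℂ) :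
    pieceHat ψ s i g = fun ξ => 𝓕 (dilDiff K i) ξ * pieceHat ψ s i g ξ := by
  refine hN.pieceHat_eq_mul s i g fun ξ h h' => ?_
  have h2 : (0 : ℝ) < 2 ^ i := by positivity
  have := h' hi
  rw [fourier_dilDiff hK, hN.eq_one, hN.eq_zero, Complex.ofReal_one, Complex.ofReal_zero, sub_zero]
  · rw [hN.smul, abs_of_pos (by positivity), inv_mul_eq_div, lt_div_iff₀ (by positivity)]
    linarith
  · rw [hN.smul, abs_of_pos (by positivity), inv_mul_eq_div, div_le_one (by positivity), pow_succ]
    linarith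

lemma lintegral_norm_mul_dil_le (K : SchwartzMap (E d) ℂ) {R : ℝ} (hR : 0 < R) :
    ∫⁻ y, ‖dil K R y‖ₑ * ‖y‖ₑ ≤ ENNReal.ofReal R⁻¹ * ∫⁻ y, ‖K y‖ₑ * ‖y‖ₑ := by
  rw [← lintegral_norm_mul_dil K hR, ← mul_assoc, ← ENNReal.ofReal_mul (by positivity),
    inv_mul_cancel₀ hR.ne']
  simp

lemma lintegral_norm_mul_dilDiff_le (K : SchwartzMap (E d) ℂ) (i : ℕ) :
    ∫⁻ y, ‖dilDiff K i y‖ₑ * ‖y‖ₑ ≤ ENNReal.ofReal (5 / 2 ^ i) * ∫⁻ y, ‖K y‖ₑ * ‖y‖ₑ := by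
  have h2 : (0 : ℝ) < 2 ^ i := by positivity
  calc ∫⁻ y, ‖dilDiff K i y‖ₑ * ‖y‖ₑ
      ≤ ∫⁻ y, (‖dil K (2 ^ (i + 1)) y‖ₑ * ‖y‖ₑ + ‖dil K (2 ^ i / 4) y‖ₑ * ‖y‖ₑ) := by
        refine lintegral_mono fun y => ?_
        rw [← add_mul]
        gcongr
        exact enorm_sub_le
    _ ≤ ENNReal.ofReal (2 ^ (i + 1))⁻¹ * (∫⁻ y, ‖K y‖ₑ * ‖y‖ₑ) +
        ENNReal.ofReal (2 ^ i / 4)⁻¹ * (∫⁻ y, ‖K y‖ₑ * ‖y‖ₑ) := by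
        have hm : Measurable fun y => ‖dil K (2 ^ (i + 1)) y‖ₑ * ‖y‖ₑ :=
          (continuous_dil K _).measurable.enorm.mul measurable_enorm
        rw [lintegral_add_left hm]
        exact add_le_add (lintegral_norm_mul_dil_le K (by positivity))
          (lintegral_norm_mul_dil_le K (by positivity))
    _ ≤ _ := by
        rw [← add_mul, ← ENNReal.ofReal_add (by positivity) (by positivity)]
        gcongr
        rw [pow_succ, inv_div, ← sub_nonneg]
        have : 5 / 2 ^ i - ((2 ^ i * 2)⁻¹ + 4 / 2 ^ i) = (1 / 2 : ℝ) / 2 ^ i := by field_simp; ring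
        rw [this]; positivity

lemma norm_fourierInv_le {h : E d → ℂ} (x : E d) : ‖𝓕⁻ h x‖ ≤ ∫ ξ, ‖h ξ‖ := by
  rw [Real.fourierInv_eq_fourier_neg]
  exact VectorFourier.norm_fourierIntegral_le_integral_norm _ _ _ _ _

/-- Translations of a function with Fourier transform in a ball of radius `R`. -/
lemma eLpNorm'_translate_sub_le (K : SchwartzMap (E d) ℂ) {R : ℝ} (hR : 0 < R) {h : E d → ℂ}
    (hh : Integrable h) (hK : h = fun ξ => 𝓕 (dil K R) ξ * h ξ) {p : ℝ} (hp : 1 < p) (z : E d) :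
    eLpNorm' (fun x => 𝓕⁻ h (x + z) - 𝓕⁻ h x) p volume ≤
      (∫⁻ y, ‖fderiv ℝ K y‖ₑ) * ENNReal.ofReal R * ‖z‖ₑ * eLpNorm' (𝓕⁻ h) p volume := by
  have hw := continuous_fourierInv hh
  have hD := integrable_dil K hR
  have hDc := continuous_dil K R
  have hrep : ∀ x, 𝓕⁻ h x = ∫ y, dil K R y * 𝓕⁻ h (x - y) := fun x => by
    conv_lhs => rw [hK]
    exact fourierInv_mul_eq hD hh x
  have hi : ∀ {D : E d → ℂ}, Integrable D → ∀ x, Integrable fun y => D y * 𝓕⁻ h (x - y) :=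
    fun hD x => hD.mul_bdd (hw.comp (continuous_const.sub continuous_id)).aestronglyMeasurable
      (Filter.Eventually.of_forall fun y => norm_fourierInv_le (x - y))
  -- The shift moves from the function to its reproducing kernel, where it costs a derivative of the
  -- kernel in `L¹`.
  have hdiff : ∀ x, 𝓕⁻ h (x + z) - 𝓕⁻ h x =
      ∫ y, (dil K R (y + z) - dil K R y) * 𝓕⁻ h (x - y) := by
    intro x
    have e : 𝓕⁻ h (x + z) = ∫ y, dil K R (y + z) * 𝓕⁻ h (x - y) := by
      rw [hrep (x + z), ← integral_add_right_eq_self (fun y => dil K R y * 𝓕⁻ h (x + z - y)) z]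
      congr 1; ext y; rw [add_sub_add_right_eq_sub]
    rw [e]
    rw [hrep x]
    rw [← integral_sub (hi (hD.comp_add_right z) x) (hi hD x)]
    simp_rw [sub_mul]
  have hm : Measurable fun y => ‖dil K R (y + z) - dil K R y‖ₑ := by
    have : Continuous fun y => dil K R (y + z) - dil K R y := by fun_prop
    exact this.measurable.enorm
  calc eLpNorm' (fun x => 𝓕⁻ h (x + z) - 𝓕⁻ h x) p volume
      ≤ eLpNorm' (fun x => ∫⁻ y, ‖dil K R (y + z) - dil K R y‖ₑ * ‖𝓕⁻ h (x - y)‖ₑ) p volume := by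
        simp only [eLpNorm', enorm_eq_self]
        gcongr with x
        rw [hdiff x]
        refine (enorm_integral_le_lintegral_enorm _).trans_eq ?_
        simp_rw [enorm_mul]
    _ ≤ (∫⁻ y, ‖dil K R (y + z) - dil K R y‖ₑ) * eLpNorm' (fun x => ‖𝓕⁻ h x‖ₑ) p volume :=
        eLpNorm'_lconvolution_le (f := fun x => ‖𝓕⁻ h x‖ₑ) hm hw.measurable.enorm hp
    _ ≤ _ := by
        refine mul_le_mul' (lintegral_translate_dil_sub_le K hR z) (le_of_eq ?_)
        simp [eLpNorm']

/-- Bernstein's inequality from `L²` to `L^∞`. -/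
lemma IsGauge.enorm_expDelta_le (hN : IsGauge ψ N) (hψ : Continuous ψ) {K : SchwartzMap (E d) ℂ}
    (hK : ∀ ξ, 𝓕 (K : E d → ℂ) ξ = (ψ ξ : ℂ)) (s : ℝ) (i : ℕ) {g : E d → ℂ}
    (hg : LocallyIntegrable g) (x : E d) :
    ‖expDelta ψ s i g x‖ₑ ≤ (ENNReal.ofReal (2 ^ d) * ∫⁻ y, ‖K y‖ₑ ^ (2 : ℝ)) ^ (1 / 2 : ℝ) *
      pow2 (d / 2 * i) * eLpNorm (expDelta ψ s i g) 2 volume := by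
  have hh := hN.integrable_pieceHat hψ s i hg
  have hw := continuous_fourierInv hh
  have e1 : eLpNorm (expDelta ψ s i g) 2 volume =
      (∫⁻ y, ‖expDelta ψ s i g (x - y)‖ₑ ^ (2 : ℝ)) ^ (1 / 2 : ℝ) := by
    rw [lintegral_sub_left_eq_self (fun y => ‖expDelta ψ s i g y‖ₑ ^ (2 : ℝ)) x,
      eLpNorm_eq_lintegral_rpow_enorm_toReal (by norm_num) (by norm_num)]
    simp
  have e2 : (ENNReal.ofReal (2 ^ d) * ∫⁻ y, ‖K y‖ₑ ^ (2 : ℝ)) ^ (1 / 2 : ℝ) * pow2 (d / 2 * i) =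
      (∫⁻ y, ‖dil K (2 ^ (i + 1)) y‖ₑ ^ (2 : ℝ)) ^ (1 / 2 : ℝ) := by
    rw [lintegral_sq_dil K (by positivity), show (d : ℝ) / 2 * i = (d * i : ℝ) * (1 / 2 : ℝ) by ring,
      ← pow2_rpow, ← ENNReal.mul_rpow_of_nonneg _ _ (by norm_num)]
    congr 1
    rw [mul_right_comm]
    congr 1
    rw [pow2, ← ENNReal.ofReal_mul (by positivity)]
    congr 1
    rw [show (d * i : ℝ) = ((d * i : ℕ) : ℝ) by push_cast; ring, Real.rpow_natCast, ← pow_mul, ← pow_add]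
    congr 1; ring
  rw [e1, e2]
  conv_lhs => rw [expDelta_eq, hN.pieceHat_eq_dil hK]
  refine (enorm_fourierInv_mul_le (integrable_dil K (by positivity)) hh x).trans ?_
  exact ENNReal.lintegral_mul_le_Lp_mul_Lq volume Real.HolderConjugate.two_two
    (continuous_dil K _).measurable.enorm.aemeasurable
    (hw.comp (continuous_const.sub continuous_id)).measurable.enorm.aemeasurable

/-! ### The embedding of `B^0_{p,2}` into `L^p` for integers `p ≥ 2` -/

/-- This is Bernoulli's inequality for `(y/x)^{m+2}`, multiplied by `x^{m+2}`. -/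
lemma pow_mul_le_pow_add_pow {x y : ℝ} (hx : 0 ≤ x) (hy : 0 ≤ y) (m : ℕ) :
    (m + 2) * (x ^ (m + 1) * y) ≤ (m + 1) * x ^ (m + 2) + y ^ (m + 2) := by
  rcases hx.eq_or_lt with rfl | hx
  · simp only [pow_succ]; simp only [mul_zero, zero_mul, zero_add]; positivity
  · have h := one_add_mul_le_pow (a := y / x - 1) (by have := div_nonneg hy hx.le; linarith) (m + 2)
    rw [add_sub_cancel, div_pow, le_div_iff₀ (by positivity)] at h
    push_cast at h
    have : (1 + ((m : ℝ) + 2) * (y / x - 1)) * x ^ (m + 2) =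
        (m + 2) * (x ^ (m + 1) * y) - (m + 1) * x ^ (m + 2) := by
      field_simp; ring
    linarith

/-- The gradient of `|z|^{m+2} / (m+2)`, conjugated. -/
noncomputable def powGrad (m : ℕ) (z : ℂ) : ℂ := ((‖z‖ ^ m : ℝ) : ℂ) * conj z

lemma continuous_powGrad (m : ℕ) : Continuous (powGrad m) := by
  unfold powGrad; fun_prop

lemma norm_powGrad (m : ℕ) (z : ℂ) : ‖powGrad m z‖ = ‖z‖ ^ (m + 1) := by
  rw [powGrad, norm_mul, Complex.norm_real, RCLike.norm_conj, Real.norm_of_nonneg (by positivity),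
    pow_succ]

/-- By convexity, `|z|^{m+2}` lies above its tangent at `b`, whose slope is given by `(m+2) powGrad
m b`. -/
lemma norm_pow_sub_le (m : ℕ) (a b : ℂ) :
    ‖b‖ ^ (m + 2) - ‖a‖ ^ (m + 2) ≤ (m + 2) * (powGrad m b * (b - a)).re := by
  have h := pow_mul_le_pow_add_pow (norm_nonneg b) (norm_nonneg a) m
  have e : powGrad m b * (b - a) = ((‖b‖ ^ (m + 2) : ℝ) : ℂ) - powGrad m b * a := by
    rw [mul_sub]; congr 1
    rw [powGrad, mul_assoc, mul_comm (conj b), Complex.mul_conj, Complex.normSq_eq_norm_sq]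
    push_cast; ring
  have h2 : (powGrad m b * a).re ≤ ‖b‖ ^ (m + 1) * ‖a‖ := by
    refine (Complex.re_le_norm _).trans ?_
    rw [norm_mul, norm_powGrad]
  rw [e, Complex.sub_re, Complex.ofReal_re]
  have : ((m : ℝ) + 2) * (powGrad m b * a).re ≤ (m + 2) * (‖b‖ ^ (m + 1) * ‖a‖) := by gcongr
  linarith

lemma norm_powGrad_sub_le (m : ℕ) (a b : ℂ) :
    ‖powGrad m a - powGrad m b‖ ≤ (m + 1) * ((‖a‖ + ‖b‖) ^ m * ‖a - b‖) := by
  induction m with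
  | zero =>
    simp only [powGrad, pow_zero, Complex.ofReal_one, one_mul, ← map_sub, RCLike.norm_conj]
    simp
  | succ m ih =>
    have e : powGrad (m + 1) a - powGrad (m + 1) b = (‖a‖ : ℂ) * (powGrad m a - powGrad m b) +
        ((‖a‖ - ‖b‖ : ℝ) : ℂ) * powGrad m b := by
      simp only [powGrad, pow_succ]; push_cast; ring
    rw [e]
    refine (norm_add_le _ _).trans ?_
    rw [norm_mul, norm_mul, norm_powGrad, Complex.norm_real, Complex.norm_real, norm_norm,
      Real.norm_eq_abs]
    have h1 : |‖a‖ - ‖b‖| ≤ ‖a - b‖ := abs_norm_sub_norm_le a b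
    have h2 : ‖b‖ ^ (m + 1) ≤ (‖a‖ + ‖b‖) ^ (m + 1) := by
      gcongr; linarith [norm_nonneg a]
    have h3 : ‖a‖ ≤ ‖a‖ + ‖b‖ := by linarith [norm_nonneg b]
    calc ‖a‖ * ‖powGrad m a - powGrad m b‖ + |‖a‖ - ‖b‖| * ‖b‖ ^ (m + 1)
        ≤ (‖a‖ + ‖b‖) * ((m + 1) * ((‖a‖ + ‖b‖) ^ m * ‖a - b‖)) +
          ‖a - b‖ * (‖a‖ + ‖b‖) ^ (m + 1) := by gcongr
      _ = _ := by push_cast; ring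

/-- Hölder's inequality with exponents `(m+2)/m, m+2, m+2`. -/
lemma lintegral_pow_mul_mul_le {X : Type*} [MeasurableSpace X] {μ : Measure X} (m : ℕ)
    {U D W : X → ℝ≥0∞} (hU : Measurable U) (hD : Measurable D) (hW : Measurable W) :
    ∫⁻ x, U x ^ m * (D x * W x) ∂μ ≤ eLpNorm' U ((m + 2 : ℕ) : ℝ) μ ^ m *
      (eLpNorm' D ((m + 2 : ℕ) : ℝ) μ * eLpNorm' W ((m + 2 : ℕ) : ℝ) μ) := by
  set p : ℝ := ((m + 2 : ℕ) : ℝ) with hp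
  have hp0 : 0 < p := by rw [hp]; positivity
  have h := ENNReal.lintegral_prod_norm_pow_le (μ := μ) (Finset.univ : Finset (Fin 3))
    (f := ![fun x => U x ^ p, fun x => D x ^ p, fun x => W x ^ p]) (p := ![m / p, 1 / p, 1 / p])
    (by
      intro i _
      fin_cases i
      · exact (hU.pow_const p).aemeasurable
      · exact (hD.pow_const p).aemeasurable
      · exact (hW.pow_const p).aemeasurable)
    (by
      simp only [Fin.sum_univ_three, Matrix.cons_val_zero, Matrix.cons_val_one, Matrix.cons_val]
      rw [hp]; push_cast; field_simp; ring)
    (by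
      intro i _
      fin_cases i <;> simp <;> positivity)
  simp only [Fin.prod_univ_three, Matrix.cons_val_zero, Matrix.cons_val_one, Matrix.cons_val] at h
  simp only [← ENNReal.rpow_mul, mul_div_cancel₀ _ hp0.ne', ENNReal.rpow_one, ENNReal.rpow_natCast]
    at h
  simp only [eLpNorm', enorm_eq_self, ← ENNReal.rpow_natCast (_ ^ (1 / p)), ← ENNReal.rpow_mul]
  rw [one_div_mul_eq_div, ← mul_assoc]
  simpa only [mul_assoc] using h

/-- Pairing with a function that is reproduced by a kernel of mean zero. -/
lemma enorm_integral_mul_le_of_kernel {L G w : E d → ℂ} (hL : Integrable L) (hLc : Continuous L)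
    (hL0 : ∫ y, L y = 0) (hG : Continuous G) (hw : Continuous w)
    (hrep : ∀ x, w x = ∫ y, L y * w (x - y))
    (hfin : ∫⁻ x, ‖G x‖ₑ * ∫⁻ y, ‖L y‖ₑ * ‖w (x - y)‖ₑ ≠ ⊤) (hGw : Integrable fun x => G x * w x) :
    ‖∫ x, G x * w x‖ₑ ≤ ∫⁻ y, ‖L y‖ₑ * ∫⁻ x, ‖G (x + y) - G x‖ₑ * ‖w x‖ₑ := by
  have hcont : Continuous fun q : E d × E d => G q.1 * (L q.2 * w (q.1 - q.2)) := by fun_prop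
  have hint : Integrable (fun q : E d × E d => G q.1 * (L q.2 * w (q.1 - q.2)))
      (volume.prod volume) := by
    refine ⟨hcont.aestronglyMeasurable, ?_⟩
    rw [HasFiniteIntegral, lintegral_prod _ hcont.measurable.enorm.aemeasurable]
    simp only [enorm_mul]
    refine lt_of_le_of_lt (lintegral_mono fun x => ?_) (lt_top_iff_ne_top.2 hfin)
    rw [lintegral_const_mul' _ _ enorm_ne_top]
  -- Fubini's theorem moves the convolution with `L` from `w` to `G`.
  have e1 : ∫ x, G x * w x = ∫ y, ∫ x, G x * (L y * w (x - y)) := by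
    rw [← integral_integral_swap hint]
    congr 1; ext x
    rw [hrep x]; exact (integral_const_mul _ _).symm
  have e2 : ∀ y, ∫ x, G x * (L y * w (x - y)) = ∫ x, L y * (G (x + y) * w x) := by
    intro y
    rw [← integral_add_right_eq_self (fun x => G x * (L y * w (x - y))) y]
    congr 1; ext x; rw [add_sub_cancel_right]; ring
  have hae : ∀ᵐ y, Integrable fun x => L y * (G (x + y) * w x) := by
    filter_upwards [hint.prod_left_ae] with y hy
    refine (hy.comp_add_right y).congr (Filter.Eventually.of_forall fun x => ?_)
    simp only [add_sub_cancel_right]; ring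
  have hI : Integrable fun y => ∫ x, L y * (G (x + y) * w x) := by
    refine hint.integral_prod_right.congr (Filter.Eventually.of_forall fun y => ?_)
    exact e2 y
  -- Since `L` has mean zero, `G x` may be subtracted for free. The pairing then sees only
  -- differences of `G`.
  have e3 : ∫ x, G x * w x = ∫ y, ∫ x, L y * ((G (x + y) - G x) * w x) := by
    have h0 : ∫ y, L y * ∫ x, G x * w x = 0 := by rw [integral_mul_const, hL0, zero_mul]
    rw [e1]
    simp_rw [e2]
    rw [← sub_zero (∫ y, ∫ x, L y * (G (x + y) * w x)), ← h0,
      ← integral_sub hI (hL.mul_const _)]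
    refine integral_congr_ae ?_
    filter_upwards [hae] with y hy
    rw [← integral_const_mul, ← integral_sub hy (hGw.const_mul _)]
    congr 1; ext x; ring
  rw [e3]
  refine (enorm_integral_le_lintegral_enorm _).trans (lintegral_mono fun y => ?_)
  rw [integral_const_mul, enorm_mul]
  gcongr
  refine (enorm_integral_le_lintegral_enorm _).trans_eq ?_
  simp_rw [enorm_mul]

lemma enorm_powGrad (m : ℕ) (z : ℂ) : ‖powGrad m z‖ₑ = ‖z‖ₑ ^ (m + 1) := by
  rw [← ofReal_norm, norm_powGrad, ENNReal.ofReal_pow (norm_nonneg _), ofReal_norm]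

lemma enorm_powGrad_sub_le (m : ℕ) (a b : ℂ) :
    ‖powGrad m a - powGrad m b‖ₑ ≤ (m + 1) * ((‖a‖ₑ + ‖b‖ₑ) ^ m * ‖a - b‖ₑ) := by
  rw [← ofReal_norm]
  refine (ENNReal.ofReal_le_ofReal (norm_powGrad_sub_le m a b)).trans_eq ?_
  rw [ENNReal.ofReal_mul (by positivity), ENNReal.ofReal_mul (by positivity),
    ENNReal.ofReal_pow (by positivity), ENNReal.ofReal_add (norm_nonneg _) (norm_nonneg _),
    ofReal_norm, ofReal_norm, ofReal_norm]
  congr 1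
  rw [ENNReal.ofReal_add (by positivity) (by positivity)]; simp

lemma eLpNorm'_enorm {X : Type*} [MeasurableSpace X] {μ : Measure X} (f : X → ℂ) (p : ℝ) :
    eLpNorm' (fun x => ‖f x‖ₑ) p μ = eLpNorm' f p μ := by simp [eLpNorm']

lemma eLpNorm'_pow_eq {X : Type*} [MeasurableSpace X] {μ : Measure X} (f : X → ℂ) {n : ℕ} (hn : n ≠ 0) :
    eLpNorm' f (n : ℝ) μ ^ n = ∫⁻ x, ‖f x‖ₑ ^ n ∂μ := by
  have : (n : ℝ) ≠ 0 := by exact_mod_cast hn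
  rw [eLpNorm', ← ENNReal.rpow_natCast, ← ENNReal.rpow_mul, one_div_mul_cancel this,
    ENNReal.rpow_one]
  simp

/-- Adding a piece `w` of higher frequency to `S` changes `‖S‖_p^p` by a quadratic amount. -/
lemma eLpNorm'_pow_add_le (m : ℕ) {S T w L : E d → ℂ} (hS : Continuous S)
    (hw : Continuous w) (hT : T = S + w) (hL : Integrable L) (hLc : Continuous L)
    (hL0 : ∫ y, L y = 0) (hrep : ∀ x, w x = ∫ y, L y * w (x - y))
    (hSf : eLpNorm' S ((m + 2 : ℕ) : ℝ) volume ≠ ⊤) (hTf : eLpNorm' T ((m + 2 : ℕ) : ℝ) volume ≠ ⊤)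
    (hwf : eLpNorm' w ((m + 2 : ℕ) : ℝ) volume ≠ ⊤) {D : ℝ≥0∞}
    (hD : ∀ z, eLpNorm' (fun x => T (x + z) - T x) ((m + 2 : ℕ) : ℝ) volume ≤ D * ‖z‖ₑ) :
    eLpNorm' T ((m + 2 : ℕ) : ℝ) volume ^ (m + 2) ≤
      eLpNorm' S ((m + 2 : ℕ) : ℝ) volume ^ (m + 2) +
      (m + 2) * ((m + 1) * 2 ^ m) * ((∫⁻ y, ‖L y‖ₑ * ‖y‖ₑ) * D) *
        (eLpNorm' T ((m + 2 : ℕ) : ℝ) volume ^ m * eLpNorm' w ((m + 2 : ℕ) : ℝ) volume) := by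
  set p : ℝ := ((m + 2 : ℕ) : ℝ) with hp
  have hp1 : 1 < p := by rw [hp]; push_cast; linarith [(Nat.cast_nonneg m : (0 : ℝ) ≤ m)]
  have hTc : Continuous T := hT ▸ hS.add hw
  set G : E d → ℂ := fun x => powGrad m (T x) with hG
  have hGc : Continuous G := (continuous_powGrad m).comp hTc
  have hTm := hTc.measurable.enorm
  have hwm := hw.measurable.enorm
  have hold : ∀ W : E d → ℝ≥0∞, Measurable W → ∫⁻ x, ‖G x‖ₑ * W x ≤
      eLpNorm' T p volume ^ m * (eLpNorm' T p volume * eLpNorm' W p volume) := by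
    intro W hW
    have := lintegral_pow_mul_mul_le (μ := (volume : Measure (E d))) m hTm hTm hW
    rw [eLpNorm'_enorm] at this
    refine le_trans (le_of_eq (lintegral_congr fun x => ?_)) this
    rw [hG]; simp only [enorm_powGrad]; ring
  have hGw : Integrable fun x => G x * w x := by
    refine ⟨(hGc.mul hw).aestronglyMeasurable, ?_⟩
    rw [HasFiniteIntegral]
    simp_rw [enorm_mul]
    refine (hold _ hwm).trans_lt ?_
    rw [eLpNorm'_enorm]
    exact (ENNReal.mul_ne_top (ENNReal.pow_ne_top hTf) (ENNReal.mul_ne_top hTf hwf)).lt_top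
  have hfin : ∫⁻ x, ‖G x‖ₑ * ∫⁻ y, ‖L y‖ₑ * ‖w (x - y)‖ₑ ≠ ⊤ := by
    have hm : Measurable fun q : E d × E d => ‖L q.2‖ₑ * ‖w (q.1 - q.2)‖ₑ :=
      (hLc.measurable.comp measurable_snd).enorm.mul (hw.measurable.comp measurable_sub).enorm
    refine ne_top_of_le_ne_top ?_ (hold _ hm.lintegral_prod_right')
    refine ENNReal.mul_ne_top (ENNReal.pow_ne_top hTf) (ENNReal.mul_ne_top hTf ?_)
    refine ne_top_of_le_ne_top ?_ (eLpNorm'_lconvolution_le hLc.measurable.enorm hwm hp1)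
    rw [eLpNorm'_enorm]
    exact ENNReal.mul_ne_top hL.2.ne hwf
  have hmain : ‖∫ x, G x * w x‖ₑ ≤ ((m + 1) * 2 ^ m) * ((∫⁻ y, ‖L y‖ₑ * ‖y‖ₑ) * D) *
        (eLpNorm' T p volume ^ m * eLpNorm' w p volume) := by
    refine (enorm_integral_mul_le_of_kernel hL hLc hL0 hGc hw hrep hfin hGw).trans ?_
    -- `powGrad` is locally Lipschitz, so a difference of `G` is a difference of `T` times `m`
    -- factors of size `|T|`. Hölder's inequality and `hD` bound it linearly in `|y|`, which the
    -- first moment of `L` then absorbs.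
    have hy : ∀ y, ∫⁻ x, ‖G (x + y) - G x‖ₑ * ‖w x‖ₑ ≤
        ((m + 1) * 2 ^ m) * D * (eLpNorm' T p volume ^ m * eLpNorm' w p volume) * ‖y‖ₑ := by
      intro y
      have hTy : Continuous fun x => T (x + y) := hTc.comp (continuous_add_const y)
      have hU : Measurable fun x => ‖T (x + y)‖ₑ + ‖T x‖ₑ := hTy.measurable.enorm.add hTm
      have hDm : Measurable fun x => ‖T (x + y) - T x‖ₑ := (hTy.sub hTc).measurable.enorm
      have hUn : eLpNorm' (fun x => ‖T (x + y)‖ₑ + ‖T x‖ₑ) p volume ≤ 2 * eLpNorm' T p volume := by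
        refine (eLpNorm'_add_le (f := fun x => ‖T (x + y)‖ₑ) (g := fun x => ‖T x‖ₑ)
          hTy.measurable.enorm.aestronglyMeasurable hTm.aestronglyMeasurable hp1.le).trans_eq ?_
        rw [eLpNorm'_enorm, two_mul]
        congr 1
        simp only [eLpNorm']
        rw [lintegral_add_right_eq_self (fun x => ‖T x‖ₑ ^ p) y]
      calc ∫⁻ x, ‖G (x + y) - G x‖ₑ * ‖w x‖ₑ
          ≤ ∫⁻ x, ((m : ℝ≥0∞) + 1) *
              ((‖T (x + y)‖ₑ + ‖T x‖ₑ) ^ m * (‖T (x + y) - T x‖ₑ * ‖w x‖ₑ)) := by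
            refine lintegral_mono fun x => ?_
            refine (mul_le_mul_left (enorm_powGrad_sub_le m _ _) _).trans_eq ?_
            ring
        _ = ((m : ℝ≥0∞) + 1) *
              ∫⁻ x, (‖T (x + y)‖ₑ + ‖T x‖ₑ) ^ m * (‖T (x + y) - T x‖ₑ * ‖w x‖ₑ) := by
            rw [lintegral_const_mul' _ _ (by simp)]
        _ ≤ ((m : ℝ≥0∞) + 1) * ((2 * eLpNorm' T p volume) ^ m *
              (D * ‖y‖ₑ * eLpNorm' w p volume)) := by
            gcongr
            refine (lintegral_pow_mul_mul_le m hU hDm hwm).trans ?_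
            rw [eLpNorm'_enorm, eLpNorm'_enorm]
            gcongr
            exact hD y
        _ = _ := by rw [mul_pow]; ring
    calc ∫⁻ y, ‖L y‖ₑ * ∫⁻ x, ‖G (x + y) - G x‖ₑ * ‖w x‖ₑ
        ≤ ∫⁻ y, ‖L y‖ₑ * ‖y‖ₑ *
          (((m + 1) * 2 ^ m) * D * (eLpNorm' T p volume ^ m * eLpNorm' w p volume)) := by
          refine lintegral_mono fun y => ?_
          refine (mul_le_mul_right (hy y) _).trans_eq ?_
          ring
      _ = _ := by
          have hLm : Measurable fun y => ‖L y‖ₑ * ‖y‖ₑ := hLc.measurable.enorm.mul measurable_enorm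
          rw [lintegral_mul_const _ hLm]; ring
  -- The tangent inequality at `T`, integrated. Finiteness of the norms permits the passage to real
  -- integrals.
  have hST : ∫⁻ x, ‖T x‖ₑ ^ (m + 2) ≤ (∫⁻ x, ‖S x‖ₑ ^ (m + 2)) + (m + 2) * ‖∫ x, G x * w x‖ₑ := by
    have hI : ∀ {f : E d → ℂ}, Continuous f → eLpNorm' f p volume ≠ ⊤ →
        Integrable fun x => ‖f x‖ ^ (m + 2) := by
      intro f hf hff
      refine ⟨(hf.norm.pow _).aestronglyMeasurable, ?_⟩
      rw [HasFiniteIntegral]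
      simp only [enorm_pow, enorm_norm]
      rw [← eLpNorm'_pow_eq f (by omega)]
      exact (ENNReal.pow_ne_top hff).lt_top
    have hofI : ∀ {f : E d → ℂ}, Continuous f → eLpNorm' f p volume ≠ ⊤ →
        ∫⁻ x, ‖f x‖ₑ ^ (m + 2) = ENNReal.ofReal (∫ x, ‖f x‖ ^ (m + 2)) := by
      intro f hf hff
      rw [ofReal_integral_eq_lintegral_ofReal (hI hf hff)
        (Filter.Eventually.of_forall fun x => by positivity)]
      simp_rw [ENNReal.ofReal_pow (norm_nonneg _), ofReal_norm]
    rw [hofI hTc hTf, hofI hS hSf, ← ofReal_norm,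
      show ((m : ℝ≥0∞) + 2) = ENNReal.ofReal (m + 2) by
        rw [ENNReal.ofReal_add (by positivity) (by positivity)]; simp,
      ← ENNReal.ofReal_mul (by positivity), ← ENNReal.ofReal_add (by positivity) (by positivity)]
    refine ENNReal.ofReal_le_ofReal ?_
    rw [← sub_le_iff_le_add', ← integral_sub (hI hTc hTf) (hI hS hSf)]
    calc ∫ x, (‖T x‖ ^ (m + 2) - ‖S x‖ ^ (m + 2)) ≤ ∫ x, ((m : ℝ) + 2) * (G x * w x).re := by
          refine integral_mono ((hI hTc hTf).sub (hI hS hSf)) (hGw.re.const_mul _) fun x => ?_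
          have := norm_pow_sub_le m (S x) (T x)
          have e : T x - S x = w x := by rw [hT]; simp
          rwa [e] at this
      _ = ((m : ℝ) + 2) * (∫ x, G x * w x).re := by
          rw [integral_const_mul]; congr 1; exact integral_re hGw
      _ ≤ _ := by gcongr; exact Complex.re_le_norm _
  rw [eLpNorm'_pow_eq _ (by omega), eLpNorm'_pow_eq _ (by omega)]
  refine hST.trans (add_le_add le_rfl ?_)
  calc _ ≤ _ := mul_le_mul_right hmain _
    _ = _ := by ring

lemma ennreal_mul_le_sq_add_sq (a b : ℝ≥0∞) : a * b ≤ a ^ 2 + b ^ 2 := by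
  rcases le_total a b with h | h
  · calc a * b ≤ b * b := mul_le_mul' h le_rfl
      _ = b ^ 2 := (sq b).symm
      _ ≤ _ := le_add_self
  · calc a * b ≤ a * a := mul_le_mul' le_rfl h
      _ = a ^ 2 := (sq a).symm
      _ ≤ _ := le_self_add

lemma sum_geometric_half_le (n : ℕ) : ∑ i ∈ Finset.range n, (2⁻¹ : ℝ≥0∞) ^ i ≤ 2 :=
  (ENNReal.sum_le_tsum _).trans_eq ENNReal.tsum_geometric_two

/-- Schur's test for a lower triangular kernel with geometric decay. -/
lemma sum_mul_sum_geometric_le (J : ℕ) (A : ℕ → ℝ≥0∞) :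
    ∑ j ∈ Finset.range J, A j * ∑ i ∈ Finset.range (j + 1), (2⁻¹ : ℝ≥0∞) ^ (j - i) * A i ≤
      4 * ∑ i ∈ Finset.range J, A i ^ 2 := by
  calc ∑ j ∈ Finset.range J, A j * ∑ i ∈ Finset.range (j + 1), (2⁻¹ : ℝ≥0∞) ^ (j - i) * A i
      ≤ ∑ j ∈ Finset.range J, ∑ i ∈ Finset.range (j + 1),
          ((2⁻¹ : ℝ≥0∞) ^ (j - i) * A j ^ 2 + (2⁻¹ : ℝ≥0∞) ^ (j - i) * A i ^ 2) := by
        refine Finset.sum_le_sum fun j _ => ?_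
        rw [Finset.mul_sum]
        refine Finset.sum_le_sum fun i _ => ?_
        rw [← mul_add, mul_left_comm]
        exact mul_le_mul_right (ennreal_mul_le_sq_add_sq _ _) _
    _ = ∑ j ∈ Finset.range J, (∑ i ∈ Finset.range (j + 1), (2⁻¹ : ℝ≥0∞) ^ (j - i)) * A j ^ 2 +
        ∑ i ∈ Finset.range J, (∑ j ∈ Finset.Ico i J, (2⁻¹ : ℝ≥0∞) ^ (j - i)) * A i ^ 2 := by
        simp_rw [Finset.sum_add_distrib, Finset.sum_mul]
        congr 1
        refine Finset.sum_comm' fun j i => ?_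
        simp only [Finset.mem_range, Finset.mem_Ico]; omega
    _ ≤ ∑ j ∈ Finset.range J, 2 * A j ^ 2 + ∑ i ∈ Finset.range J, 2 * A i ^ 2 := by
        refine add_le_add (Finset.sum_le_sum fun j _ => ?_) (Finset.sum_le_sum fun i _ => ?_)
        · gcongr
          refine le_trans (le_of_eq ?_) (sum_geometric_half_le (j + 1))
          rw [← Finset.sum_range_reflect]
          exact Finset.sum_congr rfl fun i hi => by
            simp only [Finset.mem_range] at hi; congr 1; omega
        · gcongr
          rw [Finset.sum_Ico_eq_sum_range]
          simp only [Nat.add_sub_cancel_left]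
          exact sum_geometric_half_le _
    _ = _ := by rw [← Finset.mul_sum, ← two_mul, ← mul_assoc]; norm_num

/-- Bound each `M (j+1)^m` by the `m`-th power of the maximum `X` of `M`, sum the steps up to an
index where the maximum is attained, and divide by `X^m`. Finiteness of `M` is needed for this
division. -/
lemma sq_le_of_pow_step (m J : ℕ) {C : ℝ≥0∞} {M A : ℕ → ℝ≥0∞} (h0 : M 0 = 0)
    (hM : ∀ j ≤ J, M j ≠ ⊤)
    (hstep : ∀ j < J, M (j + 1) ^ (m + 2) ≤ M j ^ (m + 2) + C * (M (j + 1) ^ m *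
      (A j * ∑ i ∈ Finset.range (j + 1), (2⁻¹ : ℝ≥0∞) ^ (j - i) * A i))) :
    M J ^ 2 ≤ 4 * C * ∑ i ∈ Finset.range J, A i ^ 2 := by
  obtain ⟨j₀, hj₀, hmax⟩ := Finset.exists_max_image (Finset.range (J + 1)) M ⟨0, by simp⟩
  simp only [Finset.mem_range] at hj₀ hmax
  set X := M j₀ with hX
  have hXt : X ≠ ⊤ := hM _ (by omega)
  rcases eq_or_ne X 0 with hX0 | hX0
  · have : M J = 0 := le_antisymm ((hmax J (by omega)).trans_eq hX0) bot_le
    simp [this]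
  have hind : ∀ l ≤ J, M l ^ (m + 2) ≤ ∑ j ∈ Finset.range l, C * (X ^ m *
      (A j * ∑ i ∈ Finset.range (j + 1), (2⁻¹ : ℝ≥0∞) ^ (j - i) * A i)) := by
    intro l
    induction l with
    | zero => intro _; simp [h0]
    | succ l ih =>
      intro hl
      rw [Finset.sum_range_succ]
      refine (hstep l (by omega)).trans (add_le_add (ih (by omega)) ?_)
      gcongr
      exact hmax _ (by omega)
  have h1 : X ^ m * X ^ 2 ≤ X ^ m * (4 * C * ∑ i ∈ Finset.range J, A i ^ 2) := by
    rw [← pow_add]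
    refine (hind j₀ (by omega)).trans ?_
    calc _ ≤ ∑ j ∈ Finset.range J, C * (X ^ m *
      (A j * ∑ i ∈ Finset.range (j + 1), (2⁻¹ : ℝ≥0∞) ^ (j - i) * A i)) :=
          Finset.sum_le_sum_of_subset (Finset.range_mono (by omega))
      _ ≤ C * (X ^ m * (4 * ∑ i ∈ Finset.range J, A i ^ 2)) := by
          rw [← Finset.mul_sum, ← Finset.mul_sum]
          gcongr
          exact sum_mul_sum_geometric_le J A
      _ = _ := by ring
  rw [ENNReal.mul_le_mul_iff_right (pow_ne_zero _ hX0) (ENNReal.pow_ne_top hXt)] at h1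
  exact le_trans (by gcongr; exact hmax J (by omega)) h1

lemma partSum_succ (s : ℝ) (j : ℕ) (g : E d → ℂ) :
    partSum ψ s (j + 1) g = partSum ψ s j g + expDelta ψ s j g := by
  ext x; simp [partSum, Finset.sum_range_succ]

lemma IsGauge.continuous_expDelta (hN : IsGauge ψ N) (hψ : Continuous ψ) (s : ℝ) (i : ℕ)
    {g : E d → ℂ} (hg : LocallyIntegrable g) : Continuous (expDelta ψ s i g) :=
  continuous_fourierInv (hN.integrable_pieceHat hψ s i hg)

lemma IsGauge.continuous_partSum (hN : IsGauge ψ N) (hψ : Continuous ψ) (s : ℝ) (j : ℕ)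
    {g : E d → ℂ} (hg : LocallyIntegrable g) : Continuous (partSum ψ s j g) :=
  continuous_finsetSum _ fun i _ => hN.continuous_expDelta hψ s i hg

/-- The embedding of the Besov space `B^0_{p,2}` into `L^p`, for integers `p = m + 2`. -/
lemma IsGauge.exists_eLpNorm'_partSum_le (hN : IsGauge ψ N) (hψ : Continuous ψ)
    {K : SchwartzMap (E d) ℂ} (hK : ∀ ξ, 𝓕 (K : E d → ℂ) ξ = (ψ ξ : ℂ)) (m : ℕ) :
    ∃ C : ℝ≥0∞, C ≠ ⊤ ∧ 1 ≤ C ∧ ∀ (s : ℝ) (J : ℕ) (g : E d → ℂ), LocallyIntegrable g →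
      eLpNorm' (partSum ψ s J g) ((m + 2 : ℕ) : ℝ) volume ≤
        C * (∑ i ∈ Finset.range J,
          eLpNorm' (expDelta ψ s i g) ((m + 2 : ℕ) : ℝ) volume ^ (2 : ℝ)) ^ (1 / 2 : ℝ) := by
  set p : ℝ := ((m + 2 : ℕ) : ℝ) with hp
  have hp1 : 1 < p := by rw [hp]; push_cast; linarith [(Nat.cast_nonneg m : (0 : ℝ) ≤ m)]
  set c₁ := ∫⁻ y, ‖K y‖ₑ * ‖y‖ₑ with hc₁
  set c₂ := ∫⁻ y, ‖fderiv ℝ K y‖ₑ with hc₂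
  have hc₁t : c₁ ≠ ⊤ := by
    have := (K.integrable_pow_mul volume 1).2
    rw [HasFiniteIntegral] at this
    simp only [pow_one, enorm_mul, enorm_norm] at this
    rw [hc₁]; simp_rw [mul_comm ‖K _‖ₑ]; exact this.ne
  have hc₂t : c₂ ≠ ⊤ := by
    have := (SchwartzMap.fderivCLM ℝ (E d) ℂ K).integrable (μ := volume)
    exact this.2.ne
  -- The summand `1` handles `j = 0`. The `10` is `5 · 2`: the first moment of `dilDiff K j` is at
  -- most `5 · 2^{-j} c₁`, and translating the piece `i` costs `2^{i+1} c₂`.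
  set C₀ : ℝ≥0∞ := 1 + (m + 2) * ((m + 1) * 2 ^ m) * (10 * (c₁ * c₂)) with hC₀
  have hC₀t : C₀ ≠ ⊤ := by
    refine ENNReal.add_ne_top.2 ⟨ENNReal.one_ne_top, ENNReal.mul_ne_top ?_ ?_⟩
    · exact ENNReal.mul_ne_top (by simp) (ENNReal.mul_ne_top (by simp) (by simp))
    · exact ENNReal.mul_ne_top (by norm_num) (ENNReal.mul_ne_top hc₁t hc₂t)
  have h1C : 1 ≤ (4 * C₀) ^ (1 / 2 : ℝ) := by
    refine ENNReal.one_le_rpow ?_ (by norm_num)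
    calc (1 : ℝ≥0∞) = 1 * 1 := (mul_one 1).symm
      _ ≤ 4 * C₀ := mul_le_mul' (by norm_num) le_self_add
  refine ⟨(4 * C₀) ^ (1 / 2 : ℝ), ENNReal.rpow_ne_top_of_nonneg (by norm_num)
    (ENNReal.mul_ne_top (by norm_num) hC₀t), h1C, fun s J g hg => ?_⟩
  set A : ℕ → ℝ≥0∞ := fun i => eLpNorm' (expDelta ψ s i g) p volume with hA
  by_cases hAt : ∃ i ∈ Finset.range J, A i = ⊤
  · obtain ⟨i, hi, hit⟩ := hAt
    have : ∑ i ∈ Finset.range J, A i ^ (2 : ℝ) = ⊤ := by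
      rw [ENNReal.sum_eq_top]
      exact ⟨i, hi, by rw [hit]; exact ENNReal.top_rpow_of_pos (by norm_num)⟩
    change _ ≤ _ * (∑ i ∈ Finset.range J, A i ^ (2 : ℝ)) ^ (1 / 2 : ℝ)
    rw [this, ENNReal.top_rpow_of_pos (by norm_num), ENNReal.mul_top (by positivity)]
    exact le_top
  push Not at hAt
  have hw := fun i => hN.continuous_expDelta hψ s i hg
  have hS := fun j => hN.continuous_partSum hψ s j hg
  have hSf : ∀ j ≤ J, eLpNorm' (partSum ψ s j g) p volume ≠ ⊤ := by
    intro j hj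
    have e : partSum ψ s j g = ∑ i ∈ Finset.range j, expDelta ψ s i g := by
      ext x; simp [partSum]
    rw [e]
    refine ne_top_of_le_ne_top ?_
      (eLpNorm'_sum_le (fun i _ => (hw i).aestronglyMeasurable) hp1.le)
    exact ENNReal.sum_ne_top.2 fun i hi =>
      hAt i (by simp only [Finset.mem_range] at hi ⊢; omega)
  have hsq := sq_le_of_pow_step m J (C := C₀) (M := fun j => eLpNorm' (partSum ψ s j g) p volume)
    (A := A) (by
      have : partSum ψ s 0 g = 0 := by ext x; simp [partSum]
      simp only [this]
      exact eLpNorm'_zero (by linarith)) hSf (by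
    intro j hj
    -- The first step starts from `S_0 = 0`, so it needs no cancellation.
    rcases Nat.eq_zero_or_pos j with rfl | hj0
    · have e : partSum ψ s 1 g = expDelta ψ s 0 g := by ext x; simp [partSum]
      simp only [zero_add, e, Finset.sum_range_one, Nat.sub_self, pow_zero, one_mul]
      refine le_trans ?_ le_add_self
      change A 0 ^ (m + 2) ≤ C₀ * (A 0 ^ m * (A 0 * A 0))
      calc A 0 ^ (m + 2) = 1 * (A 0 ^ m * (A 0 * A 0)) := by ring
        _ ≤ _ := by gcongr; exact le_self_add
    · have hL := hN.pieceHat_eq_dilDiff hK s hj0 g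
      have hrep : ∀ x, expDelta ψ s j g x = ∫ y, dilDiff K j y * expDelta ψ s j g (x - y) :=
        fun x => by
          conv_lhs => rw [expDelta_eq, hL]
          exact fourierInv_mul_eq (integrable_dilDiff K j) (hN.integrable_pieceHat hψ s j hg) x
      have hD : ∀ z, eLpNorm' (fun x => partSum ψ s (j + 1) g (x + z) - partSum ψ s (j + 1) g x)
          p volume ≤ (∑ i ∈ Finset.range (j + 1), c₂ * ENNReal.ofReal (2 ^ (i + 1)) * A i) * ‖z‖ₑ := by
        intro z
        have e : (fun x => partSum ψ s (j + 1) g (x + z) - partSum ψ s (j + 1) g x) =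
            ∑ i ∈ Finset.range (j + 1), fun x => expDelta ψ s i g (x + z) - expDelta ψ s i g x := by
          ext x; simp [partSum]
        rw [e, Finset.sum_mul]
        refine (eLpNorm'_sum_le (fun i _ => (((hw i).comp (continuous_add_const z)).sub
          (hw i)).aestronglyMeasurable) hp1.le).trans (Finset.sum_le_sum fun i _ => ?_)
        refine (eLpNorm'_translate_sub_le K (by positivity) (hN.integrable_pieceHat hψ s i hg)
          (hN.pieceHat_eq_dil hK s i g) hp1 z).trans_eq ?_
        rw [← expDelta_eq]; ring
      have h := eLpNorm'_pow_add_le m (hS j) (hw j) (partSum_succ s j g) (integrable_dilDiff K j)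
        (continuous_dilDiff K j) (integral_dilDiff hK j) hrep (hSf j hj.le) (hSf (j + 1) hj)
        (hAt j (Finset.mem_range.2 hj)) hD
      refine h.trans ?_
      refine add_le_add le_rfl ?_
      -- The gain `2^{-j}` from the oscillation of the new piece, against the loss `2^i` from
      -- differentiating an earlier one, leaves the summable kernel `2^{-(j-i)}`.
      have hq : (∫⁻ y, ‖dilDiff K j y‖ₑ * ‖y‖ₑ) *
          (∑ i ∈ Finset.range (j + 1), c₂ * ENNReal.ofReal (2 ^ (i + 1)) * A i) ≤
          10 * (c₁ * c₂) * ∑ i ∈ Finset.range (j + 1), (2⁻¹ : ℝ≥0∞) ^ (j - i) * A i := by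
        refine (mul_le_mul_left (lintegral_norm_mul_dilDiff_le K j) _).trans_eq ?_
        rw [Finset.mul_sum, Finset.mul_sum]
        refine Finset.sum_congr rfl fun i hi => ?_
        have hij : i ≤ j := by simp only [Finset.mem_range] at hi; omega
        have e : ENNReal.ofReal (5 / 2 ^ j) * ENNReal.ofReal (2 ^ (i + 1)) =
            10 * (2⁻¹ : ℝ≥0∞) ^ (j - i) := by
          rw [← ENNReal.ofReal_mul (by positivity),
            show (2⁻¹ : ℝ≥0∞) = ENNReal.ofReal 2⁻¹ by
              rw [ENNReal.ofReal_inv_of_pos (by norm_num)]; norm_num,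
            ← ENNReal.ofReal_pow (by norm_num), show (10 : ℝ≥0∞) = ENNReal.ofReal 10 by norm_num,
            ← ENNReal.ofReal_mul (by norm_num)]
          congr 1
          obtain ⟨l, rfl⟩ := Nat.exists_eq_add_of_le hij
          rw [Nat.add_sub_cancel_left, inv_pow, pow_add, pow_succ]
          field_simp; norm_num
        calc _ = (ENNReal.ofReal (5 / 2 ^ j) * ENNReal.ofReal (2 ^ (i + 1))) * (c₁ * c₂ * A i) := by
              rw [← hc₁]; ring
          _ = _ := by rw [e]; ring
      calc _ ≤ (m + 2) * ((m + 1) * 2 ^ m) *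
            (10 * (c₁ * c₂) * ∑ i ∈ Finset.range (j + 1), (2⁻¹ : ℝ≥0∞) ^ (j - i) * A i) *
            (eLpNorm' (partSum ψ s (j + 1) g) p volume ^ m * A j) := by gcongr
        _ = ((m + 2) * ((m + 1) * 2 ^ m) * (10 * (c₁ * c₂))) *
            (eLpNorm' (partSum ψ s (j + 1) g) p volume ^ m *
            (A j * ∑ i ∈ Finset.range (j + 1), (2⁻¹ : ℝ≥0∞) ^ (j - i) * A i)) := by ring
        _ ≤ _ := by gcongr; exact le_add_self)
  calc eLpNorm' (partSum ψ s J g) p volume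
      = (eLpNorm' (partSum ψ s J g) p volume ^ 2) ^ (1 / 2 : ℝ) := by
        rw [← ENNReal.rpow_natCast, ← ENNReal.rpow_mul]; norm_num
    _ ≤ (4 * C₀ * ∑ i ∈ Finset.range J, A i ^ 2) ^ (1 / 2 : ℝ) := by gcongr
    _ = _ := by
        rw [ENNReal.mul_rpow_of_nonneg _ _ (by norm_num)]
        simp only [ENNReal.rpow_two, hA]

/-! ### Space-time bounds for the increments of the power -/

lemma enorm_pow_sub_pow_le {a b : ℂ} {r : ℝ≥0∞} (ha : ‖a‖ₑ ≤ r) (hb : ‖b‖ₑ ≤ r) (n : ℕ) :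
    ‖b ^ (n + 1) - a ^ (n + 1)‖ₑ ≤ (n + 1) * (‖b - a‖ₑ * r ^ n) := by
  induction n with
  | zero => simp
  | succ n ih =>
    have e : b ^ (n + 1 + 1) - a ^ (n + 1 + 1) = b * (b ^ (n + 1) - a ^ (n + 1)) + (b - a) * a ^ (n + 1) := by
      ring
    rw [e]
    refine (enorm_add_le _ _).trans ?_
    rw [enorm_mul, enorm_mul, enorm_pow]
    calc ‖b‖ₑ * ‖b ^ (n + 1) - a ^ (n + 1)‖ₑ + ‖b - a‖ₑ * ‖a‖ₑ ^ (n + 1)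
        ≤ r * ((n + 1) * (‖b - a‖ₑ * r ^ n)) + ‖b - a‖ₑ * r ^ (n + 1) := by gcongr
      _ = _ := by push_cast; ring

/-- Hölder's inequality for `|T| ≤ c |w| U^n`. -/
lemma eLpNorm'_le_of_le_mul_rpow {X : Type*} [MeasurableSpace X] {μ : Measure X} {T w : X → ℂ}
    {U : X → ℝ≥0∞} (hw : Measurable w) (hU : Measurable U) {c : ℝ≥0∞} {p p' n : ℝ} (hp : 0 < p)
    (hp' : 0 < p') (hn : 0 ≤ n) (h : 1 / p' = (1 + n) / p)
    (hT : ∀ᵐ x ∂μ, ‖T x‖ₑ ≤ c * (‖w x‖ₑ * U x ^ n)) :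
    eLpNorm' T p' μ ≤ c * (eLpNorm' w p μ * eLpNorm' U p μ ^ n) := by
  have hwm : Measurable fun x => ‖w x‖ₑ := hw.enorm
  have hm : Measurable fun x => (‖w x‖ₑ * U x ^ n) ^ p' := (hwm.mul (hU.pow_const n)).pow_const p'
  have h1 : p' * (1 + n) = p := by field_simp at h; linarith
  have hsum : p' / p + n * p' / p = 1 := by rw [← add_div, div_eq_one_iff_eq hp.ne']; linarith
  have key : ∫⁻ x, (‖w x‖ₑ * U x ^ n) ^ p' ∂μ ≤
      (∫⁻ x, ‖w x‖ₑ ^ p ∂μ) ^ (p' / p) * (∫⁻ x, U x ^ p ∂μ) ^ (n * p' / p) := by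
    refine le_trans (le_of_eq (lintegral_congr fun x => ?_)) (ENNReal.lintegral_mul_norm_pow_le
      (hwm.pow_const p).aemeasurable (hU.pow_const p).aemeasurable (by positivity) (by positivity) hsum)
    rw [ENNReal.mul_rpow_of_nonneg _ _ hp'.le, ← ENNReal.rpow_mul, ← ENNReal.rpow_mul,
      ← ENNReal.rpow_mul, mul_div_cancel₀ _ hp.ne', mul_div_cancel₀ _ hp.ne']
  have hip : 0 ≤ 1 / p' := by positivity
  calc eLpNorm' T p' μ ≤ (∫⁻ x, (c * (‖w x‖ₑ * U x ^ n)) ^ p' ∂μ) ^ (1 / p') := by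
        refine ENNReal.rpow_le_rpow (lintegral_mono_ae ?_) hip
        filter_upwards [hT] with x hx
        gcongr
    _ = c * (∫⁻ x, (‖w x‖ₑ * U x ^ n) ^ p' ∂μ) ^ (1 / p') := by
        simp_rw [ENNReal.mul_rpow_of_nonneg c _ hp'.le]
        rw [lintegral_const_mul _ hm, ENNReal.mul_rpow_of_nonneg _ _ hip, ← ENNReal.rpow_mul,
          mul_one_div_cancel hp'.ne', ENNReal.rpow_one]
    _ ≤ c * ((∫⁻ x, ‖w x‖ₑ ^ p ∂μ) ^ (p' / p) * (∫⁻ x, U x ^ p ∂μ) ^ (n * p' / p)) ^ (1 / p') := by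
        gcongr
    _ = _ := by
        rw [ENNReal.mul_rpow_of_nonneg _ _ hip, ← ENNReal.rpow_mul, ← ENNReal.rpow_mul]
        simp only [eLpNorm', enorm_eq_self]
        rw [← ENNReal.rpow_mul]
        congr 3 <;> field_simp

/-- A Bochner integral with a parameter is measurable even where the integrand fails to be
integrable, so the exceptional times do no harm. -/
lemma measurable_expDelta (hψ : Continuous ψ) (s : ℝ) (i : ℕ) {vhat : ℝ → E d → ℂ}
    (hv : Measurable (Function.uncurry vhat)) :
    Measurable fun z : ℝ × E d => expDelta ψ s i (vhat z.1) z.2 := by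
  have h1 : Continuous fun ξ : E d => (2 : ℝ) ^ (s * l1Norm ξ) :=
    Continuous.rpow continuous_const (continuous_const.mul continuous_l1Norm)
      fun _ => Or.inl (by norm_num)
  have h2 : Continuous fun ξ : E d => (((2 : ℝ) ^ (s * l1Norm ξ) * dyadicSymbol ψ i ξ : ℝ) : ℂ) :=
    Complex.continuous_ofReal.comp (h1.mul (continuous_dyadicSymbol hψ i))
  have h3 : Measurable fun q : (ℝ × E d) × E d =>
      (((2 : ℝ) ^ (s * l1Norm q.2) * dyadicSymbol ψ i q.2 : ℝ) : ℂ) * vhat q.1.1 q.2 :=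
    (h2.measurable.comp measurable_snd).mul
      (hv.comp ((measurable_fst.comp measurable_fst).prodMk measurable_snd))
  have h4 : Measurable fun q : (ℝ × E d) × E d => ((Real.fourierChar (inner ℝ q.2 q.1.2) : Circle) : ℂ) := by
    have : Continuous fun q : (ℝ × E d) × E d => ((Real.fourierChar (inner ℝ q.2 q.1.2) : Circle) : ℂ) :=
      continuous_subtype_val.comp (Real.continuous_fourierChar.comp (by fun_prop))
    exact this.measurable
  have h5 := (h4.mul h3).stronglyMeasurable.integral_prod_right' (ν := (volume : Measure (E d)))
  convert h5.measurable using 1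
  ext z
  rw [expDelta_eq, Real.fourierInv_eq]
  rfl

lemma measurable_partSum (hψ : Continuous ψ) (s : ℝ) (j : ℕ) {vhat : ℝ → E d → ℂ}
    (hv : Measurable (Function.uncurry vhat)) :
    Measurable fun z : ℝ × E d => partSum ψ s j (vhat z.1) z.2 :=
  Finset.measurable_sum _ fun i _ => measurable_expDelta hψ s i hv

lemma measurable_powDiff (hψ : Continuous ψ) (s : ℝ) (n j : ℕ) {vhat : ℝ → E d → ℂ}
    (hv : Measurable (Function.uncurry vhat)) :
    Measurable fun z : ℝ × E d => powDiff ψ s n j (vhat z.1) z.2 :=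
  ((measurable_partSum hψ s _ hv).pow_const _).sub ((measurable_partSum hψ s _ hv).pow_const _)

lemma eLpNorm'_eLpNorm' {F : ℝ → E d → ℝ≥0∞} (hF : Measurable fun z : ℝ × E d => F z.1 z.2)
    {p : ℝ} (hp : 0 < p) : eLpNorm' (fun t => eLpNorm' (F t) p volume) p volume =
      eLpNorm' (fun z : ℝ × E d => F z.1 z.2) p (volume.prod volume) := by
  simp only [eLpNorm', enorm_eq_self]
  rw [lintegral_prod _ (hF.pow_const p).aemeasurable]
  congr 1
  refine lintegral_congr fun t => ?_
  rw [← ENNReal.rpow_mul, one_div_mul_cancel hp.ne', ENNReal.rpow_one]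

lemma eLpNorm_ofReal_eq {X F : Type*} [MeasurableSpace X] {μ : Measure X} [TopologicalSpace F]
    [ContinuousENorm F] (f : X → F) {p : ℝ} (hp : 0 < p) :
    eLpNorm f (ENNReal.ofReal p) μ = eLpNorm' f p μ := by
  rw [eLpNorm_eq_eLpNorm' (by simpa using hp) ENNReal.ofReal_ne_top, ENNReal.toReal_ofReal hp.le]

lemma mixedNorm_eq {F : ℝ → E d → ℂ} (hF : Measurable fun z : ℝ × E d => F z.1 z.2)
    {p : ℝ} (hp : 0 < p) : mixedNorm (ENNReal.ofReal p) (ENNReal.ofReal p) F =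
      eLpNorm' (fun z : ℝ × E d => F z.1 z.2) p (volume.prod volume) := by
  rw [mixedNorm, eLpNorm_ofReal_eq _ hp]
  simp_rw [eLpNorm_ofReal_eq _ hp]
  have := eLpNorm'_eLpNorm' (F := fun t x => ‖F t x‖ₑ) hF.enorm hp
  simpa [eLpNorm'] using this

lemma measurable_eLpNorm' {F : ℝ → E d → ℂ} (hF : Measurable fun z : ℝ × E d => F z.1 z.2) (p : ℝ) :
    Measurable fun t => eLpNorm' (F t) p volume :=
  ((hF.enorm.pow_const p).lintegral_prod_right').pow_const _

lemma ae_prod_of_ae {P : ℝ → Prop} (h : ∀ᵐ t : ℝ, P t) :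
    ∀ᵐ z : ℝ × E d ∂(volume.prod volume), P z.1 :=
  Measure.quasiMeasurePreserving_fst.ae h

lemma partSum_succ_sub (s : ℝ) (j : ℕ) (g : E d → ℂ) (x : E d) :
    partSum ψ s (j + 1) g x - partSum ψ s j g x = expDelta ψ s j g x := by
  rw [partSum_succ]; simp

lemma enorm_partSum_le (s : ℝ) {l j : ℕ} (hl : l ≤ j) (g : E d → ℂ) (x : E d) :
    ‖partSum ψ s l g x‖ₑ ≤ ∑ i ∈ Finset.range j, ‖expDelta ψ s i g x‖ₑ :=
  (enorm_sum_le _ _).trans (Finset.sum_le_sum_of_subset (Finset.range_mono hl))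

lemma enorm_powDiff_le (s : ℝ) (n j : ℕ) (g : E d → ℂ) (x : E d) {r : ℝ≥0∞}
    (h1 : ‖partSum ψ s j g x‖ₑ ≤ r) (h2 : ‖partSum ψ s (j + 1) g x‖ₑ ≤ r) :
    ‖powDiff ψ s n j g x‖ₑ ≤ (n + 1) * (‖expDelta ψ s j g x‖ₑ * r ^ n) := by
  have := enorm_pow_sub_pow_le h1 h2 n
  rwa [partSum_succ_sub] at this

/-- The norm of `2^{s|∇|} Δ_i v` in `L^p(ℝ × ℝ^d)`. -/
noncomputable def pieceNorm (ψ : E d → ℝ) (p s : ℝ) (i : ℕ) (vhat : ℝ → E d → ℂ) : ℝ≥0∞ :=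
  mixedNorm (ENNReal.ofReal p) (ENNReal.ofReal p) fun t => expDelta ψ s i (vhat t)

/-- The norm of `v` in `L̃^p(ℝ; B^{κ,s}_{p,2})`, restricted to the first `j` frequencies. -/
noncomputable def partNorm (ψ : E d → ℝ) (p κ s : ℝ) (j : ℕ) (vhat : ℝ → E d → ℂ) : ℝ≥0∞ :=
  (∑ i ∈ Finset.range j, (pow2 (κ * i) * pieceNorm ψ p s i vhat) ^ (2 : ℝ)) ^ (1 / 2 : ℝ)

lemma pieceNorm_eq (hψ : Continuous ψ) {p : ℝ} (hp : 0 < p) (s : ℝ) (i : ℕ) {vhat : ℝ → E d → ℂ}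
    (hv : Measurable (Function.uncurry vhat)) : pieceNorm ψ p s i vhat =
      eLpNorm' (fun z : ℝ × E d => expDelta ψ s i (vhat z.1) z.2) p (volume.prod volume) :=
  mixedNorm_eq (measurable_expDelta hψ s i hv) hp

lemma tildeNorm_univ (γ r : ℝ≥0∞) (σ s : ℝ) (vhat : ℝ → E d → ℂ) :
    tildeNorm ψ γ r 2 σ s Set.univ vhat =
      (∑' i : ℕ, (pow2 (σ * i) * mixedNorm γ r fun t => expDelta ψ s i (vhat t)) ^ (2 : ℝ)) ^
        (1 / 2 : ℝ) := by
  rw [tildeNorm, tsum_univ (f := fun i : ℕ => (ENNReal.ofReal ((2 : ℝ) ^ (σ * (i : ℝ))) *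
    mixedNorm γ r fun t => expDelta ψ s i (vhat t)) ^ (2 : ℝ))]
  rfl

/-- The pointwise bound behind the subcritical estimate: interpolation between the `L^p` decay of
high frequencies and the `L^∞` growth of low frequencies. -/
lemma IsGauge.sum_enorm_expDelta_le (hN : IsGauge ψ N) (hψ : Continuous ψ)
    {K : SchwartzMap (E d) ℂ} (hK : ∀ ξ, 𝓕 (K : E d → ℂ) ξ = (ψ ξ : ℂ)) {σc a κ₀ κ : ℝ}
    (ha : 0 < a) (hσ : (d : ℝ) / 2 - σc = a) (h0 : 0 < κ₀) (hκ : κ₀ ≤ κ) (s : ℝ) (j : ℕ)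
    {vhat : ℝ → E d → ℂ} (hl : ∀ᵐ t : ℝ, LocallyIntegrable (vhat t) volume) :
    ∀ᵐ t : ℝ, ∀ x, ∑ i ∈ Finset.range j, ‖expDelta ψ s i (vhat t) x‖ₑ ≤
      ENNReal.ofReal ((1 + (2 : ℝ) ^ κ) * (1 + (1 / (1 - (2 : ℝ) ^ (-2 * κ₀))) ^ (1 / 2 : ℝ))) *
      (ENNReal.ofReal ((1 / a) ^ (1 / 2 : ℝ)) *
        ((ENNReal.ofReal (2 ^ d) * ∫⁻ y, ‖K y‖ₑ ^ (2 : ℝ)) ^ (1 / 2 : ℝ) *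
          tildeNorm ψ ⊤ 2 2 σc s Set.univ vhat)) ^ (κ / (a + κ)) *
      ((∑ i ∈ Finset.range j, (pow2 (κ * i) * ‖expDelta ψ s i (vhat t) x‖ₑ) ^ (2 : ℝ)) ^
        (1 / 2 : ℝ)) ^ (a / (a + κ)) := by
  have hκ' : 0 < κ := h0.trans_le hκ
  set b : ℕ → ℝ≥0∞ := fun i => mixedNorm ⊤ 2 fun t => expDelta ψ s i (vhat t) with hb
  have hbt : ∀ᵐ t : ℝ, ∀ i, eLpNorm (expDelta ψ s i (vhat t)) 2 volume ≤ b i := by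
    refine ae_all_iff.2 fun i => ?_
    have := ae_le_eLpNormEssSup (μ := (volume : Measure ℝ))
      (f := fun t => eLpNorm (expDelta ψ s i (vhat t)) 2 volume)
    filter_upwards [this] with t ht
    simpa [hb, mixedNorm] using ht
  set B := (ENNReal.ofReal (2 ^ d) * ∫⁻ y, ‖K y‖ₑ ^ (2 : ℝ)) ^ (1 / 2 : ℝ) with hB
  filter_upwards [hl, hbt] with t ht hbt x
  -- The growth `2^{di/2}` from Bernstein's inequality splits as `2^{ai} · 2^{σc i}`, and the second
  -- factor is the weight in the critical norm.
  refine (sum_interp_le ha h0 hκ j (fun i => ‖expDelta ψ s i (vhat t) x‖ₑ)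
    (fun i => B * (pow2 (σc * i) * b i)) (fun i _ => ?_)).trans ?_
  · refine (hN.enorm_expDelta_le hψ hK s i ht x).trans ?_
    calc B * pow2 (d / 2 * i) * eLpNorm (expDelta ψ s i (vhat t)) 2 volume
        ≤ B * pow2 (a * i + σc * i) * b i := by
          gcongr
          · exact pow2_mono (le_of_eq (by rw [← hσ]; ring))
          · exact hbt i
      _ = _ := by rw [pow2_add]; ring
  · gcongr
    rw [tildeNorm_univ]
    calc (∑ i ∈ Finset.range j, (B * (pow2 (σc * i) * b i)) ^ (2 : ℝ)) ^ (1 / 2 : ℝ)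
        = B * (∑ i ∈ Finset.range j, (pow2 (σc * i) * b i) ^ (2 : ℝ)) ^ (1 / 2 : ℝ) := by
          simp_rw [ENNReal.mul_rpow_of_nonneg B _ (by norm_num : (0 : ℝ) ≤ 2)]
          rw [← Finset.mul_sum, ENNReal.mul_rpow_of_nonneg _ _ (by norm_num), ← ENNReal.rpow_mul]
          norm_num
      _ ≤ _ := by
          gcongr
          exact ENNReal.sum_le_tsum _

lemma eLpNorm'_const_mul {X : Type*} [MeasurableSpace X] {μ : Measure X} {f : X → ℝ≥0∞}
    (hf : Measurable f) (c : ℝ≥0∞) {p : ℝ} (hp : 0 < p) :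
    eLpNorm' (fun x => c * f x) p μ = c * eLpNorm' f p μ := by
  simp only [eLpNorm', enorm_eq_self, ENNReal.mul_rpow_of_nonneg c _ hp.le]
  rw [lintegral_const_mul _ (hf.pow_const p), ENNReal.mul_rpow_of_nonneg _ _ (by positivity),
    ← ENNReal.rpow_mul, mul_one_div_cancel hp.ne', ENNReal.rpow_one]

/-- The subcritical case `α > n`. -/
lemma IsGauge.mixedNorm_powDiff_le_of_lt (hN : IsGauge ψ N) (hψ : Continuous ψ)
    {K : SchwartzMap (E d) ℂ} (hK : ∀ ξ, 𝓕 (K : E d → ℂ) ξ = (ψ ξ : ℂ)) {n p p' κ₀ κ : ℝ} {α : ℕ}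
    (hn : 0 < n) (hnα : n < α) (hp : p = n + 2) (hp' : p' = p / (n + 1)) (hκ : κ = 2 / n - 2 / α)
    (h0 : 0 < κ₀) (hκ₀ : κ₀ ≤ κ) (s : ℝ) (j : ℕ) {vhat : ℝ → E d → ℂ}
    (hv : Measurable (Function.uncurry vhat))
    (hl : ∀ᵐ t : ℝ, LocallyIntegrable (vhat t) volume) :
    mixedNorm (ENNReal.ofReal p') (ENNReal.ofReal p') (fun t => powDiff ψ s α j (vhat t)) ≤
      ((α + 1) * ENNReal.ofReal ((1 + (2 : ℝ) ^ κ) *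
          (1 + (1 / (1 - (2 : ℝ) ^ (-2 * κ₀))) ^ (1 / 2 : ℝ))) ^ (α : ℝ) *
        (ENNReal.ofReal (Real.sqrt α) * (ENNReal.ofReal (2 ^ d) * ∫⁻ y, ‖K y‖ₑ ^ (2 : ℝ)) ^
          (1 / 2 : ℝ)) ^ (α - n) * tildeNorm ψ ⊤ 2 2 (d / 2 - 2 / α) s Set.univ vhat ^ (α - n)) *
      (pieceNorm ψ p s j vhat * partNorm ψ p κ s (j + 1) vhat ^ n) := by
  have hα : (0 : ℝ) < α := hn.trans hnα
  have hp0 : 0 < p := by linarith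
  have hp'0 : 0 < p' := by rw [hp']; positivity
  -- With growth rate `2/α` this sum makes the interpolation weights `1 - n/α` and `n/α`. Their
  -- `α`-th powers give exactly `α - n` critical factors and `n` square functions.
  have haκ : 2 / (α : ℝ) + κ = 2 / n := by rw [hκ]; ring
  have hκ' : 0 < κ := h0.trans_le hκ₀
  set B := (ENNReal.ofReal (2 ^ d) * ∫⁻ y, ‖K y‖ₑ ^ (2 : ℝ)) ^ (1 / 2 : ℝ) with hB
  set C₁ := ENNReal.ofReal ((1 + (2 : ℝ) ^ κ) *
          (1 + (1 / (1 - (2 : ℝ) ^ (-2 * κ₀))) ^ (1 / 2 : ℝ))) with hC₁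
  set Z := tildeNorm ψ ⊤ 2 2 (d / 2 - 2 / α) s Set.univ vhat with hZ
  have hw := fun i => measurable_expDelta hψ s i hv
  set f : ℕ → ℝ × E d → ℝ≥0∞ := fun i z => pow2 (κ * i) * ‖expDelta ψ s i (vhat z.1) z.2‖ₑ with hf
  have hfm : ∀ i, Measurable (f i) := fun i => measurable_const.mul (hw i).enorm
  set G : ℝ × E d → ℝ≥0∞ := fun z =>
    (∑ i ∈ Finset.range (j + 1), f i z ^ (2 : ℝ)) ^ (1 / 2 : ℝ) with hG
  have hGm : Measurable G :=
    (Finset.measurable_sum _ fun i _ => (hfm i).pow_const _).pow_const _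
  have hpt := hN.sum_enorm_expDelta_le hψ hK (σc := d / 2 - 2 / α) (a := 2 / α) (by positivity)
    (by ring) h0 hκ₀ s (j + 1) hl
  rw [haκ, hκ, ← hκ] at hpt
  have hθ : (2 / (α : ℝ)) / (2 / n) = n / α := by field_simp
  have hθ' : κ / (2 / n) = 1 - n / α := by rw [hκ]; field_simp
  rw [hθ, hθ'] at hpt
  rw [mixedNorm_eq (measurable_powDiff hψ s α j hv) hp'0]
  have hT : ∀ᵐ z : ℝ × E d ∂(volume.prod volume), ‖powDiff ψ s α j (vhat z.1) z.2‖ₑ ≤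
      ((α + 1) * C₁ ^ (α : ℝ) * (ENNReal.ofReal (Real.sqrt α) * B) ^ (α - n) * Z ^ (α - n)) *
        (‖expDelta ψ s j (vhat z.1) z.2‖ₑ * G z ^ n) := by
    filter_upwards [ae_prod_of_ae hpt] with z hz
    have hz := hz z.2
    refine (enorm_powDiff_le s α j _ _ (enorm_partSum_le s (Nat.le_succ j) _ _)
      (enorm_partSum_le s le_rfl _ _)).trans ?_
    have hsq : ENNReal.ofReal ((1 / (2 / (α : ℝ))) ^ (1 / 2 : ℝ)) ≤ ENNReal.ofReal (Real.sqrt α) := by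
      refine ENNReal.ofReal_le_ofReal ?_
      rw [← Real.sqrt_eq_rpow]
      refine Real.sqrt_le_sqrt ?_
      rw [one_div_div]; linarith
    have hW : (∑ i ∈ Finset.range (j + 1), ‖expDelta ψ s i (vhat z.1) z.2‖ₑ) ^ α ≤
        C₁ ^ (α : ℝ) * ((ENNReal.ofReal (Real.sqrt α) * B) ^ (α - n) * Z ^ (α - n)) * G z ^ n := by
      have h1 : 0 ≤ 1 - n / α := by rw [sub_nonneg, div_le_one hα]; exact hnα.le
      rw [← ENNReal.rpow_natCast]
      calc _ ≤ (C₁ * (ENNReal.ofReal (Real.sqrt α) * (B * Z)) ^ (1 - n / α) * G z ^ (n / α)) ^ (α : ℝ) := by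
            refine ENNReal.rpow_le_rpow (hz.trans ?_) hα.le
            gcongr
        _ = _ := by
            rw [← mul_assoc (ENNReal.ofReal (Real.sqrt α)),
              ENNReal.mul_rpow_of_nonneg _ _ hα.le, ENNReal.mul_rpow_of_nonneg _ _ hα.le,
              ← ENNReal.rpow_mul, ← ENNReal.rpow_mul, div_mul_cancel₀ _ hα.ne',
              show (1 - n / α) * α = (α : ℝ) - n by field_simp,
              ENNReal.mul_rpow_of_nonneg _ _ (by linarith : (0 : ℝ) ≤ α - n)]
    calc _ ≤ ((α : ℝ≥0∞) + 1) * (‖expDelta ψ s j (vhat z.1) z.2‖ₑ *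
          (C₁ ^ (α : ℝ) * ((ENNReal.ofReal (Real.sqrt α) * B) ^ (α - n) * Z ^ (α - n)) * G z ^ n)) := by
          gcongr
      _ = _ := by ring
  refine (eLpNorm'_le_of_le_mul_rpow (hw j) hGm hp0 hp'0 hn.le
    (by rw [hp']; field_simp; ring) hT).trans ?_
  rw [← pieceNorm_eq hψ hp0 s j hv]
  gcongr
  refine (eLpNorm'_square_function_le _ (fun i _ => hfm i) (by linarith)).trans_eq ?_
  rw [partNorm]
  congr 1
  refine Finset.sum_congr rfl fun i _ => ?_
  congr 1
  have hwe : Measurable fun z : ℝ × E d => ‖expDelta ψ s i (vhat z.1) z.2‖ₑ := (hw i).enorm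
  rw [hf, pieceNorm_eq hψ hp0 s i hv, eLpNorm'_const_mul hwe _ hp0]
  congr 1

/-- The critical case `α = n`, in which `p = α + 2`. -/
lemma mixedNorm_powDiff_le_of_eq (hψ : Continuous ψ) {α : ℕ} {p p' : ℝ}
    {C : ℝ≥0∞} (hp : p = ((α + 2 : ℕ) : ℝ)) (hp' : p' = p / (α + 1)) {s : ℝ}
    (hC : ∀ (J : ℕ) (g : E d → ℂ), LocallyIntegrable g →
      eLpNorm' (partSum ψ s J g) ((α + 2 : ℕ) : ℝ) volume ≤
        C * (∑ i ∈ Finset.range J,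
          eLpNorm' (expDelta ψ s i g) ((α + 2 : ℕ) : ℝ) volume ^ (2 : ℝ)) ^ (1 / 2 : ℝ))
    (j : ℕ) {vhat : ℝ → E d → ℂ} (hv : Measurable (Function.uncurry vhat))
    (hl : ∀ᵐ t : ℝ, LocallyIntegrable (vhat t) volume) :
    mixedNorm (ENNReal.ofReal p') (ENNReal.ofReal p') (fun t => powDiff ψ s α j (vhat t)) ≤
      ((α + 1) * (2 * C) ^ (α : ℝ)) *
      (pieceNorm ψ p s j vhat * partNorm ψ p 0 s (j + 1) vhat ^ (α : ℝ)) := by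
  have hp2 : 2 ≤ p := by rw [hp]; push_cast; linarith [(Nat.cast_nonneg α : (0 : ℝ) ≤ α)]
  have hp0 : 0 < p := by linarith
  have hp'0 : 0 < p' := by rw [hp']; positivity
  have hw := fun i => measurable_expDelta hψ s i hv
  have hS := fun i => measurable_partSum hψ s i hv
  -- The moduli of the two partial sums, not the sum of the moduli of the pieces: the embedding
  -- relies on cancellation between pieces.
  set U : ℝ × E d → ℝ≥0∞ := fun z =>
    ‖partSum ψ s j (vhat z.1) z.2‖ₑ + ‖partSum ψ s (j + 1) (vhat z.1) z.2‖ₑ with hU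
  have hUm : Measurable U := (hS j).enorm.add (hS (j + 1)).enorm
  have hpart : ∀ l ≤ j + 1, eLpNorm' (fun z : ℝ × E d => ‖partSum ψ s l (vhat z.1) z.2‖ₑ) p
      (volume.prod volume) ≤ C * partNorm ψ p 0 s (j + 1) vhat := by
    intro l hlj
    have hm : ∀ i, Measurable fun t => eLpNorm' (expDelta ψ s i (vhat t)) p volume :=
      fun i => measurable_eLpNorm' (hw i) p
    rw [← eLpNorm'_eLpNorm' (F := fun t x => ‖partSum ψ s l (vhat t) x‖ₑ) (hS l).enorm hp0]
    simp_rw [eLpNorm'_enorm]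
    calc _ ≤ eLpNorm' (fun t => C * (∑ i ∈ Finset.range (j + 1),
            eLpNorm' (expDelta ψ s i (vhat t)) p volume ^ (2 : ℝ)) ^ (1 / 2 : ℝ)) p volume := by
          refine ENNReal.rpow_le_rpow (lintegral_mono_ae ?_) (by positivity)
          filter_upwards [hl] with t ht
          simp only [enorm_eq_self]
          gcongr
          have := hC l (vhat t) ht
          rw [← hp] at this
          refine this.trans ?_
          gcongr
      _ = C * eLpNorm' (fun t => (∑ i ∈ Finset.range (j + 1),
            eLpNorm' (expDelta ψ s i (vhat t)) p volume ^ (2 : ℝ)) ^ (1 / 2 : ℝ)) p volume :=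
          eLpNorm'_const_mul
            ((Finset.measurable_sum _ fun i _ => (hm i).pow_const _).pow_const _) _ hp0
      _ ≤ _ := by
          gcongr
          refine (eLpNorm'_square_function_le _ (fun i _ => hm i) hp2).trans_eq ?_
          rw [partNorm]
          congr 1
          refine Finset.sum_congr rfl fun i _ => ?_
          congr 1
          rw [zero_mul, pow2_zero, one_mul, pieceNorm, mixedNorm, eLpNorm_ofReal_eq _ hp0]
          simp_rw [eLpNorm_ofReal_eq _ hp0]
  have hUn : eLpNorm' U p (volume.prod volume) ≤ 2 * C * partNorm ψ p 0 s (j + 1) vhat := by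
    refine (eLpNorm'_add_le (hS j).enorm.aestronglyMeasurable (hS (j + 1)).enorm.aestronglyMeasurable
      (by linarith)).trans ?_
    refine (add_le_add (hpart j (by omega)) (hpart (j + 1) le_rfl)).trans_eq ?_
    ring
  rw [mixedNorm_eq (measurable_powDiff hψ s α j hv) hp'0]
  refine (eLpNorm'_le_of_le_mul_rpow (c := (α + 1)) (n := α) (hw j) hUm hp0 hp'0 (by positivity)
    (by rw [hp']; field_simp; ring) (Filter.Eventually.of_forall fun z => ?_)).trans ?_
  · rw [ENNReal.rpow_natCast]
    exact enorm_powDiff_le s α j _ _ le_self_add le_add_self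
  · rw [← pieceNorm_eq hψ hp0 s j hv]
    calc _ ≤ ((α : ℝ≥0∞) + 1) * (pieceNorm ψ p s j vhat *
          (2 * C * partNorm ψ p 0 s (j + 1) vhat) ^ (α : ℝ)) := by gcongr
      _ = _ := by rw [ENNReal.mul_rpow_of_nonneg _ _ (by positivity)]; ring

lemma ofReal_mul_sqrt_rpow_le {x C : ℝ} {α : ℕ} (hα : 1 ≤ α) (hx : 1 ≤ x) (hC : x ≤ C) :
    ENNReal.ofReal ((x * Real.sqrt α) ^ (α : ℝ)) ≤
      ENNReal.ofReal ((C * Real.sqrt α) ^ ((α : ℝ) + C)) := by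
  have h1 : 1 ≤ Real.sqrt α := Real.one_le_sqrt.2 (by exact_mod_cast hα)
  refine ENNReal.ofReal_le_ofReal ?_
  calc (x * Real.sqrt α) ^ (α : ℝ) ≤ (C * Real.sqrt α) ^ (α : ℝ) := by gcongr
    _ ≤ _ := by
      refine Real.rpow_le_rpow_of_exponent_le ?_ (by linarith)
      nlinarith

lemma natCast_add_one_le_two_pow (α : ℕ) : (α : ℝ≥0∞) + 1 ≤ 2 ^ (α : ℝ) := by
  rw [ENNReal.rpow_natCast]
  exact_mod_cast Nat.lt_two_pow_self

/-- The multilinear estimate for the increments of `(∑_{i<j} 2^{s|∇|} Δ_i v)^{1+α}`. -/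
lemma IsGauge.exists_mixedNorm_powDiff_le (hN : IsGauge ψ N) (hψ : Continuous ψ)
    {K : SchwartzMap (E d) ℂ} (hK : ∀ ξ, 𝓕 (K : E d → ℂ) ξ = (ψ ξ : ℂ)) {n p p' : ℝ} (hn : 0 < n)
    (hp : p = n + 2) (hp' : p' = p / (n + 1)) :
    ∃ C : ℝ, 1 ≤ C ∧ ∀ α : ℕ, n ≤ α → ∀ (s : ℝ) (j : ℕ) (vhat : ℝ → E d → ℂ),
      Measurable (Function.uncurry vhat) → (∀ᵐ t : ℝ, LocallyIntegrable (vhat t) volume) →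
      mixedNorm (ENNReal.ofReal p') (ENNReal.ofReal p') (fun t => powDiff ψ s α j (vhat t)) ≤
        ENNReal.ofReal ((C * Real.sqrt α) ^ ((α : ℝ) + C)) *
        tildeNorm ψ ⊤ 2 2 (d / 2 - 2 / α) s Set.univ vhat ^ (α - n) *
        (pieceNorm ψ p s j vhat * partNorm ψ p (2 / n - 2 / α) s (j + 1) vhat ^ n) := by
  -- The critical case occurs only for an integer `n = ⌊n⌋₊`, so a single embedding constant
  -- suffices.
  obtain ⟨Cb, hCb, hCb1, hbcd⟩ := hN.exists_eLpNorm'_partSum_le hψ hK ⌊n⌋₊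
  -- The least integer above `n`. Every subcritical `α` is at least `α₁`, whence `κ ≥ κ₀ > 0`
  -- uniformly.
  set α₁ : ℕ := ⌊n⌋₊ + 1 with hα₁
  have hnα₁ : n < α₁ := by rw [hα₁]; push_cast; exact Nat.lt_floor_add_one n
  set κ₀ : ℝ := 2 / n - 2 / α₁ with hκ₀
  have hα₁0 : (0 : ℝ) < α₁ := hn.trans hnα₁
  have h0 : 0 < κ₀ := by rw [hκ₀, sub_pos]; gcongr
  set c₁ : ℝ := (1 + (2 : ℝ) ^ (2 / n)) * (1 + (1 / (1 - (2 : ℝ) ^ (-2 * κ₀))) ^ (1 / 2 : ℝ)) with hc₁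
  have hr1 : (2 : ℝ) ^ (-2 * κ₀) < 1 := Real.rpow_lt_one_of_one_lt_of_neg (by norm_num) (by linarith)
  have hr0 : 0 ≤ 1 / (1 - (2 : ℝ) ^ (-2 * κ₀)) := by
    apply div_nonneg <;> linarith
  have hc₁1 : 1 ≤ c₁ := by
    have h1 : 0 ≤ (2 : ℝ) ^ (2 / n) := by positivity
    have h2 := Real.rpow_nonneg hr0 (1 / 2)
    rw [hc₁]; nlinarith
  set B := (ENNReal.ofReal (2 ^ d) * ∫⁻ y, ‖K y‖ₑ ^ (2 : ℝ)) ^ (1 / 2 : ℝ) with hB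
  have hBt : B ≠ ⊤ := by
    refine ENNReal.rpow_ne_top_of_nonneg (by norm_num) (ENNReal.mul_ne_top ENNReal.ofReal_ne_top ?_)
    have h2 := (K.memLp 2 volume).eLpNorm_lt_top
    rw [eLpNorm_lt_top_iff_lintegral_rpow_enorm_lt_top (by norm_num) (by norm_num)] at h2
    simpa using h2.ne
  set b₁ : ℝ := 1 + B.toReal with hb₁
  have hBb : B ≤ ENNReal.ofReal b₁ := by
    rw [← ENNReal.ofReal_toReal hBt]
    exact ENNReal.ofReal_le_ofReal (by rw [hb₁]; linarith)
  have hb₁1 : 1 ≤ b₁ := by rw [hb₁]; linarith [ENNReal.toReal_nonneg (a := B)]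
  have hCbr : 1 ≤ Cb.toReal := by
    rw [← ENNReal.toReal_one]; exact ENNReal.toReal_mono hCb hCb1
  have hc₁b : 1 ≤ c₁ * b₁ := by nlinarith
  -- One summand for each case. The factor `α + 1 ≤ 2^α` contributes a `2` to each base, and the
  -- critical base already contains `2 * Cb`.
  refine ⟨2 * c₁ * b₁ + 4 * Cb.toReal, by nlinarith, fun α hα s j vhat hv hl => ?_⟩
  have hα0 : (0 : ℝ) < α := hn.trans_le hα
  have hα1 : 1 ≤ α := by exact_mod_cast hα0
  have hsq1 : 1 ≤ Real.sqrt α := Real.one_le_sqrt.2 (by exact_mod_cast hα1)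
  rcases hα.eq_or_lt with hnα | hnα
  · have hfl : ⌊n⌋₊ = α := by rw [hnα]; exact Nat.floor_natCast α
    rw [hfl] at hbcd
    have h := mixedNorm_powDiff_le_of_eq hψ (α := α) (p := p) (p' := p') (by
      rw [hp, hnα]; push_cast; rfl) (by rw [hp', hnα]) (hbcd s) j hv hl
    rw [hnα, sub_self, sub_self, ENNReal.rpow_zero, mul_one]
    refine h.trans ?_
    gcongr
    refine le_trans ?_ (ofReal_mul_sqrt_rpow_le hα1 (x := 4 * Cb.toReal) (by linarith) (by nlinarith))
    calc ((α : ℝ≥0∞) + 1) * (2 * Cb) ^ (α : ℝ) ≤ 2 ^ (α : ℝ) * (2 * Cb) ^ (α : ℝ) := by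
          gcongr; exact natCast_add_one_le_two_pow α
      _ = (ENNReal.ofReal (4 * Cb.toReal)) ^ (α : ℝ) := by
          rw [← ENNReal.mul_rpow_of_nonneg _ _ hα0.le, ENNReal.ofReal_mul (by norm_num),
            ENNReal.ofReal_toReal hCb, ← mul_assoc]
          norm_num
      _ ≤ _ := by
          rw [ENNReal.ofReal_rpow_of_nonneg (by positivity) hα0.le]
          exact ENNReal.ofReal_le_ofReal (Real.rpow_le_rpow (by positivity)
            (le_mul_of_one_le_right (by positivity) hsq1) hα0.le)
  · have hα₁α : α₁ ≤ α := by
      rw [hα₁]; exact Nat.succ_le_of_lt ((Nat.floor_lt hn.le).2 hnα)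
    have hκ₀κ : κ₀ ≤ 2 / n - 2 / α := by
      rw [hκ₀]; gcongr
    have h := hN.mixedNorm_powDiff_le_of_lt hψ hK hn hnα hp hp' rfl h0 hκ₀κ s j hv hl
    refine h.trans ?_
    gcongr
    refine le_trans ?_ (ofReal_mul_sqrt_rpow_le hα1 (x := 2 * c₁ * b₁) (by nlinarith) (by linarith))
    have hx1 : (1 : ℝ≥0∞) ≤ ENNReal.ofReal (Real.sqrt α) * ENNReal.ofReal b₁ := by
      rw [← ENNReal.ofReal_mul (by positivity), ENNReal.one_le_ofReal]; nlinarith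
    have hcc : ENNReal.ofReal ((1 + (2 : ℝ) ^ (2 / n - 2 / (α : ℝ))) *
          (1 + (1 / (1 - (2 : ℝ) ^ (-2 * κ₀))) ^ (1 / 2 : ℝ))) ≤ ENNReal.ofReal c₁ := by
      refine ENNReal.ofReal_le_ofReal ?_
      rw [hc₁]
      have h2 := Real.rpow_nonneg hr0 (1 / 2)
      gcongr
      · norm_num
      · have : 0 < 2 / (α : ℝ) := by positivity
        linarith
    calc _ ≤ 2 ^ (α : ℝ) * ENNReal.ofReal c₁ ^ (α : ℝ) *
          (ENNReal.ofReal (Real.sqrt α) * ENNReal.ofReal b₁) ^ (α : ℝ) := by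
          gcongr
          · exact natCast_add_one_le_two_pow α
          · calc (ENNReal.ofReal (Real.sqrt α) * B) ^ ((α : ℝ) - n)
                ≤ (ENNReal.ofReal (Real.sqrt α) * ENNReal.ofReal b₁) ^ ((α : ℝ) - n) :=
                  ENNReal.rpow_le_rpow (by gcongr) (by linarith)
              _ ≤ _ := ENNReal.rpow_le_rpow_of_exponent_le hx1 (by linarith)
      _ = _ := by
          rw [← ENNReal.mul_rpow_of_nonneg _ _ hα0.le, ← ENNReal.mul_rpow_of_nonneg _ _ hα0.le,
            ← ENNReal.ofReal_rpow_of_nonneg (by positivity) hα0.le]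
          congr 1
          rw [show (2 : ℝ≥0∞) = ENNReal.ofReal 2 by norm_num, ← ENNReal.ofReal_mul (by positivity),
            ← ENNReal.ofReal_mul (by positivity), ← ENNReal.ofReal_mul (by positivity)]
          congr 1; ring

/-! ### Summation over the dyadic pieces -/

lemma tildeNorm_eq (γ r : ℝ≥0∞) (σ s : ℝ) (A : Set ℕ) (vhat : ℝ → E d → ℂ) :
    tildeNorm ψ γ r 2 σ s A vhat = (∑' i : A, (pow2 (σ * (i : ℕ)) *
      mixedNorm γ r fun t => expDelta ψ s i (vhat t)) ^ (2 : ℝ)) ^ (1 / 2 : ℝ) := rfl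

/-- The dyadic pieces of a power, in `L^{p'}(ℝ × ℝ^d)`. -/
lemma IsGauge.mixedNorm_expDelta_convPow_le (hN : IsGauge ψ N) (hψ : Continuous ψ)
    {K : SchwartzMap (E d) ℂ} (hK : ∀ ξ, 𝓕 (K : E d → ℂ) ξ = (ψ ξ : ℂ)) (s : ℝ) (k n : ℕ)
    {vhat : ℝ → E d → ℂ} (hv : Measurable (Function.uncurry vhat))
    (hl : ∀ᵐ t : ℝ, LocallyIntegrable (vhat t) volume)
    (ho : ∀ᵐ t : ℝ, ∀ᵐ ξ : E d, ξ ∉ octant d → vhat t ξ = 0) {p : ℝ} (hp : 1 < p) :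
    mixedNorm (ENNReal.ofReal p) (ENNReal.ofReal p) (fun t => expDelta ψ s k (convPow (vhat t) n)) ≤
      ∑ j ∈ (Finset.range (k + 2)).filter (fun j => k ≤ j + (n + 2)), 2 * (∫⁻ y, ‖K y‖ₑ) *
        mixedNorm (ENNReal.ofReal p) (ENNReal.ofReal p) (fun t => powDiff ψ s n j (vhat t)) := by
  have hp0 : 0 < p := by linarith
  set F := (Finset.range (k + 2)).filter (fun j => k ≤ j + (n + 2)) with hF
  have hm : ∀ j, Measurable fun t => eLpNorm (powDiff ψ s n j (vhat t)) (ENNReal.ofReal p) volume := by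
    intro j
    simp_rw [eLpNorm_ofReal_eq _ hp0]
    exact measurable_eLpNorm' (measurable_powDiff hψ s n j hv) p
  simp_rw [mixedNorm]
  calc eLpNorm (fun t => eLpNorm (expDelta ψ s k (convPow (vhat t) n)) (ENNReal.ofReal p) volume)
        (ENNReal.ofReal p) volume
      ≤ eLpNorm (∑ j ∈ F, fun t => 2 * (∫⁻ y, ‖K y‖ₑ) *
          eLpNorm (powDiff ψ s n j (vhat t)) (ENNReal.ofReal p) volume) (ENNReal.ofReal p) volume := by
        refine eLpNorm_mono_enorm_ae ?_
        filter_upwards [hl, ho] with t h1 h2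
        rw [enorm_eq_self, enorm_eq_self, Finset.sum_apply]
        exact hN.eLpNorm_expDelta_convPow_le hψ hK s k n h1 h2 hp
    _ ≤ _ := by
        refine (eLpNorm_sum_le (fun j _ => (measurable_const.mul (hm j)).aestronglyMeasurable)
          (by rw [ENNReal.one_le_ofReal]; exact hp.le)).trans_eq ?_
        refine Finset.sum_congr rfl fun j _ => ?_
        rw [eLpNorm_ofReal_eq _ hp0, eLpNorm_ofReal_eq _ hp0]
        exact eLpNorm'_const_mul (hm j) _ hp0

lemma partNorm_le_of_subset {p κ κ' s : ℝ} (hκ : κ ≤ κ') {j : ℕ} {A : Set ℕ}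
    (hA : ∀ i < j, i ∈ A) (vhat : ℝ → E d → ℂ) : partNorm ψ p κ s j vhat ≤
      tildeNorm ψ (ENNReal.ofReal p) (ENNReal.ofReal p) 2 κ' s A vhat := by
  rw [partNorm, tildeNorm_eq]
  gcongr
  calc ∑ i ∈ Finset.range j, (pow2 (κ * i) * pieceNorm ψ p s i vhat) ^ (2 : ℝ)
      ≤ ∑ i ∈ Finset.range j, A.indicator
          (fun i : ℕ => (pow2 (κ' * i) * pieceNorm ψ p s i vhat) ^ (2 : ℝ)) i := by
        refine Finset.sum_le_sum fun i hi => ?_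
        rw [Set.indicator_of_mem (hA i (Finset.mem_range.1 hi))]
        gcongr
        exact pow2_mono (by gcongr)
    _ ≤ ∑' i, A.indicator
          (fun i : ℕ => (pow2 (κ' * i) * pieceNorm ψ p s i vhat) ^ (2 : ℝ)) i := ENNReal.sum_le_tsum _
    _ = _ := (tsum_subtype A _).symm

/-- On `A` the regularity may be raised from `κ` to `κ'` because the indices are nonnegative. -/
lemma partNorm_le_two_mul_max {p κ κ' s : ℝ} (hκ : κ ≤ κ') (j : ℕ) (A : Set ℕ)
    (vhat : ℝ → E d → ℂ) : partNorm ψ p κ s j vhat ≤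
      2 * max (tildeNorm ψ (ENNReal.ofReal p) (ENNReal.ofReal p) 2 κ s Aᶜ vhat)
        (tildeNorm ψ (ENNReal.ofReal p) (ENNReal.ofReal p) 2 κ' s A vhat) := by
  have h1 := partNorm_le_of_subset (ψ := ψ) (p := p) (s := s) (le_refl κ) (j := j)
    (A := Set.univ) (fun i _ => Set.mem_univ i) vhat
  have h2 : tildeNorm ψ (ENNReal.ofReal p) (ENNReal.ofReal p) 2 κ s A vhat ≤
      tildeNorm ψ (ENNReal.ofReal p) (ENNReal.ofReal p) 2 κ' s A vhat := by
    rw [tildeNorm_eq, tildeNorm_eq]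
    gcongr
    exact pow2_mono (by gcongr)
  refine h1.trans ?_
  calc tildeNorm ψ (ENNReal.ofReal p) (ENNReal.ofReal p) 2 κ s Set.univ vhat
      ≤ tildeNorm ψ (ENNReal.ofReal p) (ENNReal.ofReal p) 2 κ s Aᶜ vhat +
          tildeNorm ψ (ENNReal.ofReal p) (ENNReal.ofReal p) 2 κ s A vhat := by
        rw [tildeNorm_univ, tildeNorm_eq, tildeNorm_eq]
        refine le_trans (ENNReal.rpow_le_rpow (le_of_eq ?_) (by norm_num))
          (ENNReal.rpow_add_le_add_rpow _ _ (by norm_num) (by norm_num))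
        rw [add_comm]
        exact (ENNReal.summable.tsum_add_tsum_compl ENNReal.summable).symm
    _ ≤ _ := by
        rw [two_mul]
        exact add_le_add (le_max_left _ _) (h2.trans (le_max_right _ _))

/-- Summation of the dyadic pieces with Schur's test. Here `e j` splits into a high frequency
contribution, of size `H x j`, and a low frequency one, of size `L y j`. -/
lemma tsum_band_split_le (A : Set ℕ) (M : ℕ) (R H L : ℝ≥0∞) (a x y : ℕ → ℝ≥0∞)
    (h : ∀ k ∈ Aᶜ, a k ≤ ∑ j ∈ (Finset.range (k + 2)).filter (fun j => k ≤ j + M),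
      R * (Aᶜ.indicator (fun j => H * x j) j + A.indicator (fun j => L * y j) j)) :
    (∑' k : (Aᶜ : Set ℕ), a k ^ (2 : ℝ)) ^ (1 / 2 : ℝ) ≤ ((M : ℝ≥0∞) + 2) * R *
      (H * (∑' j : (Aᶜ : Set ℕ), x j ^ (2 : ℝ)) ^ (1 / 2 : ℝ) +
        L * (∑' j : A, y j ^ (2 : ℝ)) ^ (1 / 2 : ℝ)) := by
  have hc : ∀ (c : ℝ≥0∞) (S : Set ℕ) (f : ℕ → ℝ≥0∞), (∑' j : S, (c * f j) ^ (2 : ℝ)) ^ (1 / 2 : ℝ) =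
      c * (∑' j : S, f j ^ (2 : ℝ)) ^ (1 / 2 : ℝ) := by
    intro c S f
    simp_rw [ENNReal.mul_rpow_of_nonneg c _ (zero_le_two : (0 : ℝ) ≤ 2)]
    rw [ENNReal.tsum_mul_left, ENNReal.mul_rpow_of_nonneg _ _ (by norm_num), ← ENNReal.rpow_mul]
    norm_num
  set e : ℕ → ℝ≥0∞ := fun j =>
    R * (Aᶜ.indicator (fun j => H * x j) j + A.indicator (fun j => L * y j) j) with he
  have h1 : ∑' j, e j ^ (2 : ℝ) =
      ∑' j : A, (R * L * y j) ^ (2 : ℝ) + ∑' j : (Aᶜ : Set ℕ), (R * H * x j) ^ (2 : ℝ) := by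
    rw [← ENNReal.summable.tsum_add_tsum_compl (s := A) ENNReal.summable]
    congr 1
    · refine tsum_congr fun j => ?_
      rw [he]
      simp only
      rw [Set.indicator_of_notMem (by simp), Set.indicator_of_mem j.2, zero_add, mul_assoc]
    · refine tsum_congr fun j => ?_
      rw [he]
      simp only
      rw [Set.indicator_of_mem j.2, Set.indicator_of_notMem j.2, add_zero, mul_assoc]
  calc (∑' k : (Aᶜ : Set ℕ), a k ^ (2 : ℝ)) ^ (1 / 2 : ℝ)
      ≤ (((M : ℝ≥0∞) + 2) ^ (2 : ℝ) * ∑' j, e j ^ (2 : ℝ)) ^ (1 / 2 : ℝ) :=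
        ENNReal.rpow_le_rpow (tsum_band_le Aᶜ M a e h) (by norm_num)
    _ = ((M : ℝ≥0∞) + 2) * (∑' j, e j ^ (2 : ℝ)) ^ (1 / 2 : ℝ) := by
        rw [ENNReal.mul_rpow_of_nonneg _ _ (by norm_num), ← ENNReal.rpow_mul]
        norm_num
    _ ≤ ((M : ℝ≥0∞) + 2) * ((∑' j : A, (R * L * y j) ^ (2 : ℝ)) ^ (1 / 2 : ℝ) +
          (∑' j : (Aᶜ : Set ℕ), (R * H * x j) ^ (2 : ℝ)) ^ (1 / 2 : ℝ)) := by
        rw [h1]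
        gcongr
        exact ENNReal.rpow_add_le_add_rpow _ _ (by norm_num) (by norm_num)
    _ = _ := by rw [hc, hc]; ring

/-- Here `r` will be `√α`. Factors exponential in `α` go into the base and fixed ones into the extra
exponent, so the final constant keeps the form `(C√α)^{α+C}`. -/
lemma absorb_const {a b C r : ℝ} {α : ℕ} (ha : 1 ≤ a) (hb : 1 ≤ b) (hC : 1 ≤ C) (hr : 1 ≤ r) :
    a * b ^ (α : ℝ) * (C * r) ^ ((α : ℝ) + C) ≤ (a * b * C * r) ^ ((α : ℝ) + a * b * C) := by
  have hab : 1 ≤ a * b := by nlinarith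
  have hCr : 1 ≤ C * r := by nlinarith
  have hCab : C ≤ a * b * C := by nlinarith
  have h1 : a * b ^ (α : ℝ) ≤ (a * b) ^ ((α : ℝ) + a * b * C) := by
    calc a * b ^ (α : ℝ) ≤ (a * b) ^ (1 : ℝ) * (a * b) ^ (α : ℝ) := by
          rw [Real.rpow_one]
          gcongr
          · exact le_mul_of_one_le_right (by linarith) hb
          · exact le_mul_of_one_le_left (by linarith) ha
      _ = (a * b) ^ (1 + (α : ℝ)) := (Real.rpow_add (by linarith) _ _).symm
      _ ≤ _ := Real.rpow_le_rpow_of_exponent_le hab (by nlinarith)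
  calc a * b ^ (α : ℝ) * (C * r) ^ ((α : ℝ) + C)
      ≤ (a * b) ^ ((α : ℝ) + a * b * C) * (C * r) ^ ((α : ℝ) + a * b * C) := by
        gcongr
    _ = _ := by rw [← Real.mul_rpow (by linarith) (by linarith)]; congr 1; ring

end NLKG

/-! ### The nonlinear estimate -/

theorem lemma4p2 (d : ℕ) (hd : 2 ≤ d) (ψ : NLKG.E d → ℝ) (hψ : NLKG.IsCutoff ψ)
    (σ : ℝ) (hσ : 1 / 2 < σ) :
    ∃ C : ℝ, 1 ≤ C ∧
      ∀ (α : ℕ), 4 / ((d : ℝ) - 1) ≤ (α : ℝ) → NLKG.sigmaC d α ≤ σ →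
      ∀ (s : ℝ), s < 0 → ∀ (lam : ℝ), 1 < lam →
      ∀ (vhat : ℝ → NLKG.E d → ℂ), Measurable (Function.uncurry vhat) →
        (∀ᵐ t : ℝ, LocallyIntegrable (vhat t) volume) →
        (∀ᵐ t : ℝ, ∀ᵐ ξ : NLKG.E d, ξ ∉ NLKG.octant d → vhat t ξ = 0) →
        let p : ℝ := NLKG.pExp d
        let P : ℝ≥0∞ := ENNReal.ofReal p
        let P' : ℝ≥0∞ := ENNReal.ofReal (Real.conjExponent p)
        let low : Set ℕ := NLKG.lowFreq lam
        let σc : ℝ := NLKG.sigmaC d α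
        let δ : ℝ := NLKG.deltaExp p
        NLKG.tildeNorm ψ P' P' 2 (σ - 1 / 2) s lowᶜ (fun t => NLKG.convPow (vhat t) α) ≤
          ENNReal.ofReal ((C * Real.sqrt α) ^ ((α : ℝ) + C)) *
          (NLKG.tildeNorm ψ P P 2 (σ - 1 / 2) s lowᶜ vhat *
              (max (NLKG.tildeNorm ψ P P 2 (σc - 1 / 2) s lowᶜ vhat)
                (NLKG.tildeNorm ψ P P 2 (σc - δ) s low vhat)) ^ (4 / ((d : ℝ) - 1)) +
            ENNReal.ofReal (lam ^ (-1 / p)) *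
              NLKG.tildeNorm ψ P P 2 (σ - δ) s low vhat *
              (NLKG.tildeNorm ψ P P 2 (σc - δ) s low vhat) ^ (4 / ((d : ℝ) - 1))) *
          (NLKG.tildeNorm ψ ∞ 2 2 σc s Set.univ vhat) ^ ((α : ℝ) - 4 / ((d : ℝ) - 1)) := by
  obtain ⟨N, hN⟩ := hψ.exists_gauge
  obtain ⟨K, hK⟩ := hψ.exists_kernel
  have hψc : Continuous ψ := hψ.1.continuous
  have hd1 : (0 : ℝ) < (d : ℝ) - 1 := by
    have : (2 : ℝ) ≤ d := by exact_mod_cast hd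
    linarith
  set n : ℝ := 4 / ((d : ℝ) - 1) with hn
  have hn0 : 0 < n := by positivity
  have hp : NLKG.pExp d = n + 2 := by rw [NLKG.pExp, hn]; field_simp; ring
  have hp1 : 1 < NLKG.pExp d := by linarith
  have hp0 : 0 < NLKG.pExp d := by linarith
  have hp' : Real.conjExponent (NLKG.pExp d) = NLKG.pExp d / (n + 1) := by
    rw [Real.conjExponent, hp]; congr 1; ring
  have hp'1 : 1 < Real.conjExponent (NLKG.pExp d) := by
    rw [hp', hp, one_lt_div (by positivity)]; linarith
  have h2n : 2 / n = ((d : ℝ) - 1) / 2 := by rw [hn]; field_simp; norm_num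
  obtain ⟨C₀, hC₀, hmain⟩ := hN.exists_mixedNorm_powDiff_le hψc hK hn0 hp hp'
  set c : ℝ≥0∞ := 2 * ∫⁻ y, ‖K y‖ₑ with hc
  have hct : c ≠ ⊤ := ENNReal.mul_ne_top (by norm_num) (K.integrable (μ := volume)).2.ne
  set x : ℝ := σ - 1 / 2 with hx
  have hx0 : 0 < x := by rw [hx]; linarith
  set q : ℝ := 1 / NLKG.pExp d with hq
  have hq0 : 0 < q := by positivity
  have h1two : ∀ {y : ℝ}, 0 ≤ y → 1 ≤ (2 : ℝ) ^ y := fun hy => Real.one_le_rpow (by norm_num) hy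
  -- `a` collects the factors free of `α`, and `b` the bases of `α`-th powers, from `α + 4 ≤ 4 ·
  -- 2^α` and from the shifts `2^{xM}` and `2^{qM}` with `M = α + 2`.
  set a : ℝ := 4 * (2 : ℝ) ^ (2 * x) * (1 + c.toReal) * 2 ^ n * 2 ^ (2 * q) with ha
  set b : ℝ := 2 * (2 : ℝ) ^ x * 2 ^ q with hb
  have hc0 : 0 ≤ c.toReal := ENNReal.toReal_nonneg
  have ha1 : 1 ≤ a := by
    rw [ha]
    have := one_le_mul_of_one_le_of_one_le (one_le_mul_of_one_le_of_one_le
      (one_le_mul_of_one_le_of_one_le (one_le_mul_of_one_le_of_one_le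
      (by norm_num : (1 : ℝ) ≤ 4) (h1two (by positivity : 0 ≤ 2 * x)))
      (by linarith : 1 ≤ 1 + c.toReal)) (h1two hn0.le)) (h1two (by positivity : 0 ≤ 2 * q))
    exact this
  have hb1 : 1 ≤ b := one_le_mul_of_one_le_of_one_le (one_le_mul_of_one_le_of_one_le
      (by norm_num : (1 : ℝ) ≤ 2) (h1two hx0.le)) (h1two hq0.le)
  refine ⟨a * b * C₀, one_le_mul_of_one_le_of_one_le (one_le_mul_of_one_le_of_one_le ha1 hb1) hC₀, ?_⟩
  intro α hα _ s _ lam hlam vhat hv hl ho p P P' low σc δ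
  have hα0 : (0 : ℝ) < α := hn0.trans_le hα
  have hr : 1 ≤ Real.sqrt α := by
    rw [Real.one_le_sqrt]
    have : 0 < α := by exact_mod_cast hα0
    exact_mod_cast this
  have hσc : σc = d / 2 - 2 / α := rfl
  -- The decay rate required by the interpolation is the regularity of the `L^p` norms in the claim.
  have hκ : 2 / n - 2 / (α : ℝ) = σc - 1 / 2 := by rw [h2n, hσc]; ring
  have hδ : δ = 1 / 2 - q := rfl
  have hκδ : σc - 1 / 2 ≤ σc - δ := by rw [hδ]; linarith
  set Q := ENNReal.ofReal ((C₀ * Real.sqrt α) ^ ((α : ℝ) + C₀)) with hQ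
  set Z := NLKG.tildeNorm ψ ∞ 2 2 σc s Set.univ vhat ^ ((α : ℝ) - n) with hZ
  set Yl := NLKG.tildeNorm ψ P P 2 (σc - δ) s low vhat with hYl
  set Y := max (NLKG.tildeNorm ψ P P 2 (σc - 1 / 2) s lowᶜ vhat) Yl with hY
  set M : ℕ := α + 2 with hM
  have hD : ∀ j, NLKG.mixedNorm P' P' (fun t => NLKG.powDiff ψ s α j (vhat t)) ≤
      Q * Z * (NLKG.pieceNorm ψ p s j vhat * NLKG.partNorm ψ p (σc - 1 / 2) s (j + 1) vhat ^ n) := by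
    intro j
    have := hmain α hα s j vhat hv hl
    rwa [hκ] at this
  have hband := NLKG.tsum_band_split_le low M (NLKG.pow2 (x * M) * c * Q * Z) ((2 * Y) ^ n)
    (NLKG.pow2 (q * M) * ENNReal.ofReal (lam ^ (-1 / p)) * Yl ^ n)
    (fun k => NLKG.pow2 (x * k) *
      NLKG.mixedNorm P' P' fun t => NLKG.expDelta ψ s k (NLKG.convPow (vhat t) α))
    (fun j => NLKG.pow2 (x * j) * NLKG.pieceNorm ψ p s j vhat)
    (fun j => NLKG.pow2 ((σ - δ) * j) * NLKG.pieceNorm ψ p s j vhat) (by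
    intro k hk
    refine (mul_le_mul_right (hN.mixedNorm_expDelta_convPow_le hψc hK s k α hv hl ho hp'1) _).trans ?_
    rw [Finset.mul_sum]
    refine Finset.sum_le_sum fun j hj => ?_
    have hkj : (k : ℝ) ≤ j + M := by exact_mod_cast (Finset.mem_filter.1 hj).2
    -- As `x = σ - 1/2` is positive, the weight moves from `k` to `j` within the band at the cost
    -- `2^{xM}`.
    have hpk : NLKG.pow2 (x * k) ≤ NLKG.pow2 (x * M) * NLKG.pow2 (x * j) := by
      rw [← NLKG.pow2_add]
      exact NLKG.pow2_mono (by nlinarith)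
    calc NLKG.pow2 (x * k) * (c * NLKG.mixedNorm P' P' (fun t => NLKG.powDiff ψ s α j (vhat t)))
        ≤ (NLKG.pow2 (x * M) * NLKG.pow2 (x * j)) * (c * (Q * Z * (NLKG.pieceNorm ψ p s j vhat *
            NLKG.partNorm ψ p (σc - 1 / 2) s (j + 1) vhat ^ n))) := by
          gcongr
          exact hD j
      _ = NLKG.pow2 (x * M) * c * Q * Z * (NLKG.pow2 (x * j) * NLKG.pieceNorm ψ p s j vhat *
            NLKG.partNorm ψ p (σc - 1 / 2) s (j + 1) vhat ^ n) := by ring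
      _ ≤ _ := by
          refine mul_le_mul_right ?_ _
          -- For low `j` every `i ≤ j` is low as well, so the increment is controlled by
          -- low-frequency norms alone.
          by_cases hjl : j ∈ low
          · rw [Set.indicator_of_notMem (by simpa using hjl), Set.indicator_of_mem hjl, zero_add]
            have hsub : ∀ i < j + 1, i ∈ low := by
              intro i hi
              have h1 : (j : ℝ) ≤ Real.logb 2 lam := hjl
              have h2 : (i : ℝ) ≤ j := by exact_mod_cast Nat.lt_succ_iff.1 hi
              exact h2.trans h1
            have hlk : NLKG.pow2 (-(q * k)) ≤ ENNReal.ofReal (lam ^ (-1 / p)) := by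
              refine ENNReal.ofReal_le_ofReal ?_
              have hk' : ¬ ((k : ℝ) ≤ Real.logb 2 lam) := hk
              have h1 : Real.logb 2 lam ≤ k := (not_le.1 hk').le
              have h2 : lam ^ (-q) = ((2 : ℝ) ^ Real.logb 2 lam) ^ (-q) := by
                rw [Real.rpow_logb (by norm_num) (by norm_num) (by linarith)]
              have e : -1 / p = -q := by
                rw [hq]; change -1 / p = -(1 / p); ring
              rw [e]
              rw [h2, ← Real.rpow_mul (by norm_num)]
              exact Real.rpow_le_rpow_of_exponent_le (by norm_num) (by nlinarith)
            -- Because `x = (σ - δ) - q`, passing to the weight `2^{(σ-δ)j}` leaves `2^{-qj} ≤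
            -- 2^{qM} 2^{-qk}`. As `k` is high, `2^{-qk}` is at most `λ^{-1/p}`.
            have hpj : NLKG.pow2 (x * j) ≤ NLKG.pow2 ((σ - δ) * j) * (NLKG.pow2 (q * M) *
                NLKG.pow2 (-(q * k))) := by
              rw [← NLKG.pow2_add, ← NLKG.pow2_add]
              refine NLKG.pow2_mono ?_
              rw [hδ, hx]; nlinarith
            calc _ ≤ (NLKG.pow2 ((σ - δ) * j) * (NLKG.pow2 (q * M) *
                    ENNReal.ofReal (lam ^ (-1 / p)))) * NLKG.pieceNorm ψ p s j vhat * Yl ^ n := by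
                  gcongr
                  · exact hpj.trans (by gcongr)
                  · exact NLKG.partNorm_le_of_subset hκδ hsub vhat
              _ = _ := by ring
          -- For high `j` the pieces `i ≤ j` may be low or high, which is why the maximum of two
          -- norms appears.
          · rw [Set.indicator_of_mem (by simpa using hjl), Set.indicator_of_notMem hjl, add_zero,
              mul_comm ((2 * Y) ^ n)]
            gcongr
            exact NLKG.partNorm_le_two_mul_max hκδ _ _ vhat)
  have hconst : ((M : ℝ≥0∞) + 2) * (NLKG.pow2 (x * M) * c * Q) * (2 ^ n * NLKG.pow2 (q * M)) ≤
      ENNReal.ofReal ((a * b * C₀ * Real.sqrt α) ^ ((α : ℝ) + a * b * C₀)) := by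
    refine le_trans ?_ (ENNReal.ofReal_le_ofReal (NLKG.absorb_const (α := α) ha1 hb1 hC₀ hr))
    have hM4 : (M : ℝ≥0∞) + 2 ≤ ENNReal.ofReal (4 * 2 ^ (α : ℝ)) := by
      have h1 : ((α : ℝ) + 1) ≤ 2 ^ (α : ℝ) := by
        rw [Real.rpow_natCast]; exact_mod_cast Nat.lt_two_pow_self
      rw [hM, show (((α + 2 : ℕ) : ℝ≥0∞) + 2) = ENNReal.ofReal (((α + 2 : ℕ) : ℝ) + 2) by
        rw [ENNReal.ofReal_add (by positivity) (by norm_num), ENNReal.ofReal_natCast]; norm_num]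
      refine ENNReal.ofReal_le_ofReal ?_
      push_cast; linarith
    have hcc : c ≤ ENNReal.ofReal (1 + c.toReal) := by
      nth_rw 1 [← ENNReal.ofReal_toReal hct]
      exact ENNReal.ofReal_le_ofReal (by linarith)
    have h2e : (2 : ℝ≥0∞) ^ n = ENNReal.ofReal (2 ^ n) := by
      rw [← ENNReal.ofReal_rpow_of_pos (by norm_num)]; norm_num
    have hxM : (2 : ℝ) ^ (x * M) = 2 ^ (2 * x) * (2 ^ x) ^ (α : ℝ) := by
      rw [← Real.rpow_mul (by norm_num), ← Real.rpow_add (by norm_num), hM]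
      congr 1; push_cast; ring
    have hqM : (2 : ℝ) ^ (q * M) = 2 ^ (2 * q) * (2 ^ q) ^ (α : ℝ) := by
      rw [← Real.rpow_mul (by norm_num), ← Real.rpow_add (by norm_num), hM]
      congr 1; push_cast; ring
    calc ((M : ℝ≥0∞) + 2) * (NLKG.pow2 (x * M) * c * Q) * (2 ^ n * NLKG.pow2 (q * M))
        ≤ ENNReal.ofReal (4 * 2 ^ (α : ℝ)) * (NLKG.pow2 (x * M) * ENNReal.ofReal (1 + c.toReal) * Q) *
            (2 ^ n * NLKG.pow2 (q * M)) := by gcongr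
      _ = _ := by
        rw [h2e, hQ, NLKG.pow2, NLKG.pow2, hxM, hqM, ← ENNReal.ofReal_mul (by positivity),
          ← ENNReal.ofReal_mul (by positivity), ← ENNReal.ofReal_mul (by positivity),
          ← ENNReal.ofReal_mul (by positivity), ← ENNReal.ofReal_mul (by positivity)]
        congr 1
        rw [ha, hb, Real.mul_rpow (x := 2 * (2 : ℝ) ^ x) (y := (2 : ℝ) ^ q) (by positivity)
          (by positivity), Real.mul_rpow (x := (2 : ℝ)) (y := (2 : ℝ) ^ x) (by positivity)
          (by positivity)]
        ring
  set X := NLKG.tildeNorm ψ P P 2 x s lowᶜ vhat with hX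
  set X' := NLKG.tildeNorm ψ P P 2 (σ - δ) s low vhat with hX'
  have h1n : (1 : ℝ≥0∞) ≤ 2 ^ n := ENNReal.one_le_rpow (by norm_num) hn0
  have h1q : 1 ≤ NLKG.pow2 (q * M) := by
    rw [← NLKG.pow2_zero]; exact NLKG.pow2_mono (by positivity)
  calc NLKG.tildeNorm ψ P' P' 2 x s lowᶜ (fun t => NLKG.convPow (vhat t) α)
      ≤ ((M : ℝ≥0∞) + 2) * (NLKG.pow2 (x * M) * c * Q * Z) * ((2 * Y) ^ n * X +
          NLKG.pow2 (q * M) * ENNReal.ofReal (lam ^ (-1 / p)) * Yl ^ n * X') := hband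
    _ ≤ ((M : ℝ≥0∞) + 2) * (NLKG.pow2 (x * M) * c * Q * Z) * ((2 ^ n * NLKG.pow2 (q * M)) *
          (X * Y ^ n + ENNReal.ofReal (lam ^ (-1 / p)) * X' * Yl ^ n)) := by
        refine mul_le_mul_right ?_ _
        rw [mul_add, ENNReal.mul_rpow_of_nonneg _ _ hn0.le]
        refine add_le_add ?_ ?_
        · calc 2 ^ n * Y ^ n * X = 2 ^ n * 1 * (X * Y ^ n) := by ring
            _ ≤ _ := by gcongr
        · calc NLKG.pow2 (q * M) * ENNReal.ofReal (lam ^ (-1 / p)) * Yl ^ n * X' =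
                1 * NLKG.pow2 (q * M) * (ENNReal.ofReal (lam ^ (-1 / p)) * X' * Yl ^ n) := by ring
            _ ≤ _ := by gcongr
    _ = ((M : ℝ≥0∞) + 2) * (NLKG.pow2 (x * M) * c * Q) * (2 ^ n * NLKG.pow2 (q * M)) *
          (X * Y ^ n + ENNReal.ofReal (lam ^ (-1 / p)) * X' * Yl ^ n) * Z := by ring
    _ ≤ _ := by gcongr
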